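/- Let $d,n\ge 1$, let $\Omega\subset\mathbb R^d$ be a bounded open set, let $x_1,\dots,x_n\in\Omega$ be fixed sample points and $f$ a real function (only the values $f(x_i)$ enter). Write $a(u,v)=\int_\Omega\nabla u\cdot\nabla v\,dx$ and $\|v\|_a=a(v,v)^{1/2}$ on $H^1_0(\Omega)$, and consider the Dirichlet problem with Dirac source $$-\Delta u=\frac1n\sum_{i=1}^n f(x_i)\,\delta(x-x_i)\ \text{ in }\Omega,\qquad u=0\ \text{ on }\partial\Omega. \tag{P}$$ A solution of (P) is a function $u\in L^1(\Omega)$ with $\int_\Omega u\,g\,dx=\frac1n\sum_i f(x_i)w(x_i)$ whenever $g\in L^\infty(\Omega)$ and $w\in H^1_0(\Omega)\cap C(\Omega)$ is a weak solution of $-\Delta w=g$ (solution by transposition). For each $N\in\mathbb N$ let $\phi^N_1,\dots,\phi^N_{m_N}\in H^1_0(\Omega)\cap C(\Omega)$ be linearly independent, with span $U_N$ (the bases need not be nested), and consider the Ritz–Galerkin scheme with Monte Carlo right-hand side $$u_N=\sum_{k=1}^{m_N}c_k\phi^N_k,\qquad \sum_{k=1}^{m_N}c_k\,a(\phi^N_k,\phi^N_j)=\frac1n\sum_{i=1}^n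 f(x_i)\phi^N_j(x_i),\quad j=1,\dots,m_N. \tag{RG}$$ Call $(U_N)$ *complete* if for every $w\in H^1_0(\Omega)$ there are $v_N\in U_N$ with $\|w-v_N\|_a\to0$. Say that $(U_N)$ *approximates at* $y\in\Omega$ if there are constants $K_N$ with $|v(y)|\le K_N\|v\|_a$ for all $v\in U_N$, such that for every $w\in H^1_0(\Omega)\cap C(\Omega)$ that is a weak solution of $-\Delta w=g$ with $g\in C_c^\infty(\Omega)$ there are $v_N\in U_N$ with $v_N(y)\to w(y)$ and $K_N\|w-v_N\|_a\to0$. Either property forces the number $m_N$ of basis functions to tend to infinity. Then: 1. Problem (P) has a solution $u$, unique up to null sets. It satisfies $-\Delta u=\frac1n\sum_i f(x_i)\delta_{x_i}$ in the sense of distributions on $\Omega$; $(1-\chi)u\in H^1_0(\Omega)$ for every $\chi\in C_c^\infty(\Omega)$ that equals $1$ near all sample points; and, for a suitable representative, which is used below, $u$ is continuous on $\Omega\setminus\{x_1,\dots,x_n\}$. 2. The system (RG) has exactly one solution for every $N$. If $(U_N)$ approximates at every sample point $x_i$, then $u_N\to u$ in the sense of distributions, i.e. $\int_\Omega u_N\,g\,dx\to\int_\Omega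 u\,g\,dx$ for all $g\in C_c^\infty(\Omega)$. If $d=1$ and $(U_N)$ is complete, then $\|u-u_N\|_a\to0$ and $u_N\to u$ uniformly on $\Omega$. 3. If $\Omega=\prod_{j=1}^d(a_j,b_j)$ is a box, these hypotheses hold for the Fourier basis $\prod_{j}\sin\frac{k_j\pi(y_j-a_j)}{b_j-a_j}$, $1\le k_j\le N$: its members are linearly independent and lie in $H_0^1(\Omega)\cap C(\Omega)$, and the spaces $U_N$ are complete and approximate at every point of $\Omega$. 4. If $d=1$, then $u\in H^1_0(\Omega)$ and $a(u,v)=\frac1n\sum_i f(x_i)v(x_i)$ for all $v\in H^1_0(\Omega)\cap C(\Omega)$; and if $\Omega=(a,b)$, then $u$ is the piecewise linear function $$u(x)=\frac1n\sum_{i=1}^n f(x_i)(b-x_i)\frac{x-a}{b-a}-\frac1n\sum_{i=1}^n f(x_i)(x-x_i)H(x-x_i),\qquad H(t)=\begin{cases}0,&t<0\\1,&t\ge0.\end{cases}$$ 5. If $d=2$, then $u$ is singular at the sample points: $|u(x)|\to\infty$ as $x\to x_i$, $x\neq x_i$, for every $i$ with $f(x_i)\ne0$. -/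

import Mathlib

open MeasureTheory Set Filter Topology
open scoped ContDiff ENNReal

noncomputable section

namespace RitzGalerkin

/-- The Euclidean space `ℝ^d`. -/
abbrev E (d : ℕ) : Type := EuclideanSpace ℝ (Fin d)

/-- `ψ ∈ C_c^∞(Ω)`. -/
def IsTest {d : ℕ} (Ω : Set (E d)) (ψ : E d → ℝ) : Prop :=
  ContDiff ℝ ∞ ψ ∧ HasCompactSupport ψ ∧ tsupport ψ ⊆ Ω

/-- `G` is a weak gradient of `v` on `Ω`. -/
def HasWeakGrad {d : ℕ} (Ω : Set (E d)) (v : E d → ℝ) (G : E d → E d) : Prop :=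
  LocallyIntegrableOn v Ω ∧ LocallyIntegrableOn G Ω ∧
    ∀ ψ : E d → ℝ, IsTest Ω ψ →
      ∫ y in Ω, v y • gradient ψ y = - ∫ y in Ω, ψ y • G y

open Classical in
/-- The weak gradient of `v` on `Ω` (unique up to a null set when it exists; `0` when it does not). -/
def weakGrad {d : ℕ} (Ω : Set (E d)) (v : E d → ℝ) : E d → E d :=
  if h : ∃ G, HasWeakGrad Ω v G then h.choose else 0

/-- `v ∈ H¹(Ω)`. -/
def MemH1 {d : ℕ} (Ω : Set (E d)) (v : E d → ℝ) : Prop :=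
  MemLp v 2 (volume.restrict Ω) ∧
    ∃ G, HasWeakGrad Ω v G ∧ MemLp G 2 (volume.restrict Ω)

/-- `v ∈ H¹₀(Ω)`: the closure of `C_c^∞(Ω)` in `H¹(Ω)`. -/
def MemH10 {d : ℕ} (Ω : Set (E d)) (v : E d → ℝ) : Prop :=
  MemH1 Ω v ∧ ∃ ψ : ℕ → E d → ℝ, (∀ j, IsTest Ω (ψ j)) ∧
    Tendsto (fun j => eLpNorm (v - ψ j) 2 (volume.restrict Ω)) atTop (𝓝 0) ∧
    Tendsto (fun j => eLpNorm (weakGrad Ω v - gradient (ψ j)) 2 (volume.restrict Ω)) atTop (𝓝 0)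

/-- The Dirichlet form `a(u, v) = ∫_Ω ∇u · ∇v`. -/
def energy {d : ℕ} (Ω : Set (E d)) (u v : E d → ℝ) : ℝ :=
  ∫ y in Ω, inner ℝ (weakGrad Ω u y) (weakGrad Ω v y)

/-- The energy norm `a(v, v)^{1/2} = ‖∇v‖_{L²(Ω)}`. -/
def energyNorm {d : ℕ} (Ω : Set (E d)) (v : E d → ℝ) : ℝ :=
  √(energy Ω v v)

/-- The discrete source `(1/n) ∑ᵢ f(xᵢ) δ_{xᵢ}`, applied to `v`. -/
def sampleSum {d n : ℕ} (x : Fin n → E d) (f v : E d → ℝ) : ℝ :=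
  (1 / (n : ℝ)) * ∑ i, f (x i) * v (x i)

/-- `w` is the (continuous representative of the) weak solution in `H¹₀(Ω)` of `-Δ w = g`. -/
def IsWeakSolution {d : ℕ} (Ω : Set (E d)) (g w : E d → ℝ) : Prop :=
  MemH10 Ω w ∧ ContinuousOn w Ω ∧
    ∀ v, MemH10 Ω v → energy Ω w v = ∫ y in Ω, g y * v y

/-- `u` is the very weak solution (solution by transposition) of
`-Δ u = (1/n) ∑ᵢ f(xᵢ) δ_{xᵢ}` in `Ω`, `u = 0` on `∂Ω`: `u ∈ L¹(Ω)`, and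
`∫_Ω u (-Δ w) = (1/n) ∑ᵢ f(xᵢ) w(xᵢ)` for all continuous `w ∈ H¹₀(Ω)` with `Δ w ∈ L^∞(Ω)`. -/
def IsDeltaSolution {d n : ℕ} (Ω : Set (E d)) (x : Fin n → E d) (f u : E d → ℝ) : Prop :=
  IntegrableOn u Ω ∧
    ∀ g w : E d → ℝ, MemLp g ∞ (volume.restrict Ω) → IsWeakSolution Ω g w →
      ∫ y in Ω, u y * g y = sampleSum x f w

/-- A finite family of basis functions of a conforming Ritz–Galerkin method: continuous functions in
`H¹₀(Ω)`, linearly independent as functions on `Ω`. -/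
def IsTrialBasis {d : ℕ} {ι : Type} (Ω : Set (E d)) (φ : ι → E d → ℝ) : Prop :=
  (∀ k, MemH10 Ω (φ k) ∧ ContinuousOn (φ k) Ω) ∧ LinearIndependent ℝ (fun k (y : Ω) => φ k y)

/-- `c` solves the Ritz–Galerkin system with sampled right-hand side,
`∑ₖ cₖ a(φₖ, φⱼ) = (1/n) ∑ᵢ f(xᵢ) φⱼ(xᵢ)` for all `j`. -/
def IsRGCoeff {d n : ℕ} {ι : Type} [Fintype ι] (Ω : Set (E d)) (x : Fin n → E d) (f : E d → ℝ)
    (φ : ι → E d → ℝ) (c : ι → ℝ) : Prop :=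
  ∀ j, ∑ k, c k * energy Ω (φ k) (φ j) = sampleSum x f (φ j)

/-- The trial spaces `U_N = span φ_N` exhaust `H¹₀(Ω)` in the limit. -/
def IsCompleteFamily {d : ℕ} {ι : ℕ → Type} (Ω : Set (E d)) (φ : ∀ N, ι N → E d → ℝ) : Prop :=
  ∀ w, MemH10 Ω w → ∃ v : ℕ → E d → ℝ, (∀ N, v N ∈ Submodule.span ℝ (range (φ N))) ∧
    Tendsto (fun N => energyNorm Ω (w - v N)) atTop (𝓝 0)

/-- Approximation with point values: if `K_N` bounds evaluation at `y` on the trial space `U_N`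
with respect to the energy norm (inverse inequality), then every `w ∈ H¹₀(Ω)` with
`Δ w ∈ C_c^∞(Ω)` is approximated by some `v_N ∈ U_N` at the point `y`, and in the energy norm
faster than `K_N` grows. -/
def ApproximatesAt {d : ℕ} {ι : ℕ → Type} (Ω : Set (E d)) (φ : ∀ N, ι N → E d → ℝ) (y : E d) :
    Prop :=
  ∃ K : ℕ → ℝ,
    (∀ N, ∀ v ∈ Submodule.span ℝ (range (φ N)), |v y| ≤ K N * energyNorm Ω v) ∧
    ∀ g w, IsTest Ω g → IsWeakSolution Ω g w →
      ∃ v : ℕ → E d → ℝ, (∀ N, v N ∈ Submodule.span ℝ (range (φ N))) ∧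
        Tendsto (fun N => v N y) atTop (𝓝 (w y)) ∧
        Tendsto (fun N => K N * energyNorm Ω (w - v N)) atTop (𝓝 0)

/-- The Fourier basis on the box `∏ⱼ (aⱼ, bⱼ)` with modes `1, …, N` in each direction. -/
def sineBasis {d : ℕ} (a b : Fin d → ℝ) (N : ℕ) (k : Fin d → Fin N) (y : E d) : ℝ :=
  ∏ j, Real.sin ((((k j : ℕ) : ℝ) + 1) * Real.pi * (y j - a j) / (b j - a j))

/-- The Heaviside step function. -/
def heaviside (t : ℝ) : ℝ := if t < 0 then 0 else 1

end RitzGalerkin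

end

open RitzGalerkin

/-!
# Dirac sources, Green functions and Ritz–Galerkin schemes

By linearity everything reduces to the Green function `𝒢_z` of `Ω` with a pole `z ∈ Ω`. It is built
as a compactly supported parametrix plus a weak solution with smooth data. Superposing radial
profiles over the scales `t ∈ (ε, r)` gives functions `Φ_{ε,r}` (`green`) with
`-Δ Φ_{ε,r} = η_ε - η_r`, where `η_t` is an unnormalised mollifier of mass `mass d`
(`laplacian_green`); they are smooth for `ε > 0`, increase to the parametrix `Φ_{0,r}`, and converge
to it in `L¹`. If `v ∈ H¹₀(Ω)` solves `-Δ v = η_r(· - z)` (Lax–Milgram, `exists_isH0_weak`), then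
`𝒢_z = (Φ_{0,r}(· - z) + v) / mass d` has `-Δ 𝒢_z = δ_z`. Testing the equation of a weak solution
with `Φ_{ε,r}` yields at the same time interior regularity (`exists_continuousOn_of_laplacian_eq`)
and the transposition identity `∫ 𝒢_z g = w(z)` for `-Δ w = g` (`exists_isGreenFunction`). The
solution is the superposition `u = (1/n) ∑ᵢ f(xᵢ) 𝒢_{xᵢ}` (`sampleCombination`); it is unique,
because every test function is the right-hand side of some weak solution.

The parametrix is explicit enough for the two special dimensions. For `d = 2` it is bounded below by
a multiple of `-log |y - z|` near the pole (`tendsto_green_atTop`). For `d = 1` the truncations are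
Cauchy in the Dirichlet norm, so that `𝒢_z ∈ H¹₀(Ω)` (`memH10_green_zero`); the same truncations
give the Sobolev inequality (`exists_sobolev_of_dim_one`). On an interval, the weak equation for `u`
is tested with a smoothed piecewise linear Green function with pole `y`: the Dirichlet product with
`u` is a mollification of `u` at `y`, and the limit is the explicit formula
(`tendsto_energy_smoothHat`, `eq_sum_hat_of_energy_eq`).

The Galerkin matrix is invertible because a function with vanishing Dirichlet energy is zero
(Poincaré). Convergence in the sense of distributions comes from the discrete Green functions
`G_N ∈ U_N`, `a(G_N, v) = v(y)` on `U_N`: testing with `G_N` itself gives the stability bound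
`‖G_N‖_a ≤ K_N`, so that `a(w, G_N) = v_N(y) + a(w - v_N, G_N) → w(y)`
(`tendsto_energy_galerkin_delta`). For `d = 1` Céa's lemma and the Sobolev inequality suffice
(`tendsto_galerkin_of_dim_one`).

The Fourier modes of a box lie in `H¹₀` because they are dominated by a smooth function that is
positive in the box and vanishes on its boundary (`isH0_of_le_boundary`). They are orthogonal, and
total in `L²` by the Stone–Weierstrass theorem, since multiplication by cosines preserves their span
(`ae_eq_zero_of_integral_sineMode_eq_zero`). For data `g ∈ C_c^∞` the coefficients decay faster than
any power, because those of `(-Δ)^s g` are the coefficients of `g` times the `s`-th powers of the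
eigenvalues; this beats the polynomial growth of the constants `K_N` in the inverse inequality
(`exists_abs_le_energyNorm`) and gives approximation at every point (`approximatesAt_sineBasis`).
-/

open MeasureTheory Set Filter Topology
open scoped ContDiff ENNReal

namespace RitzGalerkin

/-! ### Partial derivatives and test functions -/

/-- The partial derivative `∂ⱼ F`. -/
noncomputable def pderiv {d : ℕ} (j : Fin d) (F : E d → ℝ) (y : E d) : ℝ :=
  fderiv ℝ F y (EuclideanSpace.single j 1)

theorem gradient_apply {d : ℕ} (F : E d → ℝ) (y : E d) (j : Fin d) :
    gradient F y j = pderiv j F y := by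
  have h := inner_gradient_left (𝕜 := ℝ) (f := F) (x := y) (y := EuclideanSpace.single j (1 : ℝ))
  rw [EuclideanSpace.inner_single_right] at h
  simpa [pderiv] using h

theorem contDiff_pderiv {d : ℕ} {F : E d → ℝ} (hF : ContDiff ℝ ∞ F) (j : Fin d) :
    ContDiff ℝ ∞ (pderiv j F) :=
  (hF.fderiv_right (m := ∞) (by simp)).clm_apply contDiff_const

theorem continuous_gradient {d : ℕ} {F : E d → ℝ} (hF : ContDiff ℝ ∞ F) :
    Continuous (gradient F) :=
  (InnerProductSpace.toDual ℝ (E d)).symm.continuous.comp (hF.continuous_fderiv (by simp))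

theorem laplacian_eq_sum {d : ℕ} {F : E d → ℝ} (hF : ContDiff ℝ ∞ F) (y : E d) :
    Laplacian.laplacian F y = ∑ j, pderiv j (pderiv j F) y := by
  rw [InnerProductSpace.laplacian_eq_iteratedFDeriv_orthonormalBasis F
    (EuclideanSpace.basisFun (Fin d) ℝ)]
  refine Finset.sum_congr rfl fun j _ => ?_
  rw [iteratedFDeriv_two_apply]
  have h : DifferentiableAt ℝ (fderiv ℝ F) y :=
    ((hF.fderiv_right (m := ∞) (by simp)).differentiable (by simp)).differentiableAt
  have h2 : pderiv j F = fun z => (fderiv ℝ F z) (EuclideanSpace.single j 1) := rfl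
  rw [pderiv, h2, fderiv_clm_apply h (differentiableAt_const _)]
  simp

theorem contDiff_laplacian {d : ℕ} {F : E d → ℝ} (hF : ContDiff ℝ ∞ F) :
    ContDiff ℝ ∞ (Laplacian.laplacian F) := by
  have : Laplacian.laplacian F = fun y => ∑ j, pderiv j (pderiv j F) y :=
    funext (laplacian_eq_sum hF)
  rw [this]
  exact ContDiff.sum fun j _ => contDiff_pderiv (contDiff_pderiv hF j) j

theorem tsupport_pderiv_subset {d : ℕ} (F : E d → ℝ) (j : Fin d) :
    tsupport (pderiv j F) ⊆ tsupport F := by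
  refine closure_minimal (fun y hy => ?_) (isClosed_tsupport F)
  by_contra h
  have : F =ᶠ[𝓝 y] fun _ => 0 := notMem_tsupport_iff_eventuallyEq.1 h
  exact hy (by simp [pderiv, this.fderiv_eq])

theorem tsupport_gradient_subset {d : ℕ} (F : E d → ℝ) :
    tsupport (gradient F) ⊆ tsupport F := by
  refine closure_minimal (fun y hy => ?_) (isClosed_tsupport F)
  by_contra h
  have : F =ᶠ[𝓝 y] fun _ => 0 := notMem_tsupport_iff_eventuallyEq.1 h
  exact hy (by ext j; simp [gradient_apply, pderiv, this.fderiv_eq])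

section IsTest

variable {d : ℕ} {Ω : Set (E d)} {ψ ψ' : E d → ℝ}

theorem IsTest.pderiv (hψ : IsTest Ω ψ) (j : Fin d) : IsTest Ω (pderiv j ψ) :=
  ⟨contDiff_pderiv hψ.1 j, hψ.2.1.of_isClosed_subset (isClosed_tsupport _)
    (tsupport_pderiv_subset ψ j), (tsupport_pderiv_subset ψ j).trans hψ.2.2⟩

theorem IsTest.add (hψ : IsTest Ω ψ) (hψ' : IsTest Ω ψ') : IsTest Ω (ψ + ψ') :=
  ⟨hψ.1.add hψ'.1, hψ.2.1.add hψ'.2.1,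
    (tsupport_add ψ ψ').trans (union_subset hψ.2.2 hψ'.2.2)⟩

theorem IsTest.mul_left {θ : E d → ℝ} (hθ : ContDiff ℝ ∞ θ) (hψ : IsTest Ω ψ) :
    IsTest Ω (θ * ψ) :=
  ⟨hθ.mul hψ.1, hψ.2.1.mul_left, (tsupport_mul_subset_right).trans hψ.2.2⟩

theorem IsTest.const_smul (c : ℝ) (hψ : IsTest Ω ψ) : IsTest Ω (c • ψ) :=
  IsTest.mul_left (θ := fun _ => c) contDiff_const hψ

theorem isTest_zero : IsTest Ω (0 : E d → ℝ) :=
  ⟨contDiff_const, HasCompactSupport.zero, by simp [tsupport]⟩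

theorem IsTest.laplacian (hψ : IsTest Ω ψ) : IsTest Ω (Laplacian.laplacian ψ) := by
  have hs : tsupport (Laplacian.laplacian ψ) ⊆ tsupport ψ := by
    refine closure_minimal (fun y hy => ?_) (isClosed_tsupport ψ)
    by_contra h
    refine hy ?_
    rw [laplacian_eq_sum hψ.1]
    refine Finset.sum_eq_zero fun j _ => ?_
    by_contra h2
    exact h (tsupport_pderiv_subset ψ j (tsupport_pderiv_subset _ j (subset_tsupport _ h2)))
  exact ⟨contDiff_laplacian hψ.1, hψ.2.1.of_isClosed_subset (isClosed_tsupport _) hs,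
    hs.trans hψ.2.2⟩

theorem IsTest.setIntegral_eq (hψ : IsTest Ω ψ) {V : Type*} [NormedAddCommGroup V]
    [NormedSpace ℝ V] {h : E d → V} (hh : ∀ y, ψ y = 0 → h y = 0) :
    ∫ y in Ω, h y = ∫ y, h y :=
  setIntegral_eq_integral_of_forall_compl_eq_zero fun y hy =>
    hh y (image_eq_zero_of_notMem_tsupport fun h => hy (hψ.2.2 h))

/-- Integration by parts, one of the two functions having compact support. -/
theorem integral_mul_pderiv {θ : E d → ℝ} (hψ : ContDiff ℝ ∞ ψ) (hc : HasCompactSupport ψ)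
    (hθ : ContDiff ℝ ∞ θ) (j : Fin d) :
    ∫ y, ψ y * pderiv j θ y = - ∫ y, pderiv j ψ y * θ y := by
  have hc' : HasCompactSupport (RitzGalerkin.pderiv j ψ) :=
    hc.of_isClosed_subset (isClosed_tsupport _) (tsupport_pderiv_subset ψ j)
  refine integral_mul_fderiv_eq_neg_fderiv_mul_of_integrable ?_ ?_ ?_
    (fun y _ => (hψ.differentiable (by simp)).differentiableAt)
    (fun y _ => (hθ.differentiable (by simp)).differentiableAt)
  · exact ((contDiff_pderiv hψ j).continuous.mul hθ.continuous).integrable_of_hasCompactSupport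
      hc'.mul_right
  · exact (hψ.continuous.mul (contDiff_pderiv hθ j).continuous).integrable_of_hasCompactSupport
      hc.mul_right
  · exact (hψ.continuous.mul hθ.continuous).integrable_of_hasCompactSupport hc.mul_right

theorem IsTest.continuous_gradient (hψ : IsTest Ω ψ) : Continuous (gradient ψ) :=
  RitzGalerkin.continuous_gradient hψ.1

theorem IsTest.hasCompactSupport_gradient (hψ : IsTest Ω ψ) : HasCompactSupport (gradient ψ) :=
  hψ.2.1.of_isClosed_subset (isClosed_tsupport _) (tsupport_gradient_subset ψ)

theorem IsTest.memLp (hψ : IsTest Ω ψ) (p : ℝ≥0∞) : MemLp ψ p (volume.restrict Ω) :=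
  (hψ.1.continuous.memLp_of_hasCompactSupport hψ.2.1).restrict Ω

theorem IsTest.memLp_gradient (hψ : IsTest Ω ψ) (p : ℝ≥0∞) :
    MemLp (gradient ψ) p (volume.restrict Ω) :=
  (hψ.continuous_gradient.memLp_of_hasCompactSupport hψ.hasCompactSupport_gradient).restrict Ω

/-- Integration by parts on `Ω` for a test function against a smooth function. -/
theorem IsTest.integral_smul_gradient {θ : E d → ℝ} (hψ : IsTest Ω ψ) (hθ : ContDiff ℝ ∞ θ) :
    ∫ y in Ω, θ y • gradient ψ y = - ∫ y in Ω, ψ y • gradient θ y := by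
  have h0 : ∀ y, ψ y = 0 → ψ y • gradient θ y = 0 := fun y h => by simp [h]
  have h1 : ∫ y in Ω, θ y • gradient ψ y = ∫ y, θ y • gradient ψ y := by
    refine setIntegral_eq_integral_of_forall_compl_eq_zero fun y hy => ?_
    rw [image_eq_zero_of_notMem_tsupport (f := gradient ψ), smul_zero]
    exact fun h => hy (hψ.2.2 (tsupport_gradient_subset ψ h))
  rw [h1, hψ.setIntegral_eq h0]
  have i1 : Integrable (fun y => θ y • gradient ψ y) :=
    (hθ.continuous.smul hψ.continuous_gradient).integrable_of_hasCompactSupport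
      hψ.hasCompactSupport_gradient.smul_left
  have i2 : Integrable (fun y => ψ y • gradient θ y) :=
    (hψ.1.continuous.smul (RitzGalerkin.continuous_gradient hθ)).integrable_of_hasCompactSupport
      hψ.2.1.smul_right
  ext j
  have := integral_mul_pderiv hψ.1 hψ.2.1 hθ j
  have e1 : (∫ y, θ y • gradient ψ y) j = ∫ y, (θ y • gradient ψ y) j :=
    ((EuclideanSpace.proj j : E d →L[ℝ] ℝ).integral_comp_comm i1).symm
  have e2 : (∫ y, ψ y • gradient θ y) j = ∫ y, (ψ y • gradient θ y) j :=
    ((EuclideanSpace.proj j : E d →L[ℝ] ℝ).integral_comp_comm i2).symm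
  rw [PiLp.neg_apply, e1, e2]
  simp only [PiLp.smul_apply, smul_eq_mul, gradient_apply]
  rw [this, neg_neg]
  simp_rw [mul_comm]

end IsTest

/-! ### Pairings in `L²` -/

section L2

variable {α : Type*} [MeasurableSpace α] {μ : Measure α} {V : Type*} [NormedAddCommGroup V]
  [InnerProductSpace ℝ V]

/-- Cauchy–Schwarz in `L²`. -/
theorem abs_integral_inner_le {f g : α → V} (hf : MemLp f 2 μ) (hg : MemLp g 2 μ) :
    |∫ y, inner ℝ (f y) (g y) ∂μ| ≤ (eLpNorm f 2 μ).toReal * (eLpNorm g 2 μ).toReal := by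
  have h := abs_real_inner_le_norm (hf.toLp f) (hg.toLp g)
  rw [L2.inner_def, Lp.norm_toLp, Lp.norm_toLp] at h
  refine le_of_eq_of_le ?_ h
  congr 1
  refine integral_congr_ae ?_
  filter_upwards [hf.coeFn_toLp, hg.coeFn_toLp] with y h1 h2
  rw [h1, h2]

theorem integrable_inner {f g : α → V} (hf : MemLp f 2 μ) (hg : MemLp g 2 μ) :
    Integrable (fun y => inner ℝ (f y) (g y)) μ := by
  refine (L2.integrable_inner (𝕜 := ℝ) (hf.toLp f) (hg.toLp g)).congr ?_
  filter_upwards [hf.coeFn_toLp, hg.coeFn_toLp] with y h1 h2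
  rw [h1, h2]

theorem integral_inner_self {f : α → V} (hf : MemLp f 2 μ) :
    ∫ y, inner ℝ (f y) (f y) ∂μ = (eLpNorm f 2 μ).toReal ^ 2 := by
  have h := real_inner_self_eq_norm_sq (hf.toLp f)
  rw [L2.inner_def, Lp.norm_toLp] at h
  rw [← h]
  refine integral_congr_ae ?_
  filter_upwards [hf.coeFn_toLp] with y h1
  rw [h1]

theorem tendsto_integral_inner {f g : α → V} {F : ℕ → α → V} (hf : MemLp f 2 μ)
    (hg : MemLp g 2 μ) (hF : ∀ n, MemLp (F n) 2 μ)
    (h : Tendsto (fun n => eLpNorm (f - F n) 2 μ) atTop (𝓝 0)) :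
    Tendsto (fun n => ∫ y, inner ℝ (F n y) (g y) ∂μ) atTop
      (𝓝 (∫ y, inner ℝ (f y) (g y) ∂μ)) := by
  rw [tendsto_iff_dist_tendsto_zero]
  have h2 : Tendsto (fun n => (eLpNorm (f - F n) 2 μ).toReal * (eLpNorm g 2 μ).toReal) atTop
      (𝓝 0) := by
    simpa using ((ENNReal.tendsto_toReal ENNReal.zero_ne_top).comp h).mul_const
      (eLpNorm g 2 μ).toReal
  refine squeeze_zero (fun _ => dist_nonneg) (fun n => ?_) h2
  rw [dist_comm, Real.dist_eq, ← integral_sub (integrable_inner hf hg) (integrable_inner (hF n) hg)]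
  refine le_of_eq_of_le ?_ (abs_integral_inner_le (hf.sub (hF n)) hg)
  simp [inner_sub_left]

theorem abs_integral_mul_le {f g : α → ℝ} (hf : MemLp f 2 μ) (hg : MemLp g 2 μ) :
    |∫ y, f y * g y ∂μ| ≤ (eLpNorm f 2 μ).toReal * (eLpNorm g 2 μ).toReal := by
  simpa [mul_comm] using abs_integral_inner_le hf hg

theorem integrable_mul {f g : α → ℝ} (hf : MemLp f 2 μ) (hg : MemLp g 2 μ) :
    Integrable (fun y => f y * g y) μ := by
  simpa [mul_comm] using integrable_inner hf hg

theorem tendsto_integral_mul {f g : α → ℝ} {F : ℕ → α → ℝ} (hf : MemLp f 2 μ)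
    (hg : MemLp g 2 μ) (hF : ∀ n, MemLp (F n) 2 μ)
    (h : Tendsto (fun n => eLpNorm (f - F n) 2 μ) atTop (𝓝 0)) :
    Tendsto (fun n => ∫ y, F n y * g y ∂μ) atTop (𝓝 (∫ y, f y * g y ∂μ)) := by
  simpa [mul_comm] using tendsto_integral_inner hf hg hF h

end L2

/-! ### The space `H¹₀` and its gradient -/

section Gradient

variable {d : ℕ} {F F' : E d → ℝ}

theorem gradient_add (hF : ContDiff ℝ ∞ F) (hF' : ContDiff ℝ ∞ F') :
    gradient (F + F') = gradient F + gradient F' := by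
  ext y j
  have h1 := (hF.differentiable (by simp)).differentiableAt (x := y)
  have h2 := (hF'.differentiable (by simp)).differentiableAt (x := y)
  simp [gradient_apply, pderiv, fderiv_add h1 h2]

theorem pderiv_mul (hF : ContDiff ℝ ∞ F) (hF' : ContDiff ℝ ∞ F') (j : Fin d) (y : E d) :
    pderiv j (F * F') y = F y * pderiv j F' y + F' y * pderiv j F y := by
  have h1 := (hF.differentiable (by simp)).differentiableAt (x := y)
  have h2 := (hF'.differentiable (by simp)).differentiableAt (x := y)
  simp [pderiv, fderiv_mul h1 h2]

theorem gradient_mul (hF : ContDiff ℝ ∞ F) (hF' : ContDiff ℝ ∞ F') :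
    gradient (F * F') = fun y => F y • gradient F' y + F' y • gradient F y := by
  ext y j
  simp [gradient_apply, pderiv_mul hF hF']

theorem gradient_const_smul (hF : ContDiff ℝ ∞ F) (c : ℝ) :
    gradient (c • F) = c • gradient F := by
  ext y j
  have h1 := (hF.differentiable (by simp)).differentiableAt (x := y)
  simp [gradient_apply, pderiv, fderiv_const_smul h1]

end Gradient

/-- The `L²(Ω)` norm as a real number. -/
noncomputable def l2norm {d : ℕ} {V : Type*} [NormedAddCommGroup V] (Ω : Set (E d))
    (f : E d → V) : ℝ :=
  (eLpNorm f 2 (volume.restrict Ω)).toReal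

/-- `v ∈ H¹₀(Ω)` and `G` is a version of its gradient: the pair `(v, G)` is the limit in `L²` of
pairs `(ψ, ∇ψ)` with `ψ ∈ C_c^∞(Ω)`. -/
structure IsH0 {d : ℕ} (Ω : Set (E d)) (v : E d → ℝ) (G : E d → E d) : Prop where
  memLp : MemLp v 2 (volume.restrict Ω)
  memLp_grad : MemLp G 2 (volume.restrict Ω)
  approx : ∀ ε : ℝ≥0∞, 0 < ε → ∃ ψ, IsTest Ω ψ ∧
    eLpNorm (v - ψ) 2 (volume.restrict Ω) ≤ ε ∧
    eLpNorm (G - gradient ψ) 2 (volume.restrict Ω) ≤ ε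

section H0

variable {d : ℕ} {Ω : Set (E d)} {v v' : E d → ℝ} {G G' : E d → E d}

theorem IsH0.exists_seq (h : IsH0 Ω v G) : ∃ ψ : ℕ → E d → ℝ, (∀ j, IsTest Ω (ψ j)) ∧
    Tendsto (fun j => eLpNorm (v - ψ j) 2 (volume.restrict Ω)) atTop (𝓝 0) ∧
    Tendsto (fun j => eLpNorm (G - gradient (ψ j)) 2 (volume.restrict Ω)) atTop (𝓝 0) := by
  obtain ⟨u, -, hu, hu'⟩ := exists_seq_strictAnti_tendsto' (α := ℝ≥0∞) (x := 0) (y := 1) (by simp)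
  choose ψ hψ h1 h2 using fun n => h.approx (u n) (hu n).1
  exact ⟨ψ, hψ, tendsto_of_tendsto_of_tendsto_of_le_of_le tendsto_const_nhds hu'
    (fun _ => zero_le) h1, tendsto_of_tendsto_of_tendsto_of_le_of_le tendsto_const_nhds hu'
    (fun _ => zero_le) h2⟩

theorem IsTest.isH0 {ψ : E d → ℝ} (hψ : IsTest Ω ψ) : IsH0 Ω ψ (gradient ψ) :=
  ⟨hψ.memLp 2, hψ.memLp_gradient 2, fun ε _ => ⟨ψ, hψ, by simp, by simp⟩⟩

/-- The pairs `IsH0` are closed under limits in `L²`. -/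
theorem IsH0.of_tendsto (hv : MemLp v 2 (volume.restrict Ω)) (hG : MemLp G 2 (volume.restrict Ω))
    {V : ℕ → E d → ℝ} {H : ℕ → E d → E d} (h : ∀ n, IsH0 Ω (V n) (H n))
    (h1 : Tendsto (fun j => eLpNorm (v - V j) 2 (volume.restrict Ω)) atTop (𝓝 0))
    (h2 : Tendsto (fun j => eLpNorm (G - H j) 2 (volume.restrict Ω)) atTop (𝓝 0)) :
    IsH0 Ω v G := by
  refine ⟨hv, hG, fun ε hε => ?_⟩
  have hε2 : 0 < ε / 2 := ENNReal.half_pos hε.ne'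
  obtain ⟨n, hn1, hn2⟩ := ((h1.eventually_lt_const hε2).and (h2.eventually_lt_const hε2)).exists
  obtain ⟨ψ, hψ, a1, a2⟩ := (h n).approx (ε / 2) hε2
  refine ⟨ψ, hψ, ?_, ?_⟩
  · have e : v - ψ = (v - V n) + (V n - ψ) := by abel
    rw [e, ← ENNReal.add_halves ε]
    exact (eLpNorm_add_le (hv.sub (h n).memLp).1 ((h n).memLp.sub (hψ.memLp 2)).1
      (by norm_num)).trans (add_le_add hn1.le a1)
  · have e : G - gradient ψ = (G - H n) + (H n - gradient ψ) := by abel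
    rw [e, ← ENNReal.add_halves ε]
    exact (eLpNorm_add_le (hG.sub (h n).memLp_grad).1
      ((h n).memLp_grad.sub (hψ.memLp_gradient 2)).1 (by norm_num)).trans (add_le_add hn2.le a2)

theorem IsH0.congr (h : IsH0 Ω v G) (hv : v =ᵐ[volume.restrict Ω] v')
    (hG : G =ᵐ[volume.restrict Ω] G') : IsH0 Ω v' G' := by
  refine ⟨h.memLp.ae_eq hv, h.memLp_grad.ae_eq hG, fun ε hε => ?_⟩
  obtain ⟨ψ, hψ, a1, a2⟩ := h.approx ε hε
  refine ⟨ψ, hψ, ?_, ?_⟩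
  · rwa [← eLpNorm_congr_ae (hv.sub (EventuallyEq.refl _ ψ))]
  · rwa [← eLpNorm_congr_ae (hG.sub (EventuallyEq.refl _ (gradient ψ)))]

theorem IsH0.add (h : IsH0 Ω v G) (h' : IsH0 Ω v' G') : IsH0 Ω (v + v') (G + G') := by
  refine ⟨h.memLp.add h'.memLp, h.memLp_grad.add h'.memLp_grad, fun ε hε => ?_⟩
  have hε2 : 0 < ε / 2 := ENNReal.half_pos hε.ne'
  obtain ⟨ψ, hψ, a1, a2⟩ := h.approx (ε / 2) hε2
  obtain ⟨ψ', hψ', b1, b2⟩ := h'.approx (ε / 2) hε2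
  refine ⟨ψ + ψ', hψ.add hψ', ?_, ?_⟩
  · have e : v + v' - (ψ + ψ') = (v - ψ) + (v' - ψ') := by abel
    rw [e, ← ENNReal.add_halves ε]
    exact (eLpNorm_add_le (h.memLp.sub (hψ.memLp 2)).1 (h'.memLp.sub (hψ'.memLp 2)).1
      (by norm_num)).trans (add_le_add a1 b1)
  · have e : G + G' - gradient (ψ + ψ') = (G - gradient ψ) + (G' - gradient ψ') := by
      rw [gradient_add hψ.1 hψ'.1]; abel
    rw [e, ← ENNReal.add_halves ε]
    exact (eLpNorm_add_le (h.memLp_grad.sub (hψ.memLp_gradient 2)).1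
      (h'.memLp_grad.sub (hψ'.memLp_gradient 2)).1 (by norm_num)).trans (add_le_add a2 b2)

theorem isH0_zero : IsH0 Ω (0 : E d → ℝ) 0 :=
  (isTest_zero.isH0).congr (EventuallyEq.refl _ _)
    (Eventually.of_forall fun y => by ext j; simp [gradient_apply, pderiv, fderiv_zero])

theorem tendsto_eLpNorm_of_le {α V W : Type*} [MeasurableSpace α] {μ : Measure α}
    [NormedAddCommGroup V] [NormedAddCommGroup W] {f : ℕ → α → V} {g : ℕ → α → W} (C : ℝ)
    (h : ∀ n, ∀ᵐ y ∂μ, ‖f n y‖ ≤ C * ‖g n y‖)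
    (hg : Tendsto (fun n => eLpNorm (g n) 2 μ) atTop (𝓝 0)) :
    Tendsto (fun n => eLpNorm (f n) 2 μ) atTop (𝓝 0) := by
  have : Tendsto (fun n => ENNReal.ofReal C * eLpNorm (g n) 2 μ) atTop (𝓝 0) := by
    simpa using ENNReal.Tendsto.const_mul hg (Or.inr ENNReal.ofReal_ne_top)
  exact tendsto_of_tendsto_of_tendsto_of_le_of_le tendsto_const_nhds this (fun _ => zero_le)
    fun n => eLpNorm_le_mul_eLpNorm_of_ae_le_mul (h n) 2

/-- A continuous function is bounded on a bounded set. -/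
theorem exists_norm_le_of_isBounded (hΩb : Bornology.IsBounded Ω) {V : Type*}
    [NormedAddCommGroup V] {θ : E d → V} (hθ : Continuous θ) :
    ∃ C, 0 < C ∧ ∀ y ∈ Ω, ‖θ y‖ ≤ C := by
  obtain ⟨C, hC⟩ := (hΩb.isCompact_closure).exists_bound_of_continuousOn hθ.continuousOn
  exact ⟨max C 1, by simp, fun y hy => (hC y (subset_closure hy)).trans (le_max_left _ _)⟩

theorem memLp_of_continuous (hΩ : IsOpen Ω) (hΩb : Bornology.IsBounded Ω) {V : Type*}
    [NormedAddCommGroup V] [SecondCountableTopology V] [MeasurableSpace V] [BorelSpace V]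
    {θ : E d → V} (hθ : Continuous θ) (p : ℝ≥0∞) :
    MemLp θ p (volume.restrict Ω) := by
  have : IsFiniteMeasure (volume.restrict Ω) := ⟨by simpa using hΩb.measure_lt_top⟩
  obtain ⟨C, -, hC⟩ := exists_norm_le_of_isBounded hΩb hθ
  exact MemLp.of_bound hθ.aestronglyMeasurable C ((ae_restrict_iff' hΩ.measurableSet).2
    (Eventually.of_forall hC))

/-- `H¹₀(Ω)` is stable under multiplication by smooth functions. -/
theorem IsH0.mul_left (hΩ : IsOpen Ω) (hΩb : Bornology.IsBounded Ω) {θ : E d → ℝ}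
    (hθ : ContDiff ℝ ∞ θ) (h : IsH0 Ω v G) :
    IsH0 Ω (θ * v) (fun y => θ y • G y + v y • gradient θ y) := by
  obtain ⟨C, hC0, hC⟩ := exists_norm_le_of_isBounded hΩb hθ.continuous
  obtain ⟨C', hC'0, hC'⟩ := exists_norm_le_of_isBounded hΩb (continuous_gradient hθ)
  obtain ⟨ψ, hψ, h1, h2⟩ := h.exists_seq
  have ae : ∀ {p : E d → Prop}, (∀ y ∈ Ω, p y) → ∀ᵐ y ∂(volume.restrict Ω), p y := fun hp =>
    (ae_restrict_iff' hΩ.measurableSet).2 (Eventually.of_forall hp)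
  have m1 : MemLp (fun y => θ y • G y) 2 (volume.restrict Ω) :=
    h.memLp_grad.of_le_mul (c := C) (hθ.continuous.aestronglyMeasurable.smul h.memLp_grad.1)
      (ae fun y hy => by rw [norm_smul]; gcongr; exact hC y hy)
  have m2 : MemLp (fun y => v y • gradient θ y) 2 (volume.restrict Ω) :=
    h.memLp.of_le_mul (c := C')
      (h.memLp.1.smul (continuous_gradient hθ).aestronglyMeasurable)
      (ae fun y hy => by rw [norm_smul, mul_comm]; gcongr; exact hC' y hy)
  have m0 : MemLp (θ * v) 2 (volume.restrict Ω) :=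
    h.memLp.of_le_mul (c := C) (hθ.continuous.aestronglyMeasurable.mul h.memLp.1)
      (ae fun y hy => by rw [Pi.mul_apply, norm_mul]; gcongr; exact hC y hy)
  refine IsH0.of_tendsto m0 (m1.add m2) (fun n => ((hψ n).mul_left hθ).isH0) ?_ ?_
  · refine tendsto_eLpNorm_of_le C (fun n => ae fun y hy => ?_) h1
    have : (θ * v - θ * ψ n) y = θ y * (v - ψ n) y := by simp [mul_sub]
    rw [this, norm_mul]
    gcongr
    exact hC y hy
  · have a1 : Tendsto (fun n => eLpNorm (fun y => θ y • (G - gradient (ψ n)) y) 2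
        (volume.restrict Ω)) atTop (𝓝 0) :=
      tendsto_eLpNorm_of_le C (fun n => ae fun y hy => by
        rw [norm_smul]; gcongr; exact hC y hy) h2
    have a2 : Tendsto (fun n => eLpNorm (fun y => (v - ψ n) y • gradient θ y) 2
        (volume.restrict Ω)) atTop (𝓝 0) :=
      tendsto_eLpNorm_of_le C' (fun n => ae fun y hy => by
        rw [norm_smul, mul_comm]; gcongr; exact hC' y hy) h1
    have a3 := a1.add a2
    rw [add_zero] at a3
    refine tendsto_of_tendsto_of_tendsto_of_le_of_le tendsto_const_nhds a3 (fun _ => zero_le)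
      fun n => ?_
    have e : (fun y => θ y • G y + v y • gradient θ y) - gradient (θ * ψ n) =
        (fun y => θ y • (G - gradient (ψ n)) y) + fun y => (v - ψ n) y • gradient θ y := by
      rw [gradient_mul hθ (hψ n).1]
      ext y
      simp [smul_sub, sub_smul]
      ring
    rw [e]
    exact eLpNorm_add_le
      (hθ.continuous.aestronglyMeasurable.smul
        (h.memLp_grad.sub ((hψ n).memLp_gradient 2)).1)
      ((h.memLp.sub ((hψ n).memLp 2)).1.smul (continuous_gradient hθ).aestronglyMeasurable)
      (by norm_num)

theorem IsH0.const_smul (hΩ : IsOpen Ω) (hΩb : Bornology.IsBounded Ω) (c : ℝ) (h : IsH0 Ω v G) :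
    IsH0 Ω (c • v) (c • G) := by
  refine (h.mul_left hΩ hΩb (θ := fun _ => c) contDiff_const).congr (EventuallyEq.refl _ _) ?_
  exact Eventually.of_forall fun y => by simp

theorem IsH0.sub (hΩ : IsOpen Ω) (hΩb : Bornology.IsBounded Ω) (h : IsH0 Ω v G)
    (h' : IsH0 Ω v' G') : IsH0 Ω (v - v') (G - G') := by
  have := h.add (h'.const_smul hΩ hΩb (-1))
  simpa [sub_eq_add_neg] using this

/-- Integration by parts on `Ω` for `v ∈ H¹₀(Ω)` against a function that is smooth up to and
beyond the boundary. -/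
theorem IsH0.integral_smul_grad (hΩ : IsOpen Ω) (hΩb : Bornology.IsBounded Ω) {θ : E d → ℝ}
    (hθ : ContDiff ℝ ∞ θ) (h : IsH0 Ω v G) :
    ∫ y in Ω, θ y • G y = - ∫ y in Ω, v y • gradient θ y := by
  obtain ⟨ψ, hψ, h1, h2⟩ := h.exists_seq
  have mθ : MemLp θ 2 (volume.restrict Ω) := memLp_of_continuous hΩ hΩb hθ.continuous 2
  have mθ' : MemLp (gradient θ) 2 (volume.restrict Ω) :=
    memLp_of_continuous hΩ hΩb (continuous_gradient hθ) 2
  have i1 : Integrable (fun y => θ y • G y) (volume.restrict Ω) :=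
    memLp_one_iff_integrable.1
      (h.memLp_grad.smul mθ : MemLp (fun y => θ y • G y) 1 _)
  have i2 : Integrable (fun y => v y • gradient θ y) (volume.restrict Ω) :=
    memLp_one_iff_integrable.1
      (mθ'.smul h.memLp : MemLp (fun y => v y • gradient θ y) 1 _)
  have i1' : ∀ n, Integrable (fun y => θ y • gradient (ψ n) y) (volume.restrict Ω) := fun n =>
    memLp_one_iff_integrable.1 (((hψ n).memLp_gradient 2).smul mθ)
  have i2' : ∀ n, Integrable (fun y => ψ n y • gradient θ y) (volume.restrict Ω) := fun n =>
    memLp_one_iff_integrable.1 (mθ'.smul ((hψ n).memLp 2))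
  ext j
  have e1 : (∫ y in Ω, θ y • G y) j = ∫ y in Ω, (θ y • G y) j :=
    ((EuclideanSpace.proj j : E d →L[ℝ] ℝ).integral_comp_comm i1).symm
  have e2 : (∫ y in Ω, v y • gradient θ y) j = ∫ y in Ω, (v y • gradient θ y) j :=
    ((EuclideanSpace.proj j : E d →L[ℝ] ℝ).integral_comp_comm i2).symm
  have e1' : ∀ n, (∫ y in Ω, θ y • gradient (ψ n) y) j = ∫ y in Ω, (θ y • gradient (ψ n) y) j :=
    fun n => ((EuclideanSpace.proj j : E d →L[ℝ] ℝ).integral_comp_comm (i1' n)).symm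
  have e2' : ∀ n, (∫ y in Ω, ψ n y • gradient θ y) j = ∫ y in Ω, (ψ n y • gradient θ y) j :=
    fun n => ((EuclideanSpace.proj j : E d →L[ℝ] ℝ).integral_comp_comm (i2' n)).symm
  have mθj : MemLp (fun y => EuclideanSpace.single j (θ y)) 2 (volume.restrict Ω) := by
    refine memLp_of_continuous hΩ hΩb ?_ 2
    have : (fun y => EuclideanSpace.single j (θ y)) =
        fun y => θ y • (EuclideanSpace.single j (1 : ℝ) : E d) := by
      ext y k
      by_cases hk : k = j <;> simp [hk]
    rw [this]
    exact hθ.continuous.smul continuous_const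
  have mθ'j : MemLp (fun y => gradient θ y j) 2 (volume.restrict Ω) := by
    simp only [gradient_apply]
    exact memLp_of_continuous hΩ hΩb (contDiff_pderiv hθ j).continuous 2
  have t1 := tendsto_integral_inner h.memLp_grad mθj (fun n => (hψ n).memLp_gradient 2) h2
  have t2 := tendsto_integral_mul h.memLp mθ'j (fun n => (hψ n).memLp 2) h1
  rw [PiLp.neg_apply, e1, e2]
  simp only [EuclideanSpace.inner_single_right, conj_trivial] at t1
  simp only [PiLp.smul_apply, smul_eq_mul]
  refine tendsto_nhds_unique t1 (t2.neg.congr fun n => ?_)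
  have := congrArg (fun z : E d => z j) ((hψ n).integral_smul_gradient hθ)
  simp only [PiLp.neg_apply] at this
  rw [e1', e2'] at this
  simp only [PiLp.smul_apply, smul_eq_mul] at this
  exact this.symm

theorem IsH0.integral_mul_grad_apply (hΩ : IsOpen Ω) (hΩb : Bornology.IsBounded Ω) {θ : E d → ℝ}
    (hθ : ContDiff ℝ ∞ θ) (h : IsH0 Ω v G) (j : Fin d) :
    ∫ y in Ω, θ y * G y j = - ∫ y in Ω, v y * pderiv j θ y := by
  have mθ : MemLp θ 2 (volume.restrict Ω) := memLp_of_continuous hΩ hΩb hθ.continuous 2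
  have mθ' : MemLp (gradient θ) 2 (volume.restrict Ω) :=
    memLp_of_continuous hΩ hΩb (continuous_gradient hθ) 2
  have i1 : Integrable (fun y => θ y • G y) (volume.restrict Ω) :=
    memLp_one_iff_integrable.1
      (h.memLp_grad.smul mθ : MemLp (fun y => θ y • G y) 1 _)
  have i2 : Integrable (fun y => v y • gradient θ y) (volume.restrict Ω) :=
    memLp_one_iff_integrable.1
      (mθ'.smul h.memLp : MemLp (fun y => v y • gradient θ y) 1 _)
  have e1 : (∫ y in Ω, θ y • G y) j = ∫ y in Ω, (θ y • G y) j :=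
    ((EuclideanSpace.proj j : E d →L[ℝ] ℝ).integral_comp_comm i1).symm
  have e2 : (∫ y in Ω, v y • gradient θ y) j = ∫ y in Ω, (v y • gradient θ y) j :=
    ((EuclideanSpace.proj j : E d →L[ℝ] ℝ).integral_comp_comm i2).symm
  have := congrArg (fun z : E d => z j) (h.integral_smul_grad hΩ hΩb hθ)
  simp only [PiLp.neg_apply] at this
  rw [e1, e2] at this
  simpa [gradient_apply] using this

/-- Green's formula for `v ∈ H¹₀(Ω)` and a function `F` that is smooth on the whole space. -/
theorem IsH0.integral_inner_gradient (hΩ : IsOpen Ω) (hΩb : Bornology.IsBounded Ω) {F : E d → ℝ}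
    (hF : ContDiff ℝ ∞ F) (h : IsH0 Ω v G) :
    ∫ y in Ω, inner ℝ (gradient F y) (G y) = - ∫ y in Ω, v y * Laplacian.laplacian F y := by
  have mG : ∀ j, MemLp (fun y => G y j) 2 (volume.restrict Ω) := fun j =>
    h.memLp_grad.of_le ((EuclideanSpace.proj j : E d →L[ℝ] ℝ).continuous.comp_aestronglyMeasurable
      h.memLp_grad.1) (Eventually.of_forall fun y => PiLp.norm_apply_le (G y) j)
  have mF : ∀ j, MemLp (pderiv j F) 2 (volume.restrict Ω) := fun j =>
    memLp_of_continuous hΩ hΩb (contDiff_pderiv hF j).continuous 2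
  have mFF : ∀ j, MemLp (pderiv j (pderiv j F)) 2 (volume.restrict Ω) := fun j =>
    memLp_of_continuous hΩ hΩb (contDiff_pderiv (contDiff_pderiv hF j) j).continuous 2
  have e1 : ∀ y, inner ℝ (gradient F y) (G y) = ∑ j, pderiv j F y * G y j := fun y => by
    rw [PiLp.inner_apply]
    simp [gradient_apply, mul_comm]
  simp_rw [e1, laplacian_eq_sum hF, Finset.mul_sum]
  rw [integral_finsetSum _ fun j _ => integrable_mul (mF j) (mG j),
    integral_finsetSum _ fun j _ => integrable_mul h.memLp (mFF j), ← Finset.sum_neg_distrib]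
  exact Finset.sum_congr rfl fun j _ => h.integral_mul_grad_apply hΩ hΩb (contDiff_pderiv hF j) j

end H0

/-! ### Weak gradients and the Dirichlet form -/

section WeakGradient

variable {d : ℕ} {Ω : Set (E d)} {u v v' w : E d → ℝ} {G G' : E d → E d}

theorem MemLp.locallyIntegrableOn (hΩb : Bornology.IsBounded Ω) {V : Type*}
    [NormedAddCommGroup V] {f : E d → V} (hf : MemLp f 2 (volume.restrict Ω)) :
    LocallyIntegrableOn f Ω := by
  have : IsFiniteMeasure (volume.restrict Ω) := ⟨by simpa using hΩb.measure_lt_top⟩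
  exact IntegrableOn.locallyIntegrableOn (hf.integrable (by norm_num))

theorem IsH0.hasWeakGrad (hΩ : IsOpen Ω) (hΩb : Bornology.IsBounded Ω) (h : IsH0 Ω v G) :
    HasWeakGrad Ω v G :=
  ⟨MemLp.locallyIntegrableOn hΩb h.memLp, MemLp.locallyIntegrableOn hΩb h.memLp_grad,
    fun ψ hψ => by rw [h.integral_smul_grad hΩ hΩb hψ.1, neg_neg]⟩

theorem IsTest.integrable_smul {V : Type*} [NormedAddCommGroup V]
    [NormedSpace ℝ V] {ψ : E d → ℝ} (hψ : IsTest Ω ψ) {f : E d → V}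
    (hf : LocallyIntegrableOn f Ω) : IntegrableOn (fun y => ψ y • f y) Ω := by
  have h1 : IntegrableOn f (tsupport ψ) :=
    hf.integrableOn_compact_subset hψ.2.2 hψ.2.1
  have h2 : IntegrableOn (fun y => ψ y • f y) (tsupport ψ) :=
    h1.continuousOn_smul hψ.1.continuous.continuousOn hψ.2.1
  refine (h2.integrable_of_forall_notMem_eq_zero fun y hy => ?_).integrableOn
  rw [image_eq_zero_of_notMem_tsupport hy, zero_smul]

/-- Weak gradients are unique up to null sets. -/
theorem HasWeakGrad.ae_eq (hΩ : IsOpen Ω) (h : HasWeakGrad Ω v G) (h' : HasWeakGrad Ω v G') :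
    G =ᵐ[volume.restrict Ω] G' := by
  have := IsOpen.ae_eq_zero_of_integral_contDiff_smul_eq_zero hΩ (h.2.1.sub h'.2.1) (μ := volume)
    fun ψ h1 h2 h3 => by
      have hψ : IsTest Ω ψ := ⟨h1, h2, h3⟩
      rw [← hψ.setIntegral_eq (fun y hy => by simp [hy])]
      simp only [Pi.sub_apply, smul_sub]
      rw [integral_sub (hψ.integrable_smul h.2.1) (hψ.integrable_smul h'.2.1), sub_eq_zero,
        ← neg_inj, ← h.2.2 ψ hψ, ← h'.2.2 ψ hψ]
  refine (ae_restrict_iff' hΩ.measurableSet).2 ?_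
  filter_upwards [this] with y hy hyΩ
  exact sub_eq_zero.1 (hy hyΩ)

theorem HasWeakGrad.weakGrad_ae_eq (hΩ : IsOpen Ω) (h : HasWeakGrad Ω v G) :
    weakGrad Ω v =ᵐ[volume.restrict Ω] G := by
  have hex : ∃ G, HasWeakGrad Ω v G := ⟨G, h⟩
  rw [weakGrad, dif_pos hex]
  exact hex.choose_spec.ae_eq hΩ h

theorem IsH0.weakGrad_ae_eq (hΩ : IsOpen Ω) (hΩb : Bornology.IsBounded Ω) (h : IsH0 Ω v G) :
    weakGrad Ω v =ᵐ[volume.restrict Ω] G :=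
  (h.hasWeakGrad hΩ hΩb).weakGrad_ae_eq hΩ

theorem IsH0.memH10 (hΩ : IsOpen Ω) (hΩb : Bornology.IsBounded Ω) (h : IsH0 Ω v G) :
    MemH10 Ω v := by
  refine ⟨⟨h.memLp, G, h.hasWeakGrad hΩ hΩb, h.memLp_grad⟩, ?_⟩
  obtain ⟨ψ, hψ, h1, h2⟩ := h.exists_seq
  refine ⟨ψ, hψ, h1, h2.congr fun n => eLpNorm_congr_ae ?_⟩
  exact ((h.weakGrad_ae_eq hΩ hΩb).symm.sub (EventuallyEq.refl _ _))

theorem MemH10.isH0 (hΩ : IsOpen Ω) (h : MemH10 Ω v) : IsH0 Ω v (weakGrad Ω v) := by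
  obtain ⟨⟨h1, G, hG, h2⟩, ψ, hψ, t1, t2⟩ := h
  have hW : MemLp (weakGrad Ω v) 2 (volume.restrict Ω) := h2.ae_eq (hG.weakGrad_ae_eq hΩ).symm
  exact IsH0.of_tendsto h1 hW (fun n => (hψ n).isH0) t1 t2

theorem MemH10.add (hΩ : IsOpen Ω) (hΩb : Bornology.IsBounded Ω) (h : MemH10 Ω v)
    (h' : MemH10 Ω v') : MemH10 Ω (v + v') :=
  ((h.isH0 hΩ).add (h'.isH0 hΩ)).memH10 hΩ hΩb

theorem MemH10.sub (hΩ : IsOpen Ω) (hΩb : Bornology.IsBounded Ω) (h : MemH10 Ω v)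
    (h' : MemH10 Ω v') : MemH10 Ω (v - v') :=
  ((h.isH0 hΩ).sub hΩ hΩb (h'.isH0 hΩ)).memH10 hΩ hΩb

theorem MemH10.const_smul (hΩ : IsOpen Ω) (hΩb : Bornology.IsBounded Ω) (c : ℝ)
    (h : MemH10 Ω v) : MemH10 Ω (c • v) :=
  ((h.isH0 hΩ).const_smul hΩ hΩb c).memH10 hΩ hΩb

theorem MemH10.congr (hΩ : IsOpen Ω) (hΩb : Bornology.IsBounded Ω) (h : MemH10 Ω v)
    (hv : v =ᵐ[volume.restrict Ω] v') : MemH10 Ω v' :=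
  ((h.isH0 hΩ).congr hv (EventuallyEq.refl _ _)).memH10 hΩ hΩb

theorem IsTest.memH10 (hΩ : IsOpen Ω) (hΩb : Bornology.IsBounded Ω) (h : IsTest Ω v) :
    MemH10 Ω v :=
  h.isH0.memH10 hΩ hΩb

/-- `H¹₀(Ω)` as a linear subspace of all functions. -/
def h10Submodule (hΩ : IsOpen Ω) (hΩb : Bornology.IsBounded Ω) : Submodule ℝ (E d → ℝ) where
  carrier := {v | MemH10 Ω v}
  add_mem' := MemH10.add hΩ hΩb
  zero_mem' := isTest_zero.memH10 hΩ hΩb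
  smul_mem' c _ := MemH10.const_smul hΩ hΩb c

theorem IsH0.energy_eq (hΩ : IsOpen Ω) (hΩb : Bornology.IsBounded Ω) (h : IsH0 Ω v G)
    (h' : IsH0 Ω v' G') : energy Ω v v' = ∫ y in Ω, inner ℝ (G y) (G' y) := by
  refine integral_congr_ae ?_
  filter_upwards [h.weakGrad_ae_eq hΩ hΩb, h'.weakGrad_ae_eq hΩ hΩb] with y h1 h2
  rw [h1, h2]

theorem energy_comm (u v : E d → ℝ) : energy Ω u v = energy Ω v u := by
  simp only [energy, real_inner_comm]

theorem energy_add_left (hΩ : IsOpen Ω) (hΩb : Bornology.IsBounded Ω) (hu : MemH10 Ω u)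
    (hv : MemH10 Ω v) (hw : MemH10 Ω w) : energy Ω (u + v) w = energy Ω u w + energy Ω v w := by
  have hu := hu.isH0 hΩ
  have hv := hv.isH0 hΩ
  have hw := hw.isH0 hΩ
  rw [(hu.add hv).energy_eq hΩ hΩb hw, energy, energy, ← integral_add
    (integrable_inner hu.memLp_grad hw.memLp_grad) (integrable_inner hv.memLp_grad hw.memLp_grad)]
  simp [inner_add_left]

theorem energy_smul_left (hΩ : IsOpen Ω) (hΩb : Bornology.IsBounded Ω) (c : ℝ) (hu : MemH10 Ω u)
    (hw : MemH10 Ω w) : energy Ω (c • u) w = c * energy Ω u w := by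
  have hu := hu.isH0 hΩ
  have hw := hw.isH0 hΩ
  rw [(hu.const_smul hΩ hΩb c).energy_eq hΩ hΩb hw, energy, ← integral_const_mul]
  simp [real_inner_smul_left]

theorem energy_sub_left (hΩ : IsOpen Ω) (hΩb : Bornology.IsBounded Ω) (hu : MemH10 Ω u)
    (hv : MemH10 Ω v) (hw : MemH10 Ω w) : energy Ω (u - v) w = energy Ω u w - energy Ω v w := by
  have h := energy_add_left hΩ hΩb hu (hv.const_smul hΩ hΩb (-1)) hw
  rw [energy_smul_left hΩ hΩb _ hv hw] at h
  have e : u - v = u + (-1 : ℝ) • v := by simp [sub_eq_add_neg]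
  rw [e, h]
  ring

theorem energy_sub_right (hΩ : IsOpen Ω) (hΩb : Bornology.IsBounded Ω) (hu : MemH10 Ω u)
    (hv : MemH10 Ω v) (hw : MemH10 Ω w) : energy Ω w (u - v) = energy Ω w u - energy Ω w v := by
  rw [energy_comm, energy_sub_left hΩ hΩb hu hv hw, energy_comm u, energy_comm v]

theorem MemH10.sum (hΩ : IsOpen Ω) (hΩb : Bornology.IsBounded Ω) {ι : Type*} (s : Finset ι)
    {φ : ι → E d → ℝ} (h : ∀ k, MemH10 Ω (φ k)) (c : ι → ℝ) :
    MemH10 Ω (∑ k ∈ s, c k • φ k) :=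
  (h10Submodule hΩ hΩb).sum_mem fun k _ => (h k).const_smul hΩ hΩb (c k)

theorem energy_sum_left (hΩ : IsOpen Ω) (hΩb : Bornology.IsBounded Ω) {ι : Type*} (s : Finset ι)
    {φ : ι → E d → ℝ} (h : ∀ k, MemH10 Ω (φ k)) (c : ι → ℝ) (hw : MemH10 Ω w) :
    energy Ω (∑ k ∈ s, c k • φ k) w = ∑ k ∈ s, c k * energy Ω (φ k) w := by
  classical
  induction s using Finset.induction_on with
  | empty =>
    have := energy_smul_left hΩ hΩb 0 hw hw
    simpa using this
  | insert k s hk ih =>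
    rw [Finset.sum_insert hk, Finset.sum_insert hk, energy_add_left hΩ hΩb
      ((h k).const_smul hΩ hΩb (c k)) (MemH10.sum hΩ hΩb s h c) hw,
      energy_smul_left hΩ hΩb _ (h k) hw, ih]

theorem energyNorm_eq_l2norm (hΩ : IsOpen Ω) (h : MemH10 Ω v) :
    energyNorm Ω v = l2norm Ω (weakGrad Ω v) := by
  rw [energyNorm, energy, integral_inner_self (h.isH0 hΩ).memLp_grad, Real.sqrt_sq
    ENNReal.toReal_nonneg, l2norm]

theorem IsH0.energyNorm_eq (hΩ : IsOpen Ω) (hΩb : Bornology.IsBounded Ω) (h : IsH0 Ω v G) :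
    energyNorm Ω v = l2norm Ω G := by
  rw [energyNorm_eq_l2norm hΩ (h.memH10 hΩ hΩb), l2norm, l2norm,
    eLpNorm_congr_ae (h.weakGrad_ae_eq hΩ hΩb)]

theorem energyNorm_nonneg (v : E d → ℝ) : 0 ≤ energyNorm Ω v := Real.sqrt_nonneg _

theorem energyNorm_sq (v : E d → ℝ) : energyNorm Ω v ^ 2 = energy Ω v v :=
  Real.sq_sqrt (integral_nonneg fun _ => real_inner_self_nonneg)

theorem abs_energy_le (hΩ : IsOpen Ω) (hu : MemH10 Ω u) (hv : MemH10 Ω v) :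
    |energy Ω u v| ≤ energyNorm Ω u * energyNorm Ω v := by
  rw [energyNorm_eq_l2norm hΩ hu, energyNorm_eq_l2norm hΩ hv]
  exact abs_integral_inner_le (hu.isH0 hΩ).memLp_grad (hv.isH0 hΩ).memLp_grad

theorem l2norm_add_le {V : Type*} [NormedAddCommGroup V] {f g : E d → V}
    (hf : MemLp f 2 (volume.restrict Ω)) (hg : MemLp g 2 (volume.restrict Ω)) :
    l2norm Ω (f + g) ≤ l2norm Ω f + l2norm Ω g := by
  rw [l2norm, l2norm, l2norm, ← ENNReal.toReal_add hf.2.ne hg.2.ne]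
  exact ENNReal.toReal_mono (ENNReal.add_ne_top.2 ⟨hf.2.ne, hg.2.ne⟩)
    (eLpNorm_add_le hf.1 hg.1 (by norm_num))

theorem energyNorm_add_le (hΩ : IsOpen Ω) (hΩb : Bornology.IsBounded Ω) (hu : MemH10 Ω u)
    (hv : MemH10 Ω v) : energyNorm Ω (u + v) ≤ energyNorm Ω u + energyNorm Ω v := by
  have hu := hu.isH0 hΩ
  have hv := hv.isH0 hΩ
  rw [(hu.add hv).energyNorm_eq hΩ hΩb, hu.energyNorm_eq hΩ hΩb, hv.energyNorm_eq hΩ hΩb]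
  exact l2norm_add_le hu.memLp_grad hv.memLp_grad

theorem energyNorm_sub_comm (hΩ : IsOpen Ω) (hΩb : Bornology.IsBounded Ω) (hu : MemH10 Ω u)
    (hv : MemH10 Ω v) : energyNorm Ω (u - v) = energyNorm Ω (v - u) := by
  have hu := hu.isH0 hΩ
  have hv := hv.isH0 hΩ
  rw [(hu.sub hΩ hΩb hv).energyNorm_eq hΩ hΩb, (hv.sub hΩ hΩb hu).energyNorm_eq hΩ hΩb, l2norm,
    l2norm, ← eLpNorm_neg, neg_sub]

theorem energy_congr_left (hΩ : IsOpen Ω) (hΩb : Bornology.IsBounded Ω) (hu : MemH10 Ω u)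
    (h : u =ᵐ[volume.restrict Ω] v) (hw : MemH10 Ω w) : energy Ω u w = energy Ω v w := by
  have hu := hu.isH0 hΩ
  rw [hu.energy_eq hΩ hΩb (hw.isH0 hΩ),
    (hu.congr h (EventuallyEq.refl _ _)).energy_eq hΩ hΩb (hw.isH0 hΩ)]

/-- For a function that is smooth on the whole space, the Dirichlet form against `H¹₀(Ω)` is the
pairing with `-Δ F`. -/
theorem energy_eq_integral_laplacian (hΩ : IsOpen Ω) (hΩb : Bornology.IsBounded Ω)
    {F : E d → ℝ} (hF : ContDiff ℝ ∞ F) (hF0 : MemH10 Ω F) (hv : MemH10 Ω v) :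
    energy Ω F v = ∫ y in Ω, -Laplacian.laplacian F y * v y := by
  have hW : HasWeakGrad Ω F (gradient F) :=
    ⟨MemLp.locallyIntegrableOn hΩb hF0.1.1, MemLp.locallyIntegrableOn hΩb
      (memLp_of_continuous hΩ hΩb (continuous_gradient hF) 2),
      fun ψ hψ => hψ.integral_smul_gradient hF⟩
  have h0 : IsH0 Ω F (gradient F) :=
    (hF0.isH0 hΩ).congr (EventuallyEq.refl _ _) (hW.weakGrad_ae_eq hΩ)
  rw [h0.energy_eq hΩ hΩb (hv.isH0 hΩ), (hv.isH0 hΩ).integral_inner_gradient hΩ hΩb hF,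
    ← integral_neg]
  exact integral_congr_ae (Eventually.of_forall fun y => by simp only; ring)

end WeakGradient

/-! ### The Poincaré inequality -/

section Poincare

variable {d : ℕ} {Ω : Set (E d)}

theorem l2norm_tendsto {V : Type*} [NormedAddCommGroup V] {f : E d → V} {F : ℕ → E d → V}
    (hf : MemLp f 2 (volume.restrict Ω)) (hF : ∀ n, MemLp (F n) 2 (volume.restrict Ω))
    (h : Tendsto (fun n => eLpNorm (f - F n) 2 (volume.restrict Ω)) atTop (𝓝 0)) :
    Tendsto (fun n => l2norm Ω (F n)) atTop (𝓝 (l2norm Ω f)) := by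
  have h' : Tendsto (fun n => l2norm Ω (f - F n)) atTop (𝓝 0) := by
    exact (ENNReal.tendsto_toReal ENNReal.zero_ne_top).comp h
  rw [tendsto_iff_dist_tendsto_zero]
  refine squeeze_zero (fun _ => dist_nonneg) (fun n => ?_) h'
  rw [Real.dist_eq, abs_le]
  have a1 := l2norm_add_le (hf.sub (hF n)) (hF n)
  have a2 := l2norm_add_le ((hF n).sub hf) hf
  have a3 : l2norm Ω (F n - f) = l2norm Ω (f - F n) := by
    rw [l2norm, l2norm, ← eLpNorm_neg, neg_sub]
  rw [sub_add_cancel] at a1 a2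
  constructor <;> linarith

/-- The Poincaré inequality, from `∫ ψ² = -2 ∫ y₀ ψ ∂₀ψ`. -/
theorem exists_poincare (hd : 0 < d) (hΩ : IsOpen Ω) (hΩb : Bornology.IsBounded Ω) :
    ∃ C, 0 < C ∧ ∀ (v : E d → ℝ) (G : E d → E d), IsH0 Ω v G → l2norm Ω v ≤ C * l2norm Ω G := by
  obtain ⟨R, hR0, hR⟩ := exists_norm_le_of_isBounded hΩb (θ := fun y : E d => y) continuous_id
  refine ⟨2 * R, by positivity, fun v G h => ?_⟩
  obtain ⟨ψ, hψ, t1, t2⟩ := h.exists_seq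
  refine le_of_tendsto_of_tendsto (l2norm_tendsto h.memLp (fun n => (hψ n).memLp 2) t1)
    ((l2norm_tendsto h.memLp_grad (fun n => (hψ n).memLp_gradient 2) t2).const_mul (2 * R))
    (Eventually.of_forall fun n => ?_)
  simp only
  have hψ := hψ n
  generalize ψ n = ψ at hψ ⊢
  let j : Fin d := ⟨0, hd⟩
  have hX : ContDiff ℝ ∞ (fun y : E d => y j) := (EuclideanSpace.proj j : E d →L[ℝ] ℝ).contDiff
  have hX1 : ∀ y, pderiv j (fun y : E d => y j) y = 1 := fun y => by
    have : fderiv ℝ (fun y : E d => y j) y = (EuclideanSpace.proj j : E d →L[ℝ] ℝ) :=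
      (EuclideanSpace.proj j : E d →L[ℝ] ℝ).fderiv
    simp [pderiv, this]
  have h2 := hψ.mul_left hψ.1
  -- `∫ ψ² · ∂ⱼyⱼ = -∫ yⱼ ∂ⱼ(ψ²)`
  have e := integral_mul_pderiv h2.1 h2.2.1 hX j
  simp only [hX1, pderiv_mul hψ.1 hψ.1, mul_one] at e
  let g : E d → E d := fun y => (2 * ψ y * y j) • EuclideanSpace.single j 1
  have hg : Continuous g :=
    ((continuous_const.mul hψ.1.continuous).mul hX.continuous).smul continuous_const
  have hgm : MemLp g 2 (volume.restrict Ω) := memLp_of_continuous hΩ hΩb hg 2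
  have hgn : l2norm Ω g ≤ 2 * R * l2norm Ω ψ := by
    have : eLpNorm g 2 (volume.restrict Ω) ≤
        ENNReal.ofReal (2 * R) * eLpNorm ψ 2 (volume.restrict Ω) := by
      refine eLpNorm_le_mul_eLpNorm_of_ae_le_mul ((ae_restrict_iff' hΩ.measurableSet).2
        (Eventually.of_forall fun y hy => ?_)) 2
      have : ‖y j‖ ≤ R := (PiLp.norm_apply_le y j).trans (hR y hy)
      simp only [g, norm_smul, norm_mul, PiLp.norm_single, norm_one, mul_one,
        Real.norm_ofNat]
      nlinarith [norm_nonneg (ψ y)]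
    have := ENNReal.toReal_mono (ENNReal.mul_ne_top ENNReal.ofReal_ne_top (hψ.memLp 2).2.ne) this
    rwa [ENNReal.toReal_mul, ENNReal.toReal_ofReal (by positivity)] at this
  have hs : (l2norm Ω ψ) ^ 2 = - ∫ y in Ω, inner ℝ (gradient ψ y) (g y) := by
    rw [l2norm, ← integral_inner_self (hψ.memLp 2), hψ.setIntegral_eq (fun y h => by simp [h]),
      hψ.setIntegral_eq (fun y h => by simp [h, g])]
    have e2 : ∀ y, inner ℝ (gradient ψ y) (g y) =
        (ψ y * pderiv j ψ y + ψ y * pderiv j ψ y) * y j := fun y => by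
      simp only [g, inner_smul_right, EuclideanSpace.inner_single_right, gradient_apply,
        conj_trivial]
      ring
    simp_rw [e2, ← e]
    exact integral_congr_ae (Eventually.of_forall fun y => by simp [pow_two])
  have hcs := abs_integral_inner_le (hψ.memLp_gradient 2) hgm (μ := volume.restrict Ω)
  have h3 : (l2norm Ω ψ) ^ 2 ≤ l2norm Ω (gradient ψ) * l2norm Ω g := by
    rw [hs]; exact (neg_le_abs _).trans hcs
  have n1 : 0 ≤ l2norm Ω ψ := ENNReal.toReal_nonneg
  have n2 : 0 ≤ l2norm Ω (gradient ψ) := ENNReal.toReal_nonneg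
  rcases n1.eq_or_lt with h0 | h0
  · rw [← h0]; positivity
  · refine le_of_mul_le_mul_right ?_ h0
    calc l2norm Ω ψ * l2norm Ω ψ = l2norm Ω ψ ^ 2 := by ring
      _ ≤ l2norm Ω (gradient ψ) * l2norm Ω g := h3
      _ ≤ l2norm Ω (gradient ψ) * (2 * R * l2norm Ω ψ) := mul_le_mul_of_nonneg_left hgn n2
      _ = 2 * R * l2norm Ω (gradient ψ) * l2norm Ω ψ := by ring

theorem exists_poincare_energyNorm (hd : 0 < d) (hΩ : IsOpen Ω) (hΩb : Bornology.IsBounded Ω) :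
    ∃ C, 0 < C ∧ ∀ v : E d → ℝ, MemH10 Ω v → l2norm Ω v ≤ C * energyNorm Ω v := by
  obtain ⟨C, hC, h⟩ := exists_poincare hd hΩ hΩb
  refine ⟨C, hC, fun v hv => ?_⟩
  rw [energyNorm_eq_l2norm hΩ hv]
  exact h v _ (hv.isH0 hΩ)

theorem ae_eq_zero_of_l2norm_eq_zero {f : E d → ℝ} (hf : MemLp f 2 (volume.restrict Ω))
    (h : l2norm Ω f = 0) : f =ᵐ[volume.restrict Ω] 0 := by
  rw [l2norm, ENNReal.toReal_eq_zero_iff, or_iff_left hf.2.ne] at h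
  exact (eLpNorm_eq_zero_iff hf.1 (by norm_num)).1 h

end Poincare

/-! ### Superpositions of rescaled radial profiles -/

/-- A smooth function of one variable, positive exactly on `(-∞, 1)`: the profile of the
mollifiers, as a function of the squared distance. -/
noncomputable def profile (s : ℝ) : ℝ := expNegInvGlue (1 - s)

/-- The primitive of `-profile / 2` that vanishes on `[1, ∞)`. -/
noncomputable def profilePrim (s : ℝ) : ℝ := (1 / 2) * ∫ u in s..1, profile u

theorem contDiff_profile : ContDiff ℝ ∞ profile :=
  expNegInvGlue.contDiff.comp (contDiff_const.sub contDiff_id)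

theorem profile_nonneg (s : ℝ) : 0 ≤ profile s := expNegInvGlue.nonneg _

theorem profile_pos {s : ℝ} (hs : s < 1) : 0 < profile s := expNegInvGlue.pos_of_pos (by linarith)

theorem profile_eq_zero {s : ℝ} (hs : 1 ≤ s) : profile s = 0 :=
  expNegInvGlue.zero_of_nonpos (by linarith)

theorem profile_le {s : ℝ} (hs : 0 ≤ s) : profile s ≤ profile 0 :=
  expNegInvGlue.monotone (by linarith)

theorem hasDerivAt_profilePrim (s : ℝ) : HasDerivAt profilePrim (-(1 / 2) * profile s) s := by
  have hc : Continuous profile := contDiff_profile.continuous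
  have := (intervalIntegral.integral_hasDerivAt_left (hc.intervalIntegrable s 1)
    (hc.stronglyMeasurableAtFilter _ _) hc.continuousAt).const_mul (1 / 2 : ℝ)
  exact this.congr_deriv (by ring)

theorem deriv_profilePrim : deriv profilePrim = fun s => -(1 / 2) * profile s :=
  funext fun s => (hasDerivAt_profilePrim s).deriv

theorem contDiff_profilePrim : ContDiff ℝ ∞ profilePrim := by
  rw [contDiff_infty_iff_deriv]
  refine ⟨fun s => (hasDerivAt_profilePrim s).differentiableAt, ?_⟩
  rw [deriv_profilePrim]
  exact contDiff_const.mul contDiff_profile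

theorem profilePrim_eq_zero {s : ℝ} (hs : 1 ≤ s) : profilePrim s = 0 := by
  have : ∫ u in s..1, profile u = ∫ u in s..1, (0 : ℝ) := by
    refine intervalIntegral.integral_congr fun u hu => ?_
    rw [uIcc_of_ge hs] at hu
    exact profile_eq_zero hu.1
  simp [profilePrim, this]

theorem antitone_profilePrim : Antitone profilePrim :=
  antitone_of_deriv_nonpos (fun s => (hasDerivAt_profilePrim s).differentiableAt) fun s => by
    rw [deriv_profilePrim]
    have := profile_nonneg s
    simp only
    linarith

theorem profilePrim_nonneg (s : ℝ) : 0 ≤ profilePrim s := by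
  rcases le_total s 1 with h | h
  · rw [← profilePrim_eq_zero le_rfl]
    exact antitone_profilePrim h
  · rw [profilePrim_eq_zero h]

theorem profilePrim_pos {s : ℝ} (hs : s < 1) : 0 < profilePrim s :=
  mul_pos (by norm_num) (intervalIntegral.intervalIntegral_pos_of_pos_on
    (contDiff_profile.continuous.intervalIntegrable s 1) (fun _ h => profile_pos h.2) hs)

/-- The superposition `∫ₐᵇ t^k Q(s / t²) dt` of rescaled profiles. -/
noncomputable def scaleIntegral (k : ℤ) (Q : ℝ → ℝ) (a b s : ℝ) : ℝ :=
  ∫ t in a..b, t ^ k * Q (s * t ^ (-2 : ℤ))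

theorem continuousOn_scale {Q : ℝ → ℝ} (hQ : Continuous Q) (k : ℤ) :
    ContinuousOn (fun p : ℝ × ℝ => p.2 ^ k * Q (p.1 * p.2 ^ (-2 : ℤ))) {p | 0 < p.2} := by
  have hz : ∀ m : ℤ, ContinuousOn (fun p : ℝ × ℝ => p.2 ^ m) {p | 0 < p.2} := fun m =>
    continuousOn_snd.zpow₀ m fun p hp => Or.inl (ne_of_gt hp)
  exact (hz k).mul (hQ.comp_continuousOn (continuousOn_fst.mul (hz (-2))))

theorem continuousOn_scale_right {Q : ℝ → ℝ} (hQ : Continuous Q) (k : ℤ) {a b : ℝ} (ha : 0 < a)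
    (s : ℝ) : ContinuousOn (fun t : ℝ => t ^ k * Q (s * t ^ (-2 : ℤ))) (Icc a b) :=
  (continuousOn_scale hQ k).comp (f := fun t : ℝ => (s, t)) (by fun_prop)
    fun _ ht => ha.trans_le ht.1

theorem intervalIntegrable_scale {Q : ℝ → ℝ} (hQ : Continuous Q) (k : ℤ) {a b : ℝ} (ha : 0 < a)
    (hab : a ≤ b) (s : ℝ) :
    IntervalIntegrable (fun t : ℝ => t ^ k * Q (s * t ^ (-2 : ℤ))) volume a b :=
  ContinuousOn.intervalIntegrable (by
    rw [uIcc_of_le hab]; exact continuousOn_scale_right hQ k ha s)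

theorem hasDerivAt_scaleIntegral {Q : ℝ → ℝ} (hQ : ContDiff ℝ 1 Q) (k : ℤ) {a b : ℝ} (ha : 0 < a)
    (hab : a ≤ b) (s : ℝ) :
    HasDerivAt (scaleIntegral k Q a b) (scaleIntegral (k - 2) (deriv Q) a b s) s := by
  have hQ' : Continuous (deriv Q) := hQ.continuous_deriv le_rfl
  have hK : IsCompact (Metric.closedBall s 1 ×ˢ Icc a b) :=
    (isCompact_closedBall s 1).prod isCompact_Icc
  obtain ⟨C, hC⟩ := hK.exists_bound_of_continuousOn
    ((continuousOn_scale hQ' (k - 2)).mono fun p hp => ha.trans_le hp.2.1)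
  have hI : ∀ t ∈ uIoc a b, t ∈ Icc a b := fun t ht => by
    rw [uIoc_of_le hab] at ht; exact ⟨ht.1.le, ht.2⟩
  refine (intervalIntegral.hasDerivAt_integral_of_dominated_loc_of_deriv_le (𝕜 := ℝ)
    (F := fun s t => t ^ k * Q (s * t ^ (-2 : ℤ)))
    (F' := fun s t => t ^ (k - 2) * deriv Q (s * t ^ (-2 : ℤ))) (bound := fun _ => C)
    (Metric.ball_mem_nhds s one_pos) (Eventually.of_forall fun s' => ?_)
    (intervalIntegrable_scale hQ.continuous k ha hab s) ?_ ?_ (by simp) ?_).2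
  · exact (intervalIntegrable_iff.1
      (intervalIntegrable_scale hQ.continuous k ha hab s')).aestronglyMeasurable
  · exact (intervalIntegrable_iff.1
      (intervalIntegrable_scale hQ' (k - 2) ha hab s)).aestronglyMeasurable
  · exact Eventually.of_forall fun t ht s' hs' =>
      hC (s', t) ⟨Metric.ball_subset_closedBall hs', hI t ht⟩
  · refine Eventually.of_forall fun t ht s' _ => ?_
    have ht0 : 0 < t := ha.trans_le (hI t ht).1
    have h1 : HasDerivAt (fun s : ℝ => s * t ^ (-2 : ℤ)) (t ^ (-2 : ℤ)) s' := by
      simpa using (hasDerivAt_id s').mul_const (t ^ (-2 : ℤ))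
    have h2 := (((hQ.differentiable (by simp)) (s' * t ^ (-2 : ℤ))).hasDerivAt.comp s' h1).const_mul
      (t ^ k)
    refine h2.congr_deriv ?_
    rw [sub_eq_add_neg, zpow_add₀ ht0.ne']
    ring

theorem contDiff_scaleIntegral {a b : ℝ} (ha : 0 < a) (hab : a ≤ b) {Q : ℝ → ℝ}
    (hQ : ContDiff ℝ ∞ Q) (k : ℤ) : ContDiff ℝ ∞ (scaleIntegral k Q a b) := by
  rw [contDiff_infty]
  intro n
  induction n generalizing k Q with
  | zero =>
    exact contDiff_zero.2 (Differentiable.continuous (𝕜 := ℝ) fun s =>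
      (hasDerivAt_scaleIntegral (hQ.of_le (by simp)) k ha hab s).differentiableAt)
  | succ n ih =>
    have hd := hasDerivAt_scaleIntegral (hQ.of_le (by simp)) k ha hab
    have : deriv (scaleIntegral k Q a b) = scaleIntegral (k - 2) (deriv Q) a b :=
      funext fun s => (hd s).deriv
    push_cast
    rw [contDiff_succ_iff_deriv]
    refine ⟨fun s => (hd s).differentiableAt, by simp, ?_⟩
    rw [this]
    exact ih (contDiff_infty_iff_deriv.1 hQ).2 (k - 2)

theorem deriv_scaleIntegral {Q : ℝ → ℝ} (hQ : ContDiff ℝ ∞ Q) (k : ℤ) {a b : ℝ} (ha : 0 < a)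
    (hab : a ≤ b) : deriv (scaleIntegral k Q a b) = scaleIntegral (k - 2) (deriv Q) a b :=
  funext fun s => (hasDerivAt_scaleIntegral (hQ.of_le (by simp)) k ha hab s).deriv

section Radial

variable {d : ℕ}

theorem pderiv_norm_sq_comp {J : ℝ → ℝ} (hJ : ContDiff ℝ ∞ J) (x : E d) (j : Fin d) :
    pderiv j (fun y => J (‖y - x‖ ^ 2)) = fun y => 2 * ((y - x) j * deriv J (‖y - x‖ ^ 2)) := by
  ext y
  have h1 : HasFDerivAt (fun y : E d => ‖y - x‖ ^ 2) (2 • innerSL ℝ (y - x)) y := by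
    have := ((hasFDerivAt_id (𝕜 := ℝ) y).sub_const x).norm_sq
    simpa using this
  have h2 := ((hJ.differentiable (by simp)) (‖y - x‖ ^ 2)).hasDerivAt.comp_hasFDerivAt y h1
  have h3 : fderiv ℝ (fun y => J (‖y - x‖ ^ 2)) y = _ := h2.fderiv
  rw [pderiv, h3]
  simp [EuclideanSpace.inner_single_right, innerSL_apply_apply]
  ring

theorem contDiff_norm_sq_comp {J : ℝ → ℝ} (hJ : ContDiff ℝ ∞ J) (x : E d) :
    ContDiff ℝ ∞ (fun y : E d => J (‖y - x‖ ^ 2)) :=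
  hJ.comp ((contDiff_id.sub contDiff_const).norm_sq ℝ)

theorem laplacian_norm_sq_comp {J : ℝ → ℝ} (hJ : ContDiff ℝ ∞ J) (x y : E d) :
    Laplacian.laplacian (fun y => J (‖y - x‖ ^ 2)) y =
      2 * d * deriv J (‖y - x‖ ^ 2) + 4 * ‖y - x‖ ^ 2 * deriv (deriv J) (‖y - x‖ ^ 2) := by
  have hJ' : ContDiff ℝ ∞ (deriv J) := (contDiff_infty_iff_deriv.1 hJ).2
  rw [laplacian_eq_sum (contDiff_norm_sq_comp hJ x)]
  have hX : ∀ j : Fin d, ContDiff ℝ ∞ (fun y : E d => 2 * (y - x) j) := fun j =>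
    contDiff_const.mul ((EuclideanSpace.proj j : E d →L[ℝ] ℝ).contDiff.comp
      (contDiff_id.sub contDiff_const))
  have hX1 : ∀ j : Fin d, pderiv j (fun y : E d => 2 * (y - x) j) y = 2 := fun j => by
    have h0 : HasFDerivAt (fun y : E d => 2 * (y - x) j)
        ((2 : ℝ) • (EuclideanSpace.proj j : E d →L[ℝ] ℝ)) y :=
      (((EuclideanSpace.proj j : E d →L[ℝ] ℝ).hasFDerivAt.comp y
        ((hasFDerivAt_id y).sub_const x)).const_mul 2)
    rw [pderiv, h0.fderiv]
    simp
  have hterm : ∀ j : Fin d, pderiv j (pderiv j (fun y => J (‖y - x‖ ^ 2))) y =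
      2 * deriv J (‖y - x‖ ^ 2) + 4 * ((y - x) j) ^ 2 * deriv (deriv J) (‖y - x‖ ^ 2) := fun j => by
    rw [pderiv_norm_sq_comp hJ]
    have e : (fun y => 2 * ((y - x) j * deriv J (‖y - x‖ ^ 2))) =
        (fun y : E d => 2 * (y - x) j) * fun y => deriv J (‖y - x‖ ^ 2) := by
      ext y; simp; ring
    rw [e, pderiv_mul (hX j) (contDiff_norm_sq_comp hJ' x), hX1, pderiv_norm_sq_comp hJ']
    ring
  simp_rw [hterm]
  rw [Finset.sum_add_distrib, ← Finset.sum_mul, ← Finset.sum_mul, ← Finset.mul_sum,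
    ← EuclideanSpace.real_norm_sq_eq]
  simp [mul_comm]

end Radial

/-! ### Mollifiers and the parametrix of the Laplacian -/

/-- The mollifier `η_t(y - x) = t^{-d} profile(|y - x|² / t²)` centred at `x`. It is not
normalised: its integral is `mass d`. -/
noncomputable def mollifier {d : ℕ} (t : ℝ) (x y : E d) : ℝ :=
  t ^ (-(d : ℤ)) * profile (‖y - x‖ ^ 2 * t ^ (-2 : ℤ))

/-- The common integral of all mollifiers in dimension `d`. -/
noncomputable def mass (d : ℕ) : ℝ := ∫ y : E d, profile (‖y‖ ^ 2)

/-- `Φ_{ε,r}(y - x) = ∫_ε^r t^{1-d} profilePrim(|y - x|² / t²) dt`. For `0 < ε` it is smooth with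
`-Δ Φ_{ε,r} = η_ε - η_r`, so that `Φ_{0,r}` is, up to the factor `mass d`, a compactly supported
parametrix of `-Δ`. At `y = x` and `ε = 0` the integral may diverge and the value is then junk;
only in dimension one is this value used. -/
noncomputable def green {d : ℕ} (ε r : ℝ) (x y : E d) : ℝ :=
  scaleIntegral (1 - d) profilePrim ε r (‖y - x‖ ^ 2)

section Mollifier

variable {d : ℕ} {t ε r : ℝ} {x y : E d}

theorem contDiff_mollifier (t : ℝ) (x : E d) : ContDiff ℝ ∞ (mollifier t x) :=
  contDiff_const.mul (contDiff_norm_sq_comp (J := fun s => profile (s * t ^ (-2 : ℤ)))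
    (contDiff_profile.comp (contDiff_id.mul contDiff_const)) x)

theorem mollifier_nonneg (ht : 0 ≤ t) (x y : E d) : 0 ≤ mollifier t x y :=
  mul_nonneg (zpow_nonneg ht _) (profile_nonneg _)

theorem one_le_mul_zpow (ht : 0 < t) {a : ℝ} (h : t ≤ a) : 1 ≤ a ^ 2 * t ^ (-2 : ℤ) := by
  have : t ^ (-2 : ℤ) = (t ^ 2)⁻¹ := by rw [zpow_neg]; rfl
  rw [this, ← div_eq_mul_inv, one_le_div (by positivity)]
  gcongr

theorem mollifier_eq_zero (ht : 0 < t) (h : t ≤ ‖y - x‖) : mollifier t x y = 0 := by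
  rw [mollifier, profile_eq_zero (one_le_mul_zpow ht h), mul_zero]

theorem mollifier_comm (t : ℝ) (x y : E d) : mollifier t x y = mollifier t y x := by
  rw [mollifier, mollifier, norm_sub_rev]

theorem support_mollifier_subset (ht : 0 < t) (x : E d) :
    Function.support (mollifier t x) ⊆ Metric.closedBall x t := fun y hy => by
  rw [Metric.mem_closedBall, dist_eq_norm]
  by_contra h
  exact hy (mollifier_eq_zero ht (not_le.1 h).le)

theorem tsupport_subset_closedBall {f : E d → ℝ} (h : ∀ y, r ≤ ‖y - x‖ → f y = 0) :
    tsupport f ⊆ Metric.closedBall x r := by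
  refine closure_minimal (fun y hy => ?_) Metric.isClosed_closedBall
  rw [Metric.mem_closedBall, dist_eq_norm]
  by_contra h'
  exact hy (h y (not_le.1 h').le)

theorem isTest_of_closedBall {Ω : Set (E d)} {f : E d → ℝ} (hf : ContDiff ℝ ∞ f)
    (h : ∀ y, r ≤ ‖y - x‖ → f y = 0) (hΩ : Metric.closedBall x r ⊆ Ω) : IsTest Ω f :=
  ⟨hf, (isCompact_closedBall x r).of_isClosed_subset (isClosed_tsupport f)
    (tsupport_subset_closedBall h), (tsupport_subset_closedBall h).trans hΩ⟩

theorem isTest_mollifier {Ω : Set (E d)} (ht : 0 < t) (hΩ : Metric.closedBall x t ⊆ Ω) :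
    IsTest Ω (mollifier t x) :=
  isTest_of_closedBall (contDiff_mollifier t x) (fun _ h => mollifier_eq_zero ht h) hΩ

theorem integral_mollifier (ht : 0 < t) (x : E d) : ∫ y, mollifier t x y = mass d := by
  have h1 : ∫ y, mollifier t x y = ∫ y : E d, t ^ (-(d : ℤ)) * profile (‖t⁻¹ • y‖ ^ 2) := by
    rw [← integral_add_right_eq_self _ x]
    refine integral_congr_ae (Eventually.of_forall fun y => ?_)
    simp only [mollifier, add_sub_cancel_right, norm_smul, norm_inv, Real.norm_eq_abs,
      abs_of_pos ht, mul_pow, zpow_neg, inv_pow]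
    rw [mul_comm (‖y‖ ^ 2)]
    rfl
  rw [h1, integral_const_mul, Measure.integral_comp_inv_smul_of_nonneg _
    (fun y : E d => profile (‖y‖ ^ 2)) ht.le, mass]
  simp [ht.ne']

theorem mass_pos (d : ℕ) : 0 < mass d := by
  have hm : mass d = ∫ y : E d, mollifier 1 0 y := by simp [mass, mollifier]
  have ht : IsTest univ (mollifier 1 (0 : E d)) := isTest_mollifier one_pos (subset_univ _)
  rw [hm]
  refine (ht.1.continuous.integral_pos_of_hasCompactSupport_nonneg_nonzero ht.2.1
    (mollifier_nonneg zero_le_one 0) (x := 0) ?_)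
  simp only [mollifier, sub_self, norm_zero]
  have := profile_pos (s := 0) (by norm_num)
  norm_num
  exact this.ne'

theorem contDiff_green (hε : 0 < ε) (hr : ε ≤ r) (x : E d) : ContDiff ℝ ∞ (green ε r x) :=
  contDiff_norm_sq_comp (contDiff_scaleIntegral hε hr contDiff_profilePrim _) x

theorem scaleIntegral_eq_zero {k : ℤ} (hε : 0 ≤ ε) (hr : ε ≤ r) {a : ℝ} (h : r ≤ a) :
    scaleIntegral k profilePrim ε r (a ^ 2) = 0 := by
  have : scaleIntegral k profilePrim ε r (a ^ 2) = ∫ t in ε..r, (0 : ℝ) := by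
    refine intervalIntegral.integral_congr_ae (Eventually.of_forall fun t ht => ?_)
    rw [uIoc_of_le hr] at ht
    rw [profilePrim_eq_zero (one_le_mul_zpow (hε.trans_lt ht.1) (ht.2.trans h)), mul_zero]
  simp [this]

theorem green_eq_zero (hε : 0 ≤ ε) (hr : ε ≤ r) (h : r ≤ ‖y - x‖) : green ε r x y = 0 :=
  scaleIntegral_eq_zero hε hr h

theorem isTest_green {Ω : Set (E d)} (hε : 0 < ε) (hr : ε ≤ r)
    (hΩ : Metric.closedBall x r ⊆ Ω) : IsTest Ω (green ε r x) :=
  isTest_of_closedBall (contDiff_green hε hr x) (fun _ h => green_eq_zero hε.le hr h) hΩ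

theorem green_nonneg (hε : 0 ≤ ε) (hr : ε ≤ r) (x y : E d) : 0 ≤ green ε r x y :=
  intervalIntegral.integral_nonneg hr fun _ ht =>
    mul_nonneg (zpow_nonneg (hε.trans ht.1) _) (profilePrim_nonneg _)

/-- `-Δ Φ_{ε,r} = η_ε - η_r`: the `t`-derivative of `η_t` is the Laplacian of
`t^{1-d} profilePrim(|·|² / t²)`. -/
theorem laplacian_green (hε : 0 < ε) (hr : ε ≤ r) (x y : E d) :
    Laplacian.laplacian (green ε r x) y = mollifier r x y - mollifier ε x y := by
  set s := ‖y - x‖ ^ 2 with hs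
  have hP := contDiff_profilePrim
  have hP' : ContDiff ℝ ∞ (deriv profilePrim) := (contDiff_infty_iff_deriv.1 hP).2
  have hE : deriv (deriv profilePrim) = fun s => -(1 / 2) * deriv profile s := by
    rw [deriv_profilePrim]
    ext u
    exact deriv_const_mul _ ((contDiff_profile.differentiable (by simp)) u)
  have h1 := laplacian_norm_sq_comp (contDiff_scaleIntegral hε hr hP (1 - d)) x y
  rw [deriv_scaleIntegral hP _ hε hr, deriv_scaleIntegral hP' _ hε hr, ← hs] at h1
  have h2 : Laplacian.laplacian (green ε r x) y =
      2 * d * scaleIntegral (1 - d - 2) (deriv profilePrim) ε r s +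
        4 * s * scaleIntegral (1 - d - 2 - 2) (deriv (deriv profilePrim)) ε r s := h1
  -- the integrand is the `t`-derivative of `t ↦ η_t(y - x)`
  have hFTC : ∫ t in ε..r, (2 * d * (t ^ (1 - d - 2 : ℤ) * deriv profilePrim (s * t ^ (-2 : ℤ))) +
      4 * s * (t ^ (1 - d - 2 - 2 : ℤ) * deriv (deriv profilePrim) (s * t ^ (-2 : ℤ)))) =
      mollifier r x y - mollifier ε x y := by
    refine intervalIntegral.integral_eq_sub_of_hasDerivAt (f := fun t => mollifier t x y)
      (fun t ht => ?_) ?_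
    · rw [uIcc_of_le hr] at ht
      have ht0 : t ≠ 0 := (hε.trans_le ht.1).ne'
      have a1 : HasDerivAt (fun t : ℝ => t ^ (-(d : ℤ))) ((-(d : ℤ) : ℤ) * t ^ (-(d : ℤ) - 1)) t :=
        hasDerivAt_zpow _ t (Or.inl ht0)
      have a2 : HasDerivAt (fun t : ℝ => s * t ^ (-2 : ℤ)) (s * ((-2 : ℤ) * t ^ (-2 - 1 : ℤ))) t :=
        (hasDerivAt_zpow _ t (Or.inl ht0)).const_mul s
      have a3 := ((contDiff_profile.differentiable (by simp)) (s * t ^ (-2 : ℤ))).hasDerivAt.comp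
        t a2
      refine (a1.mul a3).congr_deriv ?_
      rw [hE, deriv_profilePrim]
      have e1 : (1 - d - 2 : ℤ) = -(d : ℤ) + (-1) := by ring
      have e2 : (1 - d - 2 - 2 : ℤ) = -(d : ℤ) + (-3) := by ring
      have e3 : (-(d : ℤ) - 1 : ℤ) = -(d : ℤ) + (-1) := by ring
      have e4 : (-2 - 1 : ℤ) = -3 := by norm_num
      rw [e2, e1, e3, e4, zpow_add₀ ht0, zpow_add₀ ht0]
      push_cast
      simp only [Function.comp]
      ring
    · exact ((intervalIntegrable_scale hP'.continuous _ hε hr s).const_mul _).add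
        ((intervalIntegrable_scale (contDiff_infty_iff_deriv.1 hP').2.continuous _ hε hr
          s).const_mul _)
  rw [h2, ← hFTC, intervalIntegral.integral_add, intervalIntegral.integral_const_mul,
    intervalIntegral.integral_const_mul, scaleIntegral, scaleIntegral]
  · exact (intervalIntegrable_scale hP'.continuous _ hε hr s).const_mul _
  · exact (intervalIntegrable_scale (contDiff_infty_iff_deriv.1 hP').2.continuous _ hε hr
      s).const_mul _

theorem green_add {a b c : ℝ} (ha : 0 < a) (hab : a ≤ b) (hbc : b ≤ c) (x y : E d) :
    green a b x y + green b c x y = green a c x y :=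
  intervalIntegral.integral_add_adjacent_intervals
    (intervalIntegrable_scale contDiff_profilePrim.continuous _ ha hab _)
    (intervalIntegrable_scale contDiff_profilePrim.continuous _ (ha.trans_le hab) hbc _)

/-- Off the ball of radius `ε`, the parametrix coincides with its smooth truncation. -/
theorem green_zero_eq (hε : 0 < ε) (hr : ε ≤ r) (h : ε ≤ ‖y - x‖) :
    green 0 r x y = green ε r x y := by
  have h0 : ∀ t ∈ uIoc 0 ε, t ^ (1 - d : ℤ) * profilePrim (‖y - x‖ ^ 2 * t ^ (-2 : ℤ)) = 0 :=
    fun t ht => by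
      rw [uIoc_of_le hε.le] at ht
      rw [profilePrim_eq_zero (one_le_mul_zpow ht.1 (ht.2.trans h)), mul_zero]
  have hi : IntervalIntegrable (fun t => t ^ (1 - d : ℤ) *
      profilePrim (‖y - x‖ ^ 2 * t ^ (-2 : ℤ))) volume 0 ε :=
    (intervalIntegrable_const (c := (0 : ℝ))).congr fun t ht => (h0 t ht).symm
  have h1 := intervalIntegral.integral_add_adjacent_intervals hi
    (intervalIntegrable_scale contDiff_profilePrim.continuous (1 - d) hε hr (‖y - x‖ ^ 2))
  have h2 : ∫ t in (0 : ℝ)..ε, t ^ (1 - d : ℤ) * profilePrim (‖y - x‖ ^ 2 * t ^ (-2 : ℤ)) =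
      ∫ t in (0 : ℝ)..ε, (0 : ℝ) :=
    intervalIntegral.integral_congr_ae (Eventually.of_forall h0)
  rw [h2, intervalIntegral.integral_zero, zero_add] at h1
  exact h1.symm

theorem green_le_green_zero (hε : 0 < ε) (hr : ε ≤ r) (h : y ≠ x) :
    green ε r x y ≤ green 0 r x y := by
  have hp : 0 < ‖y - x‖ := norm_pos_iff.2 (sub_ne_zero.2 h)
  have hδ : 0 < min ε ‖y - x‖ := lt_min hε hp
  rw [green_zero_eq hδ ((min_le_left _ _).trans hr) (min_le_right _ _),
    ← green_add hδ (min_le_left _ _) hr]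
  linarith [green_nonneg hδ.le (min_le_left ε ‖y - x‖) x y]

theorem abs_mollifier_integral_le (ht : 0 < t) (x : E d) :
    ∫ y, mollifier t x y * ‖y - x‖ ^ 2 ≤ t ^ 2 * mass d := by
  have hT : IsTest univ (mollifier t x) := isTest_mollifier ht (subset_univ _)
  have hc : Continuous fun y : E d => ‖y - x‖ ^ 2 := by fun_prop
  rw [← integral_mollifier ht x, ← integral_const_mul]
  refine integral_mono ((hT.1.continuous.mul hc).integrable_of_hasCompactSupport hT.2.1.mul_right)
    ((hT.1.continuous.integrable_of_hasCompactSupport hT.2.1).const_mul _) fun y => ?_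
  rcases le_total t ‖y - x‖ with h | h
  · rw [mollifier_eq_zero ht h]; simp
  · rw [mul_comm]
    gcongr
    exact mollifier_nonneg ht.le x y

/-- The integrals of the truncations are bounded, by Green's formula with `|y - x|²`. -/
theorem integral_green_le (hd : 0 < d) (hε : 0 < ε) (hr : ε ≤ r) (x : E d) :
    ∫ y, green ε r x y ≤ r ^ 2 * mass d := by
  have hr0 : 0 < r := hε.trans_le hr
  have hG : IsTest univ (green ε r x) := isTest_green hε hr (subset_univ _)
  have hq : ContDiff ℝ ∞ (fun y : E d => ‖y - x‖ ^ 2) :=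
    contDiff_norm_sq_comp (J := fun s => s) contDiff_id x
  have h1 : ∀ y : E d, Laplacian.laplacian (fun y : E d => ‖y - x‖ ^ 2) y = 2 * d := fun y => by
    have := laplacian_norm_sq_comp (J := fun s => s) contDiff_id x y
    simpa using this
  have hT1 : IsTest univ (mollifier r x) := isTest_mollifier hr0 (subset_univ _)
  have hT2 : IsTest univ (mollifier ε x) := isTest_mollifier hε (subset_univ _)
  have hint : ∀ {ψ : E d → ℝ}, IsTest univ ψ → Integrable fun y => ψ y * ‖y - x‖ ^ 2 := fun hψ =>
    (hψ.1.continuous.mul hq.continuous).integrable_of_hasCompactSupport hψ.2.1.mul_right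
  -- `Δ|y - x|² = 2d`, and two integrations by parts move `Δ` onto `Φ_{ε,r}`
  have key : ∫ y, green ε r x y * (2 * d) =
      ∫ y, (mollifier r x y - mollifier ε x y) * ‖y - x‖ ^ 2 := by
    have e1 : ∀ y, green ε r x y * (2 * d) =
        ∑ j, green ε r x y * pderiv j (pderiv j fun y : E d => ‖y - x‖ ^ 2) y := fun y => by
      rw [← h1 y, laplacian_eq_sum hq, Finset.mul_sum]
    have e2 : ∀ y, (mollifier r x y - mollifier ε x y) * ‖y - x‖ ^ 2 =
        ∑ j, pderiv j (pderiv j (green ε r x)) y * ‖y - x‖ ^ 2 := fun y => by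
      rw [← laplacian_green hε hr, laplacian_eq_sum hG.1, Finset.sum_mul]
    simp_rw [e1, e2]
    rw [integral_finsetSum, integral_finsetSum]
    · refine Finset.sum_congr rfl fun j _ => ?_
      rw [integral_mul_pderiv hG.1 hG.2.1 (contDiff_pderiv hq j),
        integral_mul_pderiv (hG.pderiv j).1 (hG.pderiv j).2.1 hq, neg_neg]
    · exact fun j _ => hint ((hG.pderiv j).pderiv j)
    · exact fun j _ => (hG.1.continuous.mul (contDiff_pderiv (contDiff_pderiv hq j)
        j).continuous).integrable_of_hasCompactSupport hG.2.1.mul_right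
  have h2 : ∫ y, (mollifier r x y - mollifier ε x y) * ‖y - x‖ ^ 2 ≤ r ^ 2 * mass d := by
    simp_rw [sub_mul]
    rw [integral_sub (hint hT1) (hint hT2)]
    have a1 := abs_mollifier_integral_le hr0 x
    have a2 : 0 ≤ ∫ y, mollifier ε x y * ‖y - x‖ ^ 2 := integral_nonneg fun y =>
      mul_nonneg (mollifier_nonneg hε.le x y) (by positivity)
    linarith
  rw [integral_mul_const] at key
  have h3 : 0 ≤ ∫ y, green ε r x y := integral_nonneg (green_nonneg hε.le hr x)
  have h4 : (1 : ℝ) ≤ d := by exact_mod_cast hd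
  nlinarith

theorem ae_ne (hd : 0 < d) (x : E d) : ∀ᵐ y : E d, y ≠ x := by
  have : Nonempty (Fin d) := ⟨⟨0, hd⟩⟩
  have h := Measure.ae_ne (volume : Measure (E d)) x
  exact h

theorem tendsto_green (hr : 0 < r) (h : y ≠ x) :
    Tendsto (fun ε => green ε r x y) (𝓝[>] 0) (𝓝 (green 0 r x y)) := by
  have hp : 0 < min r ‖y - x‖ := lt_min hr (norm_pos_iff.2 (sub_ne_zero.2 h))
  refine tendsto_const_nhds.congr' ?_
  filter_upwards [Ioc_mem_nhdsGT hp] with ε hε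
  exact green_zero_eq hε.1 (hε.2.trans (min_le_left _ _)) (hε.2.trans (min_le_right _ _))

theorem integrable_green (hε : 0 < ε) (hr : ε ≤ r) (x : E d) : Integrable (green ε r x) := by
  have hG : IsTest univ (green ε r x) := isTest_green hε hr (subset_univ _)
  exact hG.1.continuous.integrable_of_hasCompactSupport hG.2.1

/-- By Fatou's lemma, from the bound on the integrals of the truncations. -/
theorem integrable_green_zero (hd : 0 < d) (hr : 0 < r) (x : E d) : Integrable (green 0 r x) := by
  let e : ℕ → ℝ := fun n => r / (n + 1)
  have he0 : ∀ n, 0 < e n := fun n => by positivity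
  have her : ∀ n, e n ≤ r := fun n => div_le_self hr.le (by simp)
  have het : Tendsto e atTop (𝓝[>] 0) := by
    refine tendsto_nhdsWithin_iff.2 ⟨?_, Eventually.of_forall he0⟩
    exact tendsto_const_nhds.div_atTop
      (tendsto_atTop_add_const_right _ _ tendsto_natCast_atTop_atTop)
  have hlim : ∀ᵐ y : E d, Tendsto (fun n => green (e n) r x y) atTop (𝓝 (green 0 r x y)) := by
    filter_upwards [ae_ne hd x] with y hy
    exact (tendsto_green hr hy).comp het
  have hm : AEStronglyMeasurable (green 0 r x) volume :=
    aestronglyMeasurable_of_tendsto_ae atTop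
      (fun n => (contDiff_green (he0 n) (her n) x).continuous.aestronglyMeasurable) hlim
  refine ⟨hm, ?_⟩
  have hF : ∫⁻ y, ‖green 0 r x y‖ₑ ≤ liminf (fun n => ∫⁻ y, ‖green (e n) r x y‖ₑ) atTop := by
    refine le_trans (le_of_eq ?_) (lintegral_liminf_le' fun n =>
      (contDiff_green (he0 n) (her n) x).continuous.aestronglyMeasurable.enorm)
    refine lintegral_congr_ae ?_
    filter_upwards [hlim] with y hy
    exact (hy.enorm.liminf_eq).symm
  refine hF.trans_lt (lt_of_le_of_lt (b := ENNReal.ofReal (r ^ 2 * mass d)) ?_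
    ENNReal.ofReal_lt_top)
  refine liminf_le_of_le (by isBoundedDefault) fun b hb => ?_
  obtain ⟨n, hn⟩ := hb.exists
  refine hn.trans ?_
  rw [← ofReal_integral_norm_eq_lintegral_enorm (integrable_green (he0 n) (her n) x)]
  refine ENNReal.ofReal_le_ofReal (le_of_eq_of_le ?_ (integral_green_le hd (he0 n) (her n) x))
  exact integral_congr_ae (Eventually.of_forall fun y =>
    Real.norm_of_nonneg (green_nonneg (he0 n).le (her n) x y))

theorem integral_green_sub_eq (x : E d) : ∫ y, |green 0 r x y - green ε r x y| =
    ∫ y : E d, |green 0 r 0 y - green ε r 0 y| := by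
  rw [← integral_add_right_eq_self _ x]
  simp [green]

/-- The truncations converge to the parametrix in `L¹`, uniformly in the centre. -/
theorem tendsto_integral_green_sub (hd : 0 < d) (hr : 0 < r) (x : E d) :
    Tendsto (fun ε => ∫ y, |green 0 r x y - green ε r x y|) (𝓝[>] 0) (𝓝 0) := by
  suffices h0 : Tendsto (fun ε => ∫ y, |green 0 r x y - green ε r x y|) (𝓝[>] 0)
      (𝓝 (∫ _ : E d, (0 : ℝ))) by simpa using h0
  have hmem : ∀ᶠ ε in 𝓝[>] (0 : ℝ), 0 < ε ∧ ε ≤ r := by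
    filter_upwards [Ioc_mem_nhdsGT hr] with ε hε using hε
  refine tendsto_integral_filter_of_dominated_convergence (fun y => green 0 r x y) ?_ ?_
    (integrable_green_zero hd hr x) ?_
  · filter_upwards [hmem] with ε hε
    exact ((integrable_green_zero hd hr x).sub (integrable_green hε.1 hε.2 x)).1.norm
  · filter_upwards [hmem] with ε hε
    filter_upwards [ae_ne hd x] with y hy
    rw [Real.norm_eq_abs, abs_abs, abs_of_nonneg (sub_nonneg.2 (green_le_green_zero hε.1 hε.2 hy))]
    linarith [green_nonneg hε.1.le hε.2 x y]
  · filter_upwards [ae_ne hd x] with y hy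
    have := ((tendsto_const_nhds (x := green 0 r x y)).sub (tendsto_green hr hy)).abs
    simpa using this

end Mollifier

/-! ### Approximate identities and interior regularity -/

section ApproximateIdentity

variable {d : ℕ} {Ω : Set (E d)}

theorem tendsto_average_of_continuousOn (hΩ : IsOpen Ω) {f : E d → ℝ} (hf : ContinuousOn f Ω)
    {x : E d} (hx : x ∈ Ω) :
    Tendsto (fun ε => ⨍ y in Metric.closedBall x ε, ‖f y - f x‖) (𝓝[>] 0) (𝓝 0) := by
  rw [Metric.tendsto_nhds]
  intro δ hδ
  have hc : ContinuousAt f x := hf.continuousAt (hΩ.mem_nhds hx)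
  obtain ⟨R, hR, hball⟩ := Metric.continuousAt_iff.1 hc (δ / 2) (by positivity)
  filter_upwards [Ioo_mem_nhdsGT hR] with ε hε
  have hb : ∀ y ∈ Metric.closedBall x ε, ‖‖f y - f x‖‖ ≤ δ / 2 := fun y hy => by
    rw [norm_norm, ← dist_eq_norm]
    exact (hball ((Metric.mem_closedBall.1 hy).trans_lt hε.2)).le
  have h1 := norm_setIntegral_le_of_norm_le_const (μ := volume)
    (measure_closedBall_lt_top (x := x) (r := ε)) hb
  have h2 : 0 < volume.real (Metric.closedBall x ε) :=
    ENNReal.toReal_pos (Metric.measure_closedBall_pos volume x hε.1).ne'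
      measure_closedBall_lt_top.ne
  rw [setAverage_eq, dist_zero_right, norm_smul, norm_inv, Real.norm_of_nonneg h2.le,
    inv_mul_lt_iff₀ h2]
  nlinarith

theorem eventually_closedBall_subset (hΩ : IsOpen Ω) {x : E d} (hx : x ∈ Ω) :
    ∀ᶠ ε in 𝓝[>] (0 : ℝ), Metric.closedBall x ε ⊆ Ω := by
  obtain ⟨R, hR, h⟩ := Metric.nhds_basis_closedBall.mem_iff.1 (hΩ.mem_nhds hx)
  filter_upwards [Ioo_mem_nhdsGT hR] with ε hε
  exact (Metric.closedBall_subset_closedBall hε.2.le).trans h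

theorem mollifier_le {t : ℝ} (ht : 0 ≤ t) (x y : E d) :
    mollifier t x y ≤ t ^ (-(d : ℤ)) * profile 0 :=
  mul_le_mul_of_nonneg_left (profile_le (mul_nonneg (by positivity) (zpow_nonneg ht _)))
    (zpow_nonneg ht _)

theorem tendsto_integral_mollifier_of_average {f : E d → ℝ} {x : E d}
    (hf : Tendsto (fun ε => ⨍ y in Metric.closedBall x ε, ‖f y - f x‖) (𝓝[>] 0) (𝓝 0))
    (hi : ∀ᶠ ε in 𝓝[>] (0 : ℝ), IntegrableOn f (Metric.closedBall x ε)) :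
    Tendsto (fun ε => ∫ y, mollifier ε x y * f y) (𝓝[>] 0) (𝓝 (mass d * f x)) := by
  have hm := mass_pos d
  have hpos : ∀ᶠ ε in 𝓝[>] (0 : ℝ), 0 < ε := self_mem_nhdsWithin
  have := tendsto_integral_smul_of_tendsto_average_norm_sub
    (g := fun ε y => mollifier ε x y / mass d)
    (profile 0 / mass d * volume.real (Metric.ball (0 : E d) 1)) hf hi
    (tendsto_const_nhds.congr' (f₁ := fun _ => (1 : ℝ)) ?_) ?_ ?_
  · have h2 := this.const_mul (mass d)
    refine h2.congr fun ε => ?_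
    rw [← integral_const_mul]
    refine integral_congr_ae (Eventually.of_forall fun y => ?_)
    simp only [smul_eq_mul]
    field_simp
  · filter_upwards [hpos] with ε hε
    rw [integral_div, integral_mollifier hε, div_self hm.ne']
  · filter_upwards [hpos] with ε hε y hy
    exact support_mollifier_subset hε x fun h => hy (by simp [h])
  · have hv : volume.real (Metric.ball (0 : E d) 1) ≠ 0 :=
      (ENNReal.toReal_pos (Metric.measure_ball_pos volume (0 : E d) one_pos).ne'
        measure_ball_lt_top.ne).ne'
    filter_upwards [hpos] with ε hε y
    rw [Measure.addHaar_real_closedBall _ _ hε.le, finrank_euclideanSpace, Fintype.card_fin,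
      abs_of_nonneg (div_nonneg (mollifier_nonneg hε.le x y) hm.le), mul_div_mul_right _ _ hv,
      div_right_comm, div_le_div_iff_of_pos_right hm]
    refine (mollifier_le hε.le x y).trans (le_of_eq ?_)
    rw [zpow_neg, zpow_natCast]
    field_simp

/-- Mollification converges at points of continuity. -/
theorem tendsto_integral_mollifier (hΩ : IsOpen Ω) {f : E d → ℝ} (hf : ContinuousOn f Ω)
    {x : E d} (hx : x ∈ Ω) :
    Tendsto (fun ε => ∫ y in Ω, mollifier ε x y * f y) (𝓝[>] 0) (𝓝 (mass d * f x)) := by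
  have hsub := eventually_closedBall_subset hΩ hx
  refine (tendsto_integral_mollifier_of_average (tendsto_average_of_continuousOn hΩ hf hx)
    ?_).congr' ?_
  · filter_upwards [hsub] with ε hε
    exact (hf.mono hε).integrableOn_compact (isCompact_closedBall x ε)
  · filter_upwards [hsub, self_mem_nhdsWithin] with ε hε hpos
    exact ((isTest_mollifier hpos hε).setIntegral_eq fun y hy => by simp [hy]).symm

/-- Mollification converges at the Lebesgue points. -/
theorem ae_tendsto_integral_mollifier (hΩ : IsOpen Ω) {f : E d → ℝ} (hf : IntegrableOn f Ω) :
    ∀ᵐ x ∂(volume.restrict Ω),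
      Tendsto (fun ε => ∫ y in Ω, mollifier ε x y * f y) (𝓝[>] 0) (𝓝 (mass d * f x)) := by
  have hF : Integrable (Ω.indicator f) := hf.integrable_indicator hΩ.measurableSet
  rw [ae_restrict_iff' hΩ.measurableSet]
  filter_upwards [(Besicovitch.vitaliFamily (volume : Measure (E d))).ae_tendsto_average_norm_sub
    hF.locallyIntegrable] with x h hx
  have h1 := tendsto_integral_mollifier_of_average (f := Ω.indicator f) (x := x)
    (h.comp (Besicovitch.tendsto_filterAt volume x))
    (Eventually.of_forall fun _ => hF.integrableOn)
  rw [indicator_of_mem hx] at h1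
  refine h1.congr fun ε => ?_
  rw [← integral_indicator hΩ.measurableSet]
  refine integral_congr_ae (Eventually.of_forall fun y => ?_)
  by_cases hy : y ∈ Ω <;> simp [hy]

end ApproximateIdentity

section Regularity

variable {d : ℕ} {Ω : Set (E d)} {w g : E d → ℝ}

theorem exists_ae_bound {α : Type*} [MeasurableSpace α] {μ : Measure α} {g : α → ℝ}
    (hg : MemLp g ∞ μ) : ∃ C, 0 ≤ C ∧ ∀ᵐ y ∂μ, ‖g y‖ ≤ C := by
  refine ⟨(eLpNorm g ∞ μ).toReal, ENNReal.toReal_nonneg, ?_⟩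
  have h := hg.2.ne
  rw [eLpNorm_exponent_top] at h ⊢
  filter_upwards [enorm_ae_le_eLpNormEssSup g μ] with y hy
  rw [← toReal_enorm]
  exact ENNReal.toReal_mono h hy

/-- Truncating the parametrix changes the potential of a bounded function by an amount that is
small uniformly in the pole. -/
theorem abs_integral_mul_green_sub_le (hd : 0 < d) {ε r : ℝ} (hε : 0 < ε) (hr : ε ≤ r)
    (hg : AEStronglyMeasurable g (volume.restrict Ω)) {C : ℝ} (hC0 : 0 ≤ C)
    (hC : ∀ᵐ y ∂(volume.restrict Ω), ‖g y‖ ≤ C) (x : E d) :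
    |(∫ y in Ω, g y * green 0 r x y) - ∫ y in Ω, g y * green ε r x y| ≤
      C * ∫ y : E d, |green 0 r 0 y - green ε r 0 y| := by
  have i0 := integrable_green_zero hd (hε.trans_le hr) x
  have i1 := integrable_green hε hr x
  rw [← integral_sub (i0.restrict.bdd_mul (c := C) hg hC) (i1.restrict.bdd_mul (c := C) hg hC),
    ← integral_green_sub_eq x, ← integral_const_mul]
  refine (abs_integral_le_integral_abs).trans ?_
  refine (integral_mono_ae (g := fun y => C * |green 0 r x y - green ε r x y|) ?_ ?_ ?_).trans ?_
  · exact ((i0.restrict.bdd_mul (c := C) hg hC).sub (i1.restrict.bdd_mul (c := C) hg hC)).abs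
  · exact ((i0.sub i1).abs.const_mul C).restrict
  · filter_upwards [hC] with y hy
    rw [← mul_sub, abs_mul]
    gcongr
    exact hy
  · exact setIntegral_le_integral ((i0.sub i1).abs.const_mul C)
      (Eventually.of_forall fun y => by positivity)

theorem tendsto_integral_mul_green (hd : 0 < d) {r : ℝ} (hr : 0 < r)
    (hg : MemLp g ∞ (volume.restrict Ω)) (x : E d) :
    Tendsto (fun ε => ∫ y in Ω, g y * green ε r x y) (𝓝[>] 0)
      (𝓝 (∫ y in Ω, g y * green 0 r x y)) := by
  obtain ⟨C, hC0, hC⟩ := exists_ae_bound hg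
  rw [tendsto_iff_dist_tendsto_zero]
  refine squeeze_zero' (Eventually.of_forall fun _ => dist_nonneg) ?_
    (by simpa using (tendsto_integral_green_sub hd hr (0 : E d)).const_mul C)
  filter_upwards [Ioc_mem_nhdsGT hr] with ε hε
  rw [dist_comm, Real.dist_eq]
  exact abs_integral_mul_green_sub_le hd hε.1 hε.2 hg.1 hC0 hC x

theorem continuous_integral_mul_mollifier (hw : IntegrableOn w Ω) {t : ℝ} (ht : 0 < t) :
    Continuous fun x => ∫ y in Ω, mollifier t x y * w y := by
  refine continuous_of_dominated (bound := fun y => (t ^ (-(d : ℤ)) * profile 0) * ‖w y‖)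
    (fun x => (contDiff_mollifier t x).continuous.aestronglyMeasurable.mul hw.1)
    (fun x => Eventually.of_forall fun y => ?_) (hw.norm.const_mul _)
    (Eventually.of_forall fun y => ?_)
  · rw [norm_mul, Real.norm_of_nonneg (mollifier_nonneg ht.le x y)]
    gcongr
    exact mollifier_le ht.le x y
  · simp_rw [fun x => mollifier_comm t x y]
    exact (contDiff_mollifier t y).continuous.mul continuous_const

/-- Interior regularity: a distributional solution of `-Δ w = g` with bounded `g` has a
continuous representative. On small balls `w * η_ε = w * η_r + g * Φ_{ε,r}`, and the right-hand
side converges locally uniformly as `ε → 0`. -/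
theorem exists_continuousOn_of_laplacian_eq (hd : 0 < d) (hΩ : IsOpen Ω)
    (hw : IntegrableOn w Ω) (hg : MemLp g ∞ (volume.restrict Ω))
    (h : ∀ ψ, IsTest Ω ψ → ∫ y in Ω, w y * -Laplacian.laplacian ψ y = ∫ y in Ω, g y * ψ y) :
    ∃ w', ContinuousOn w' Ω ∧ w =ᵐ[volume.restrict Ω] w' := by
  obtain ⟨C, hC0, hC⟩ := exists_ae_bound hg
  have hm := mass_pos d
  set M : ℝ → E d → ℝ := fun ε x => ∫ y in Ω, mollifier ε x y * w y with hM
  have hMc : ∀ {ε : ℝ}, 0 < ε → Continuous (M ε) := fun hε =>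
    continuous_integral_mul_mollifier hw hε
  have hi : ∀ {ε : ℝ} (x : E d), 0 < ε →
      Integrable (fun y => w y * mollifier ε x y) (volume.restrict Ω) := fun {ε} x hε =>
    Integrable.mul_bdd (c := ε ^ (-(d : ℤ)) * profile 0) hw
      (contDiff_mollifier ε x).continuous.aestronglyMeasurable (Eventually.of_forall fun y => by
        rw [Real.norm_of_nonneg (mollifier_nonneg hε.le x y)]
        exact mollifier_le hε.le x y)
  -- the equation tested with `Φ_{ε,r}(· - x)`
  have hrep : ∀ {ε r : ℝ} {x : E d}, 0 < ε → ε ≤ r → Metric.closedBall x r ⊆ Ω →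
      M ε x = M r x + ∫ y in Ω, g y * green ε r x y := fun {ε r x} hε hr hx => by
    have e := h _ (isTest_green hε hr hx)
    simp_rw [laplacian_green hε hr] at e
    rw [← e]
    have e2 : ∀ y, w y * -(mollifier r x y - mollifier ε x y) =
        w y * mollifier ε x y - w y * mollifier r x y := fun y => by ring
    simp_rw [e2]
    rw [integral_sub (hi x hε) (hi x (hε.trans_le hr))]
    simp only [hM]
    simp_rw [mul_comm (w _)]
    ring
  -- `w'` is the limit of the normalised mollifications; it exists locally uniformly, and at
  -- Lebesgue points it equals `w`
  let w' : E d → ℝ := fun x => (mass d)⁻¹ * limUnder (𝓝[>] 0) (fun ε => M ε x)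
  refine ⟨w', fun x hx => ?_, ?_⟩
  · obtain ⟨R, hR, hball⟩ := Metric.nhds_basis_closedBall.mem_iff.1 (hΩ.mem_nhds hx)
    have hsub : ∀ z ∈ Metric.ball x (R / 2), Metric.closedBall z (R / 2) ⊆ Ω := fun z hz =>
      (Metric.closedBall_subset_closedBall' (by
        have := Metric.mem_ball.1 hz; linarith)).trans hball
    have hR2 : 0 < R / 2 := by positivity
    let W : E d → ℝ := fun z => M (R / 2) z + ∫ y in Ω, g y * green 0 (R / 2) z y
    have hunif : TendstoUniformlyOn M W (𝓝[>] 0) (Metric.ball x (R / 2)) := by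
      rw [Metric.tendstoUniformlyOn_iff]
      intro δ hδ
      have ht : Tendsto (fun ε => C * ∫ y : E d, |green 0 (R / 2) 0 y - green ε (R / 2) 0 y|)
          (𝓝[>] 0) (𝓝 0) := by
        simpa using (tendsto_integral_green_sub hd hR2 (0 : E d)).const_mul C
      filter_upwards [Ioc_mem_nhdsGT hR2, ht.eventually_lt_const hδ] with ε hε hlt z hz
      rw [hrep hε.1 hε.2 (hsub z hz), Real.dist_eq]
      refine lt_of_le_of_lt ?_ hlt
      rw [add_sub_add_left_eq_sub]
      exact abs_integral_mul_green_sub_le hd hε.1 hε.2 hg.1 hC0 hC z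
    have hWc : ContinuousOn W (Metric.ball x (R / 2)) :=
      hunif.continuousOn (Eventually.frequently (by
        filter_upwards [self_mem_nhdsWithin] with ε hε
        exact (hMc hε).continuousOn))
    have hW : ∀ z ∈ Metric.ball x (R / 2), w' z = (mass d)⁻¹ * W z := fun z hz => by
      simp only [w']
      rw [(hunif.tendsto_at hz).limUnder_eq]
    have hnhds : Metric.ball x (R / 2) ∈ 𝓝 x := Metric.ball_mem_nhds x hR2
    have hca : ContinuousAt (fun z => (mass d)⁻¹ * W z) x :=
      continuousAt_const.mul (hWc.continuousAt hnhds)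
    refine (hca.congr ?_).continuousWithinAt
    filter_upwards [hnhds] with z hz
    exact (hW z hz).symm
  · filter_upwards [ae_tendsto_integral_mollifier hΩ hw] with x hx
    simp only [w']
    rw [Tendsto.limUnder_eq hx, inv_mul_cancel_left₀ hm.ne']

end Regularity

/-! ### Existence of weak solutions -/

/-- Lax–Milgram for a closed space `W` of pairs whose first component is controlled by the second:
the form `⟨p.snd, q.snd⟩` is coercive on `W`. -/
theorem exists_inner_snd_eq {X Y : Type*} [NormedAddCommGroup X] [InnerProductSpace ℝ X]
    [CompleteSpace X] [NormedAddCommGroup Y] [InnerProductSpace ℝ Y] [CompleteSpace Y]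
    (W : Submodule ℝ (WithLp 2 (X × Y))) (hW : IsClosed {p | p ∈ W}) {C : ℝ}
    (hC : ∀ p ∈ W, ‖p.fst‖ ≤ C * ‖p.snd‖) (a : X) :
    ∃ p ∈ W, ∀ q ∈ W, inner ℝ p.snd q.snd = inner ℝ a q.fst := by
  have : CompleteSpace W := hW.completeSpace_coe
  let T : W →L[ℝ] Y := (WithLp.sndL 2 ℝ X Y).comp W.subtypeL
  let S : W →L[ℝ] X := (WithLp.fstL 2 ℝ X Y).comp W.subtypeL
  let B : W →L[ℝ] W →L[ℝ] ℝ := (innerSL ℝ).bilinearComp T T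
  have hB : ∀ p q, B p q = inner ℝ (T p) (T q) := fun p q => rfl
  have hco : IsCoercive B := by
    refine ⟨(C ^ 2 + 1)⁻¹, by positivity, fun p => ?_⟩
    rw [hB, real_inner_self_eq_norm_sq]
    have hp : ‖S p‖ ≤ C * ‖T p‖ := hC _ p.2
    have e3 : ‖p‖ ^ 2 = ‖S p‖ ^ 2 + ‖T p‖ ^ 2 := WithLp.prod_norm_sq_eq_of_L2 p.1
    have h4 : ‖S p‖ ^ 2 ≤ (C * ‖T p‖) ^ 2 := by gcongr
    rw [mul_assoc, ← sq, inv_mul_le_iff₀ (by positivity), e3]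
    nlinarith
  let ℓ : W →L[ℝ] ℝ := (innerSL ℝ a).comp S
  let w := (InnerProductSpace.toDual ℝ W).symm ℓ
  let p := hco.continuousLinearEquivOfBilin.symm w
  refine ⟨p, p.2, fun q hq => ?_⟩
  have h1 := hco.continuousLinearEquivOfBilin_apply p ⟨q, hq⟩
  simp only [p, ContinuousLinearEquiv.apply_symm_apply, w,
    InnerProductSpace.toDual_symm_apply] at h1
  exact h1.symm

section Existence

variable {d : ℕ} {Ω : Set (E d)}

/-- The graph of the gradient on `H¹₀(Ω)`, as a subspace of the Hilbert space
`L²(Ω) × L²(Ω; ℝ^d)`. -/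
noncomputable def gradGraph (hΩ : IsOpen Ω) (hΩb : Bornology.IsBounded Ω) :
    Submodule ℝ (WithLp 2 (Lp ℝ 2 (volume.restrict Ω) × Lp (E d) 2 (volume.restrict Ω))) where
  carrier := {p | IsH0 Ω p.fst p.snd}
  add_mem' {p q} hp hq := (IsH0.add hp hq).congr (Lp.coeFn_add p.fst q.fst).symm
    (Lp.coeFn_add p.snd q.snd).symm
  zero_mem' := isH0_zero.congr (Lp.coeFn_zero _ _ _).symm (Lp.coeFn_zero _ _ _).symm
  smul_mem' c p hp := (IsH0.const_smul hΩ hΩb c hp).congr (Lp.coeFn_smul c p.fst).symm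
    (Lp.coeFn_smul c p.snd).symm

theorem isClosed_gradGraph (hΩ : IsOpen Ω) (hΩb : Bornology.IsBounded Ω) :
    IsClosed {p | p ∈ gradGraph hΩ hΩb} := by
  refine IsSeqClosed.isClosed fun p q hp hq => ?_
  have h1 : Tendsto (fun n => (p n).fst) atTop (𝓝 q.fst) :=
    ((WithLp.fstL 2 ℝ _ _).continuous.tendsto q).comp hq
  have h2 : Tendsto (fun n => (p n).snd) atTop (𝓝 q.snd) :=
    ((WithLp.sndL 2 ℝ _ _).continuous.tendsto q).comp hq
  rw [Lp.tendsto_Lp_iff_tendsto_eLpNorm'] at h1 h2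
  refine IsH0.of_tendsto (Lp.memLp _) (Lp.memLp _) (fun n => hp n) ?_ ?_
  · exact h1.congr fun n => eLpNorm_sub_comm _ _ _ _
  · exact h2.congr fun n => eLpNorm_sub_comm _ _ _ _

/-- Existence of weak solutions in `H¹₀(Ω)`, by the Lax–Milgram theorem. -/
theorem exists_isH0_weak (hd : 0 < d) (hΩ : IsOpen Ω) (hΩb : Bornology.IsBounded Ω)
    {g : E d → ℝ} (hg : MemLp g 2 (volume.restrict Ω)) :
    ∃ w G, IsH0 Ω w G ∧ ∀ v H, IsH0 Ω v H →
      ∫ y in Ω, inner ℝ (G y) (H y) = ∫ y in Ω, g y * v y := by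
  obtain ⟨C, hC0, hC⟩ := exists_poincare hd hΩ hΩb
  obtain ⟨p, hp, hpq⟩ := exists_inner_snd_eq (gradGraph hΩ hΩb) (isClosed_gradGraph hΩ hΩb)
    (C := C) (fun p hp => hC _ _ hp) (hg.toLp g)
  refine ⟨_, _, hp, fun v H h => ?_⟩
  have hq := hpq (WithLp.toLp 2 (h.memLp.toLp v, h.memLp_grad.toLp H))
    (h.congr (h.memLp.coeFn_toLp).symm (h.memLp_grad.coeFn_toLp).symm)
  rw [L2.inner_def, L2.inner_def] at hq
  refine Eq.trans ?_ (hq.trans ?_)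
  · refine integral_congr_ae ?_
    filter_upwards [h.memLp_grad.coeFn_toLp] with y hy
    rw [← hy]
    rfl
  · refine integral_congr_ae ?_
    filter_upwards [h.memLp.coeFn_toLp, hg.coeFn_toLp] with y hy hy'
    change inner ℝ ((hg.toLp g) y) ((h.memLp.toLp v) y) = g y * v y
    rw [hy, hy']
    simp [mul_comm]

/-- `H¹₀(Ω)` is complete for the Dirichlet norm. -/
theorem memH10_of_cauchy (hΩ : IsOpen Ω) (hΩb : Bornology.IsBounded Ω) {V : ℕ → E d → ℝ}
    {v : E d → ℝ} (hV : ∀ n, MemH10 Ω (V n)) (hv : MemLp v 2 (volume.restrict Ω))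
    (hlim : Tendsto (fun n => eLpNorm (v - V n) 2 (volume.restrict Ω)) atTop (𝓝 0))
    (hc : Tendsto (fun p : ℕ × ℕ => energyNorm Ω (V p.1 - V p.2)) atTop (𝓝 0)) :
    MemH10 Ω v ∧ Tendsto (fun n => energyNorm Ω (v - V n)) atTop (𝓝 0) := by
  have hV0 := fun n => (hV n).isH0 hΩ
  let L : ℕ → Lp (E d) 2 (volume.restrict Ω) := fun n => (hV0 n).memLp_grad.toLp _
  have hL : CauchySeq L := by
    rw [cauchySeq_iff_tendsto_dist_atTop_0]
    refine hc.congr fun p => ?_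
    rw [((hV0 p.1).sub hΩ hΩb (hV0 p.2)).energyNorm_eq hΩ hΩb, dist_eq_norm, l2norm,
      ← MemLp.toLp_sub, Lp.norm_toLp]
  obtain ⟨G, hG⟩ := cauchySeq_tendsto_of_complete hL
  rw [Lp.tendsto_Lp_iff_tendsto_eLpNorm'] at hG
  have hG2 : Tendsto (fun n => eLpNorm (⇑G - weakGrad Ω (V n)) 2 (volume.restrict Ω)) atTop
      (𝓝 0) := by
    refine hG.congr fun n => ?_
    rw [eLpNorm_sub_comm]
    exact eLpNorm_congr_ae ((EventuallyEq.refl _ _).sub (hV0 n).memLp_grad.coeFn_toLp)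
  have hvG : IsH0 Ω v G := IsH0.of_tendsto hv (Lp.memLp G) hV0 hlim hG2
  refine ⟨hvG.memH10 hΩ hΩb, ?_⟩
  have h3 : Tendsto (fun n => l2norm Ω (⇑G - weakGrad Ω (V n))) atTop (𝓝 0) :=
    (ENNReal.tendsto_toReal ENNReal.zero_ne_top).comp hG2
  exact h3.congr fun n => ((hvG.sub hΩ hΩb (hV0 n)).energyNorm_eq hΩ hΩb).symm

theorem memLp_two_of_top (hΩb : Bornology.IsBounded Ω) {g : E d → ℝ}
    (hg : MemLp g ∞ (volume.restrict Ω)) : MemLp g 2 (volume.restrict Ω) := by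
  have : IsFiniteMeasure (volume.restrict Ω) := ⟨by simpa using hΩb.measure_lt_top⟩
  exact hg.mono_exponent le_top

theorem MemH10.integrableOn (hΩb : Bornology.IsBounded Ω) {v : E d → ℝ} (hv : MemH10 Ω v) :
    IntegrableOn v Ω := by
  have : IsFiniteMeasure (volume.restrict Ω) := ⟨by simpa using hΩb.measure_lt_top⟩
  exact hv.1.1.integrable (by norm_num)

theorem IsTest.isWeakSolution (hΩ : IsOpen Ω) (hΩb : Bornology.IsBounded Ω) {ψ : E d → ℝ}
    (hψ : IsTest Ω ψ) : IsWeakSolution Ω (fun y => -Laplacian.laplacian ψ y) ψ :=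
  ⟨hψ.memH10 hΩ hΩb, hψ.1.continuous.continuousOn, fun _ hv =>
    energy_eq_integral_laplacian hΩ hΩb hψ.1 (hψ.memH10 hΩ hΩb) hv⟩

/-- For bounded data, the weak solution has a continuous representative. -/
theorem exists_isWeakSolution (hd : 0 < d) (hΩ : IsOpen Ω) (hΩb : Bornology.IsBounded Ω)
    {g : E d → ℝ} (hg : MemLp g ∞ (volume.restrict Ω)) : ∃ w, IsWeakSolution Ω g w := by
  obtain ⟨w, G, hw, h⟩ := exists_isH0_weak hd hΩ hΩb (memLp_two_of_top hΩb hg)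
  have hw0 := hw.memH10 hΩ hΩb
  obtain ⟨w', hc, hae⟩ := exists_continuousOn_of_laplacian_eq hd hΩ (hw0.integrableOn hΩb) hg
    fun ψ hψ => by
      rw [← h ψ _ hψ.isH0]
      simp only [real_inner_comm (gradient ψ _)]
      rw [hw.integral_inner_gradient hΩ hΩb hψ.1, ← integral_neg]
      exact integral_congr_ae (Eventually.of_forall fun y => by ring)
  refine ⟨w', hw0.congr hΩ hΩb hae, hc, fun v hv => ?_⟩
  rw [← energy_congr_left hΩ hΩb hw0 hae hv, hw.energy_eq hΩ hΩb (hv.isH0 hΩ)]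
  exact h v _ (hv.isH0 hΩ)

end Existence

/-! ### The Sobolev inequality in dimension one -/

section OneDimKernel

variable {d : ℕ} {Ω : Set (E d)} {ε r : ℝ} {x y : E d}

theorem green_le_of_dim_one (hd1 : d = 1) (hε : 0 ≤ ε) (hr : ε ≤ r) (x y : E d) :
    green ε r x y ≤ profilePrim 0 * (r - ε) := by
  subst hd1
  have h := intervalIntegral.norm_integral_le_of_norm_le_const (a := ε) (b := r)
    (f := fun t => t ^ (1 - (1 : ℕ) : ℤ) * profilePrim (‖y - x‖ ^ 2 * t ^ (-2 : ℤ)))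
    (C := profilePrim 0) fun t ht => by
      rw [uIoc_of_le hr] at ht
      have ht0 : 0 < t := hε.trans_lt ht.1
      simp only [Nat.cast_one, sub_self, zpow_zero, one_mul]
      rw [Real.norm_of_nonneg (profilePrim_nonneg _)]
      exact antitone_profilePrim (by positivity)
  rw [abs_of_nonneg (sub_nonneg.2 hr)] at h
  exact (le_abs_self _).trans h

/-- In dimension one the truncations converge to the parametrix uniformly, the pole included. -/
theorem abs_green_zero_sub_le (hd1 : d = 1) (hε : 0 < ε) (hr : ε ≤ r) (x y : E d) :
    |green 0 r x y - green ε r x y| ≤ profilePrim 0 * ε := by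
  rcases eq_or_ne y x with rfl | h
  · subst hd1
    simp only [green, scaleIntegral, sub_self, norm_zero, Nat.cast_one, zpow_zero, one_mul, ne_eq,
      OfNat.ofNat_ne_zero, not_false_eq_true, zero_pow, zero_mul, intervalIntegral.integral_const,
      sub_zero, smul_eq_mul]
    rw [← sub_mul, sub_sub_cancel, mul_comm,
      abs_of_nonneg (mul_nonneg (profilePrim_nonneg _) hε.le)]
  · have hp : 0 < ‖y - x‖ := norm_pos_iff.2 (sub_ne_zero.2 h)
    have hδ : 0 < min ε ‖y - x‖ := lt_min hε hp
    rw [green_zero_eq hδ ((min_le_left _ _).trans hr) (min_le_right _ _),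
      ← green_add hδ (min_le_left _ _) hr, add_sub_cancel_right,
      abs_of_nonneg (green_nonneg hδ.le (min_le_left _ _) _ _)]
    refine (green_le_of_dim_one hd1 hδ.le (min_le_left _ _) x y).trans ?_
    exact mul_le_mul_of_nonneg_left (by linarith) (profilePrim_nonneg _)

theorem continuous_green_zero (hd1 : d = 1) (hr : 0 < r) (x : E d) : Continuous (green 0 r x) := by
  have hu : TendstoUniformly (fun ε => green ε r x) (green 0 r x) (𝓝[>] 0) := by
    rw [Metric.tendstoUniformly_iff]
    intro δ hδ
    have ht : Tendsto (fun ε : ℝ => profilePrim 0 * ε) (𝓝[>] 0) (𝓝 0) := by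
      have : Tendsto (fun ε : ℝ => profilePrim 0 * ε) (𝓝 0) (𝓝 (profilePrim 0 * 0)) :=
        (continuous_const.mul continuous_id).tendsto 0
      rw [mul_zero] at this
      exact this.mono_left nhdsWithin_le_nhds
    filter_upwards [Ioc_mem_nhdsGT hr, ht.eventually_lt_const hδ] with ε hε hlt y
    exact (abs_green_zero_sub_le hd1 hε.1 hε.2 x y).trans_lt hlt
  refine hu.continuous (Eventually.frequently ?_)
  filter_upwards [Ioc_mem_nhdsGT hr] with ε hε
  exact (contDiff_green hε.1 hε.2 x).continuous

/-- In dimension one the Dirichlet norm of `Φ_{ε,r}` is controlled by `r - ε`. -/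
theorem energyNorm_green_sq_le (hd1 : d = 1) (hΩ : IsOpen Ω) (hΩb : Bornology.IsBounded Ω)
    (hε : 0 < ε) (hr : ε ≤ r) (hx : Metric.closedBall x r ⊆ Ω) :
    energyNorm Ω (green ε r x) ^ 2 ≤ profilePrim 0 * (r - ε) * mass d := by
  have hT := isTest_green hε hr hx
  have hM := isTest_mollifier hε ((Metric.closedBall_subset_closedBall hr).trans hx)
  have h0 := hT.memH10 hΩ hΩb
  rw [energyNorm_sq, energy_eq_integral_laplacian hΩ hΩb hT.1 h0 h0, ← integral_mollifier hε x,
    ← hM.setIntegral_eq fun _ h => h, ← integral_const_mul]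
  have hLT := hT.laplacian
  refine integral_mono ?_ ((memLp_one_iff_integrable.1 (hM.memLp 1)).const_mul _) fun y => ?_
  · have := integrable_mul (hLT.memLp 2) (hT.memLp 2)
    simpa using this.neg
  · simp only
    rw [laplacian_green hε hr]
    have a1 := green_nonneg hε.le hr x y
    have a2 := green_le_of_dim_one hd1 hε.le hr x y
    have a3 := mollifier_nonneg hε.le x y
    have a4 := mollifier_nonneg (hε.le.trans hr) x y
    nlinarith [mul_nonneg a4 a1]

theorem l2norm_mollifier_le {t : ℝ} (ht : 0 ≤ t) (hΩb : Bornology.IsBounded Ω) (y : E d) :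
    l2norm Ω (mollifier t y) ≤
      (volume Ω ^ ((2 : ℝ≥0∞).toReal)⁻¹).toReal * (t ^ (-(d : ℤ)) * profile 0) := by
  have h := eLpNorm_le_of_ae_bound (p := 2) (μ := volume.restrict Ω) (f := mollifier t y)
    (C := t ^ (-(d : ℤ)) * profile 0) (Eventually.of_forall fun z => by
      rw [Real.norm_of_nonneg (mollifier_nonneg ht y z)]; exact mollifier_le ht y z)
  rw [Measure.restrict_apply_univ] at h
  have h2 := ENNReal.toReal_mono (ENNReal.mul_ne_top (ENNReal.rpow_ne_top_of_nonneg (by simp)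
    hΩb.measure_lt_top.ne) ENNReal.ofReal_ne_top) h
  rwa [ENNReal.toReal_mul, ENNReal.toReal_ofReal (mul_nonneg (zpow_nonneg ht _)
    (profile_nonneg _))] at h2

/-- The one-dimensional Sobolev inequality `‖v‖_∞ ≤ C ‖∇v‖`, by testing with the mollified
fundamental solution centred at the point of evaluation. -/
theorem exists_sobolev_of_dim_one (hd1 : d = 1) (hΩ : IsOpen Ω) (hΩb : Bornology.IsBounded Ω) :
    ∃ C, 0 < C ∧ ∀ v : E d → ℝ, MemH10 Ω v → ContinuousOn v Ω → ∀ y ∈ Ω,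
      |v y| ≤ C * energyNorm Ω v := by
  obtain ⟨K, hK0, hK⟩ := exists_poincare_energyNorm (hd1 ▸ one_pos) hΩ hΩb
  have hm := mass_pos d
  set A : ℝ := (volume Ω ^ ((2 : ℝ≥0∞).toReal)⁻¹).toReal * ((1 : ℝ) ^ (-(d : ℤ)) * profile 0)
  have hA0 : 0 ≤ A := mul_nonneg ENNReal.toReal_nonneg
    (mul_nonneg (zpow_nonneg zero_le_one _) (profile_nonneg _))
  set S : ℝ := √(profilePrim 0 * mass d)
  have hS : 0 < S := Real.sqrt_pos.2 (mul_pos (profilePrim_pos one_pos) hm)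
  refine ⟨(S + K * A) / mass d, by positivity, fun v hv hvc y hy => ?_⟩
  have hlim := (tendsto_integral_mollifier hΩ hvc hy).abs
  have hbound : ∀ᶠ ε in 𝓝[>] (0 : ℝ), |∫ z in Ω, mollifier ε y z * v z| ≤
      (S + K * A) * energyNorm Ω v := by
    filter_upwards [Ioc_mem_nhdsGT (zero_lt_one' ℝ)] with ε hε
    -- `Φ_{ε,1}` may leave `Ω`, so that its energy is estimated on a larger domain
    let Ω' := Ω ∪ Metric.ball y 2
    have hΩ' : IsOpen Ω' := hΩ.union Metric.isOpen_ball
    have hΩb' : Bornology.IsBounded Ω' := hΩb.union Metric.isBounded_ball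
    have hsub : Metric.closedBall y 1 ⊆ Ω' :=
      (Metric.closedBall_subset_ball (by norm_num)).trans subset_union_right
    have hT : IsTest Ω' (green ε 1 y) := isTest_green hε.1 hε.2 hsub
    have hsm := contDiff_green hε.1 hε.2 y
    have hgr : l2norm Ω (gradient (green ε 1 y)) ≤ S := by
      have h1 : l2norm Ω (gradient (green ε 1 y)) ≤ l2norm Ω' (gradient (green ε 1 y)) :=
        ENNReal.toReal_mono (hT.memLp_gradient 2).2.ne
          (eLpNorm_mono_measure _ (Measure.restrict_mono subset_union_left le_rfl))
      rw [← hT.isH0.energyNorm_eq hΩ' hΩb'] at h1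
      refine h1.trans (Real.le_sqrt_of_sq_le ?_)
      refine (energyNorm_green_sq_le hd1 hΩ' hΩb' hε.1 hε.2 hsub).trans ?_
      have := profilePrim_nonneg 0
      have := hε.1
      gcongr
      nlinarith
    have hG := (hv.isH0 hΩ).integral_inner_gradient hΩ hΩb hsm
    simp_rw [laplacian_green hε.1 hε.2] at hG
    have mM : ∀ t : ℝ, MemLp (mollifier t y) 2 (volume.restrict Ω) := fun t =>
      memLp_of_continuous hΩ hΩb (contDiff_mollifier t y).continuous 2
    -- `∫ v η_ε = ∫ ∇Φ_{ε,1} · ∇v + ∫ v η_1`, by Green's formula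
    have e : ∫ z in Ω, mollifier ε y z * v z =
        (∫ z in Ω, inner ℝ (gradient (green ε 1 y) z) (weakGrad Ω v z)) +
          ∫ z in Ω, v z * mollifier 1 y z := by
      rw [hG]
      simp_rw [mul_sub]
      rw [integral_sub (integrable_mul hv.1.1 (mM 1)) (integrable_mul hv.1.1 (mM ε))]
      simp_rw [mul_comm (v _)]
      ring
    rw [e]
    refine (abs_add_le _ _).trans ?_
    have b1 := abs_integral_inner_le (memLp_of_continuous hΩ hΩb (continuous_gradient hsm) 2)
      (hv.isH0 hΩ).memLp_grad
    have b2 := abs_integral_mul_le hv.1.1 (mM 1)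
    have b3 := hK v hv
    have b4 : l2norm Ω (mollifier 1 y) ≤ A := l2norm_mollifier_le zero_le_one hΩb y
    have b5 : l2norm Ω (weakGrad Ω v) = energyNorm Ω v := (energyNorm_eq_l2norm hΩ hv).symm
    have b6 := energyNorm_nonneg (Ω := Ω) v
    change _ ≤ l2norm Ω (gradient (green ε 1 y)) * l2norm Ω (weakGrad Ω v) at b1
    change _ ≤ l2norm Ω v * l2norm Ω (mollifier 1 y) at b2
    rw [b5] at b1
    have c1 : l2norm Ω (gradient (green ε 1 y)) * energyNorm Ω v ≤ S * energyNorm Ω v := by gcongr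
    have c2 : l2norm Ω v * l2norm Ω (mollifier 1 y) ≤ (K * energyNorm Ω v) * A :=
      mul_le_mul b3 b4 ENNReal.toReal_nonneg (by positivity)
    linarith
  have hfin := le_of_tendsto hlim hbound
  rw [abs_mul, abs_of_pos hm] at hfin
  rw [div_mul_eq_mul_div, le_div_iff₀ hm, mul_comm]
  exact hfin

end OneDimKernel

/-! ### Green functions -/

/-- `𝒢` is the Green function of `Ω` with pole `z`: it is integrable and represents the solution
operator of `-Δ w = g` at `z`, for bounded `g`. The other fields record its behaviour at the
boundary, its regularity off the pole, its singularity in dimension two, and that in dimension one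
it is itself the weak solution with source `δ_z`. -/
structure IsGreenFunction {d : ℕ} (Ω : Set (E d)) (z : E d) (𝒢 : E d → ℝ) : Prop where
  integrableOn : IntegrableOn 𝒢 Ω
  integral_mul : ∀ g w : E d → ℝ, MemLp g ∞ (volume.restrict Ω) → IsWeakSolution Ω g w →
    Integrable (fun y => 𝒢 y * g y) (volume.restrict Ω) ∧ ∫ y in Ω, 𝒢 y * g y = w z
  memH10_mul : ∀ χ, IsTest Ω χ → (∀ᶠ y in 𝓝 z, χ y = 1) → MemH10 Ω (fun y => (1 - χ y) * 𝒢 y)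
  continuousAt : ∀ y ∈ Ω, y ≠ z → ContinuousAt 𝒢 y
  tendsto_atTop : d = 2 → Tendsto 𝒢 (𝓝[≠] z) atTop
  continuousOn : d = 1 → ContinuousOn 𝒢 Ω
  memH10 : d = 1 → MemH10 Ω 𝒢
  energy_eq : d = 1 → ∀ v, MemH10 Ω v → ContinuousOn v Ω → energy Ω 𝒢 v = v z

section GreenFunction

variable {d : ℕ} {Ω : Set (E d)} {r : ℝ} {z y : E d}

/-- The logarithmic singularity of the parametrix in dimension two: at distance `ρ` of the pole, the
scales `t ≥ 2 ρ` alone contribute at least a multiple of `∫_{2ρ}^r dt / t`. -/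
theorem tendsto_green_atTop (hd2 : d = 2) (hr : 0 < r) (z : E d) :
    Tendsto (green 0 r z) (𝓝[≠] z) atTop := by
  have hp : 0 < profilePrim (1 / 4) := profilePrim_pos (by norm_num)
  have hn : Tendsto (fun y : E d => ‖y - z‖) (𝓝[≠] z) (𝓝[>] 0) := by
    refine tendsto_nhdsWithin_iff.2 ⟨?_, ?_⟩
    · have : Continuous fun y : E d => ‖y - z‖ := by fun_prop
      have h := this.tendsto z
      simp only [sub_self, norm_zero] at h
      exact h.mono_left nhdsWithin_le_nhds
    · filter_upwards [self_mem_nhdsWithin] with y hy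
      exact norm_pos_iff.2 (sub_ne_zero.2 hy)
  have hlog : Tendsto (fun ρ : ℝ => profilePrim (1 / 4) * (Real.log r - Real.log (2 * ρ)))
      (𝓝[>] 0) atTop := by
    refine Tendsto.const_mul_atTop hp (tendsto_atTop_add_const_left _ _ ?_)
    refine tendsto_neg_atBot_atTop.comp (Real.tendsto_log_nhdsGT_zero.comp ?_)
    refine tendsto_nhdsWithin_iff.2 ⟨?_, ?_⟩
    · have : Tendsto (fun ρ : ℝ => 2 * ρ) (𝓝 0) (𝓝 (2 * 0)) :=
        (continuous_const.mul continuous_id).tendsto 0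
      rw [mul_zero] at this
      exact this.mono_left nhdsWithin_le_nhds
    · filter_upwards [self_mem_nhdsWithin] with ρ hρ
      exact mul_pos two_pos (mem_Ioi.1 hρ)
  refine tendsto_atTop_mono' _ ?_ (hlog.comp hn)
  have hev : ∀ᶠ ρ in 𝓝[>] (0 : ℝ), ρ ∈ Ioo 0 (r / 2) := Ioo_mem_nhdsGT (by positivity)
  filter_upwards [hn.eventually hev, self_mem_nhdsWithin] with y hy hne
  set ρ := ‖y - z‖ with hρ
  have hρ0 : 0 < ρ := hy.1
  have h2r : 2 * ρ ≤ r := by linarith [hy.2]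
  refine le_trans ?_ (green_le_green_zero (by positivity : 0 < 2 * ρ) h2r hne)
  have e : ∫ t in (2 * ρ)..r, profilePrim (1 / 4) * t⁻¹ =
      profilePrim (1 / 4) * (Real.log r - Real.log (2 * ρ)) := by
    rw [intervalIntegral.integral_const_mul, integral_inv_of_pos (by positivity) hr,
      Real.log_div hr.ne' (by positivity)]
  simp only [Function.comp]
  rw [← e, green, scaleIntegral]
  refine intervalIntegral.integral_mono_on h2r ?_ (intervalIntegrable_scale
    contDiff_profilePrim.continuous _ (by positivity) h2r _) fun t ht => ?_
  · refine ContinuousOn.intervalIntegrable fun t ht => ?_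
    rw [uIcc_of_le h2r] at ht
    have : t ≠ 0 := (lt_of_lt_of_le (by positivity : 0 < 2 * ρ) ht.1).ne'
    exact (continuousAt_const.mul (continuousAt_inv₀ this)).continuousWithinAt
  · have ht0 : 0 < t := lt_of_lt_of_le (by positivity : 0 < 2 * ρ) ht.1
    subst hd2
    have hz : t ^ (1 - (2 : ℕ) : ℤ) = t⁻¹ := by
      rw [show (1 - (2 : ℕ) : ℤ) = -1 by norm_num, zpow_neg_one]
    rw [hz, mul_comm]
    refine mul_le_mul_of_nonneg_left (antitone_profilePrim ?_) (inv_nonneg.2 ht0.le)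
    have h4 : (2 * ρ) ^ 2 ≤ t ^ 2 := by gcongr; exact ht.1
    rw [zpow_neg, ← div_eq_mul_inv, zpow_ofNat, div_le_div_iff₀ (by positivity) (by norm_num)]
    linarith

theorem continuousAt_green (hr : 0 < r) (h : y ≠ z) : ContinuousAt (green 0 r z) y := by
  have hp : 0 < ‖y - z‖ := norm_pos_iff.2 (sub_ne_zero.2 h)
  have hδ : 0 < min r (‖y - z‖ / 2) := lt_min hr (by positivity)
  refine (contDiff_green hδ (min_le_left _ _) z).continuous.continuousAt.congr ?_
  have : ∀ᶠ y' in 𝓝 y, ‖y - z‖ / 2 < ‖y' - z‖ := by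
    have hc : Continuous fun y' : E d => ‖y' - z‖ := by fun_prop
    exact hc.continuousAt.eventually_const_lt (by linarith)
  filter_upwards [this] with y' hy'
  exact (green_zero_eq hδ (min_le_left _ _) ((min_le_right _ _).trans hy'.le)).symm

/-- Off the pole the parametrix coincides with a smooth truncation. -/
theorem isTest_one_sub_mul_green (hr : 0 < r) (hball : Metric.closedBall z r ⊆ Ω) {χ : E d → ℝ}
    (hχ : IsTest Ω χ) (h1 : ∀ᶠ y in 𝓝 z, χ y = 1) :
    IsTest Ω (fun y => (1 - χ y) * green 0 r z y) := by
  obtain ⟨δ, hδ, hδ1⟩ := Metric.eventually_nhds_iff.1 h1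
  have hε : 0 < min r δ := lt_min hr hδ
  have := (isTest_green hε (min_le_left _ _) hball).mul_left
    (θ := fun y => 1 - χ y) (contDiff_const.sub hχ.1)
  convert this using 1
  ext y
  simp only [Pi.mul_apply]
  rcases le_or_gt (min r δ) ‖y - z‖ with h | h
  · rw [green_zero_eq hε (min_le_left _ _) h]
  · rw [hδ1 (y := y) (by rw [dist_eq_norm]; exact h.trans_le (min_le_right _ _))]
    simp

/-- The truncations form a Cauchy sequence for the Dirichlet norm in dimension one, so that the
parametrix lies in `H¹₀(Ω)`. -/
theorem memH10_green_zero (hd1 : d = 1) (hΩ : IsOpen Ω) (hΩb : Bornology.IsBounded Ω)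
    (hr : 0 < r) (hball : Metric.closedBall z r ⊆ Ω) :
    MemH10 Ω (green 0 r z) ∧ ∀ v, MemH10 Ω v → ContinuousOn v Ω →
      energy Ω (green 0 r z) v = mass d * v z - ∫ y in Ω, mollifier r z y * v y := by
  let e : ℕ → ℝ := fun n => r / (n + 1)
  have he0 : ∀ n, 0 < e n := fun n => by positivity
  have her : ∀ n, e n ≤ r := fun n => div_le_self hr.le (by simp)
  have het0 : Tendsto e atTop (𝓝 0) := tendsto_const_nhds.div_atTop
    (tendsto_atTop_add_const_right _ _ tendsto_natCast_atTop_atTop)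
  have het : Tendsto e atTop (𝓝[>] 0) :=
    tendsto_nhdsWithin_iff.2 ⟨het0, Eventually.of_forall he0⟩
  have hV : ∀ n, IsTest Ω (green (e n) r z) := fun n => isTest_green (he0 n) (her n) hball
  have hV10 := fun n => (hV n).memH10 hΩ hΩb
  have hv : MemLp (green 0 r z) 2 (volume.restrict Ω) :=
    memLp_of_continuous hΩ hΩb (continuous_green_zero hd1 hr z) 2
  have hlim : Tendsto (fun n => eLpNorm (green 0 r z - green (e n) r z) 2 (volume.restrict Ω))
      atTop (𝓝 0) := by
    have hK : Tendsto (fun n => volume Ω ^ ((2 : ℝ≥0∞).toReal)⁻¹ *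
        ENNReal.ofReal (profilePrim 0 * e n)) atTop (𝓝 0) := by
      have h1 : Tendsto (fun n => ENNReal.ofReal (profilePrim 0 * e n)) atTop (𝓝 0) := by
        have := ENNReal.tendsto_ofReal (het0.const_mul (profilePrim 0))
        simpa using this
      have := ENNReal.Tendsto.const_mul h1 (a := volume Ω ^ ((2 : ℝ≥0∞).toReal)⁻¹)
        (Or.inr (ENNReal.rpow_ne_top_of_nonneg (by simp) hΩb.measure_lt_top.ne))
      simpa using this
    refine tendsto_of_tendsto_of_tendsto_of_le_of_le tendsto_const_nhds hK (fun _ => zero_le)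
      fun n => ?_
    have := eLpNorm_le_of_ae_bound (p := 2) (μ := volume.restrict Ω)
      (f := green 0 r z - green (e n) r z) (C := profilePrim 0 * e n)
      (Eventually.of_forall fun y => abs_green_zero_sub_le hd1 (he0 n) (her n) z y)
    rwa [Measure.restrict_apply_univ] at this
  -- differences of truncations are truncations between smaller radii
  have hdiff : ∀ m n, e n ≤ e m → energyNorm Ω (green (e n) r z - green (e m) r z) ^ 2 ≤
      profilePrim 0 * (e m) * mass d := fun m n h => by
    have e1 : green (e n) r z - green (e m) r z = green (e n) (e m) z := by
      ext y
      rw [Pi.sub_apply, ← green_add (he0 n) h (her m), add_sub_cancel_right]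
    rw [e1]
    refine (energyNorm_green_sq_le hd1 hΩ hΩb (he0 n) h
      ((Metric.closedBall_subset_closedBall (her m)).trans hball)).trans ?_
    have := profilePrim_nonneg 0
    have := mass_pos d
    have := he0 n
    gcongr
    linarith
  have hc : Tendsto (fun p : ℕ × ℕ => energyNorm Ω (green (e p.1) r z - green (e p.2) r z)) atTop
      (𝓝 0) := by
    have hS : Tendsto (fun p : ℕ × ℕ => √(profilePrim 0 * (e p.1 + e p.2) * mass d)) atTop
        (𝓝 0) := by
      rw [← prod_atTop_atTop_eq]
      have h := (((het0.comp tendsto_fst).add (het0.comp tendsto_snd) :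
        Tendsto (fun p : ℕ × ℕ => e p.1 + e p.2) (atTop ×ˢ atTop) _).const_mul
        (profilePrim 0)).mul_const (mass d)
      have h2 := h.sqrt
      simpa using h2
    refine squeeze_zero (fun _ => energyNorm_nonneg _) (fun p => ?_) hS
    refine Real.le_sqrt_of_sq_le ?_
    have q0 := profilePrim_nonneg 0
    have q1 := mass_pos d
    have q2 := he0 p.1
    have q3 := he0 p.2
    rcases le_total (e p.1) (e p.2) with h | h
    · refine (hdiff p.2 p.1 h).trans ?_
      gcongr
      linarith
    · rw [energyNorm_sub_comm hΩ hΩb (hV10 _) (hV10 _)]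
      refine (hdiff p.1 p.2 h).trans ?_
      gcongr
      linarith
  obtain ⟨hm, ht⟩ := memH10_of_cauchy hΩ hΩb hV10 hv hlim hc
  refine ⟨hm, fun v hv hvc => ?_⟩
  have hen : Tendsto (fun n => energy Ω (green (e n) r z) v) atTop
      (𝓝 (energy Ω (green 0 r z) v)) := by
    rw [tendsto_iff_dist_tendsto_zero]
    refine squeeze_zero (fun _ => dist_nonneg) (fun n => ?_)
      (by simpa using ht.mul_const (energyNorm Ω v))
    rw [dist_comm, Real.dist_eq, ← energy_sub_left hΩ hΩb hm (hV10 n) hv]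
    exact abs_energy_le hΩ (hm.sub hΩ hΩb (hV10 n)) hv
  refine tendsto_nhds_unique hen ?_
  have h2 := ((tendsto_integral_mollifier hΩ hvc (hball (Metric.mem_closedBall_self hr.le))).comp
    het).sub_const (∫ y in Ω, mollifier r z y * v y)
  refine h2.congr fun n => ?_
  have mM : ∀ t : ℝ, MemLp (mollifier t z) 2 (volume.restrict Ω) := fun t =>
    memLp_of_continuous hΩ hΩb (contDiff_mollifier t z).continuous 2
  rw [energy_eq_integral_laplacian hΩ hΩb (hV n).1 (hV10 n) hv, Function.comp,
    ← integral_sub (integrable_mul (mM _) hv.1.1) (integrable_mul (mM _) hv.1.1)]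
  refine integral_congr_ae (Eventually.of_forall fun y => ?_)
  simp only
  rw [laplacian_green (he0 n) (her n)]
  ring

/-- The Green function exists: parametrix plus a weak solution with smooth data. -/
theorem exists_isGreenFunction (hd : 0 < d) (hΩ : IsOpen Ω) (hΩb : Bornology.IsBounded Ω)
    (hz : z ∈ Ω) : ∃ 𝒢, IsGreenFunction Ω z 𝒢 := by
  obtain ⟨r, hr, hball⟩ := Metric.nhds_basis_closedBall.mem_iff.1 (hΩ.mem_nhds hz)
  have hM := isTest_mollifier hr hball
  obtain ⟨v, hv⟩ := exists_isWeakSolution hd hΩ hΩb (hM.memLp ∞)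
  have hm := mass_pos d
  have hvc : ∀ {y}, y ∈ Ω → ContinuousAt v y := fun hy => hv.2.1.continuousAt (hΩ.mem_nhds hy)
  have hgi : IntegrableOn (green 0 r z) Ω := (integrable_green_zero hd hr z).integrableOn
  have hvi : IntegrableOn v Ω := hv.1.integrableOn hΩb
  -- `-Δ v = η_r` cancels the remainder of the parametrix `Φ_{0,r}`
  refine ⟨(mass d)⁻¹ • (green 0 r z + v), ?_, ?_, ?_, ?_, ?_, ?_, ?_, ?_⟩
  · exact (hgi.add hvi).smul (mass d)⁻¹
  · intro g w hg hw
    obtain ⟨C, hC0, hC⟩ := exists_ae_bound hg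
    have i1 : Integrable (fun y => g y * green 0 r z y) (volume.restrict Ω) :=
      hgi.bdd_mul (c := C) hg.1 hC
    have i2 : Integrable (fun y => g y * v y) (volume.restrict Ω) :=
      Integrable.bdd_mul (c := C) hvi hg.1 hC
    have e0 : ∀ y, ((mass d)⁻¹ • (green 0 r z + v)) y * g y =
        (mass d)⁻¹ * (g y * green 0 r z y + g y * v y) := fun y => by
      simp only [Pi.smul_apply, Pi.add_apply, smul_eq_mul]; ring
    simp_rw [e0]
    refine ⟨(i1.add i2).const_mul _, ?_⟩
    rw [integral_const_mul, integral_add i1 i2]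
    -- symmetry of the Dirichlet form: `∫ g v = a(w, v) = ∫ η_r w`
    have e1 : ∫ y in Ω, g y * v y = ∫ y in Ω, mollifier r z y * w y := by
      rw [← hw.2.2 v hv.1, energy_comm, hv.2.2 w hw.1]
    have t1 := tendsto_integral_mul_green hd hr hg z
    have t2 := (tendsto_integral_mollifier hΩ hw.2.1 hz).sub_const
      (∫ y in Ω, mollifier r z y * w y)
    have mM : ∀ t : ℝ, MemLp (mollifier t z) 2 (volume.restrict Ω) := fun t =>
      memLp_of_continuous hΩ hΩb (contDiff_mollifier t z).continuous 2
    -- `∫ g Φ_{ε,r} = a(w, Φ_{ε,r}) = ∫ (η_ε - η_r) w`, and then `ε → 0`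
    have e2 : ∫ y in Ω, g y * green 0 r z y =
        mass d * w z - ∫ y in Ω, mollifier r z y * w y := by
      refine tendsto_nhds_unique t1 (t2.congr' ?_)
      filter_upwards [Ioc_mem_nhdsGT hr] with ε hε
      have hT := isTest_green hε.1 hε.2 hball
      rw [← hw.2.2 _ (hT.memH10 hΩ hΩb), energy_comm, energy_eq_integral_laplacian hΩ hΩb hT.1
        (hT.memH10 hΩ hΩb) hw.1,
        ← integral_sub (integrable_mul (mM _) hw.1.1.1) (integrable_mul (mM _) hw.1.1.1)]
      refine integral_congr_ae (Eventually.of_forall fun y => ?_)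
      simp only
      rw [laplacian_green hε.1 hε.2]
      ring
    rw [e1, e2, sub_add_cancel, inv_mul_cancel_left₀ hm.ne']
  · intro χ hχ h1
    have a1 := (isTest_one_sub_mul_green hr hball hχ h1).memH10 hΩ hΩb
    have a2 := ((hv.1.isH0 hΩ).mul_left hΩ hΩb (θ := fun y => 1 - χ y)
      (contDiff_const.sub hχ.1)).memH10 hΩ hΩb
    have a3 := (a1.add hΩ hΩb a2).const_smul hΩ hΩb (mass d)⁻¹
    convert a3 using 1
    ext y
    simp only [Pi.smul_apply, Pi.add_apply, Pi.mul_apply, smul_eq_mul]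
    ring
  · exact fun y hy hne => ((continuousAt_green hr hne).add (hvc hy)).const_smul _
  · intro hd2
    refine Tendsto.const_mul_atTop (inv_pos.2 hm) ?_
    exact (tendsto_green_atTop hd2 hr z).atTop_add ((hvc hz).tendsto.mono_left nhdsWithin_le_nhds)
  · exact fun hd1 => ((continuous_green_zero hd1 hr z).continuousOn.add hv.2.1).const_smul _
  · exact fun hd1 => ((memH10_green_zero hd1 hΩ hΩb hr hball).1.add hΩ hΩb hv.1).const_smul hΩ hΩb _
  · intro hd1 w hw hwc
    obtain ⟨b1, b2⟩ := memH10_green_zero hd1 hΩ hΩb hr hball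
    rw [energy_smul_left hΩ hΩb _ (b1.add hΩ hΩb hv.1) hw, energy_add_left hΩ hΩb b1 hv.1 hw,
      b2 w hw hwc, hv.2.2 w hw, sub_add_cancel, inv_mul_cancel_left₀ hm.ne']

end GreenFunction

/-! ### Dirac sources -/

section DiracSource

variable {d n : ℕ} {Ω : Set (E d)} {x : Fin n → E d} {f : E d → ℝ} {𝒢 : E d → E d → ℝ}

/-- The superposition `(1/n) ∑ᵢ f(xᵢ) 𝒢(xᵢ, ·)` of functions attached to the sample points. -/
noncomputable def sampleCombination (x : Fin n → E d) (f : E d → ℝ) (𝒢 : E d → E d → ℝ)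
    (y : E d) : ℝ :=
  (1 / (n : ℝ)) * ∑ i, f (x i) * 𝒢 (x i) y

theorem sampleCombination_eq_sum (x : Fin n → E d) (f : E d → ℝ) (𝒢 : E d → E d → ℝ) :
    sampleCombination x f 𝒢 = ∑ i, ((1 / (n : ℝ)) * f (x i)) • 𝒢 (x i) := by
  ext y
  simp [sampleCombination, Finset.mul_sum, mul_assoc]

/-- The superposition of the Green functions solves the Dirichlet problem by transposition. -/
theorem isDeltaSolution_sampleCombination (hx : ∀ i, x i ∈ Ω)
    (h𝒢 : ∀ z ∈ Ω, IsGreenFunction Ω z (𝒢 z)) :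
    IsDeltaSolution Ω x f (sampleCombination x f 𝒢) := by
  refine ⟨?_, fun g w hg hw => ?_⟩
  · exact (integrable_finsetSum _ fun i _ =>
      (h𝒢 _ (hx i)).integrableOn.const_mul (f (x i))).const_mul _
  · have e : ∀ y, sampleCombination x f 𝒢 y * g y =
        (1 / (n : ℝ)) * ∑ i, f (x i) * (𝒢 (x i) y * g y) := fun y => by
      rw [sampleCombination, mul_assoc, Finset.sum_mul]
      simp only [mul_assoc]
    simp_rw [e]
    rw [integral_const_mul, integral_finsetSum _ fun i _ =>
      ((h𝒢 _ (hx i)).integral_mul g w hg hw).1.const_mul _, sampleSum]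
    congr 1
    refine Finset.sum_congr rfl fun i _ => ?_
    rw [integral_const_mul, ((h𝒢 _ (hx i)).integral_mul g w hg hw).2]

/-- Solutions by transposition are unique, since every test function is an admissible datum. -/
theorem IsDeltaSolution.ae_eq (hd : 0 < d) (hΩ : IsOpen Ω) (hΩb : Bornology.IsBounded Ω)
    {u u' : E d → ℝ} (hu : IsDeltaSolution Ω x f u) (hu' : IsDeltaSolution Ω x f u') :
    u' =ᵐ[volume.restrict Ω] u := by
  have hi : IntegrableOn (u' - u) Ω := hu'.1.sub hu.1
  have := IsOpen.ae_eq_zero_of_integral_contDiff_smul_eq_zero hΩ (hi.locallyIntegrableOn)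
    (μ := volume) fun ψ h1 h2 h3 => by
      have hψ : IsTest Ω ψ := ⟨h1, h2, h3⟩
      obtain ⟨w, hw⟩ := exists_isWeakSolution hd hΩ hΩb (hψ.memLp ∞)
      have a1 := hu.2 ψ w (hψ.memLp ∞) hw
      have a2 := hu'.2 ψ w (hψ.memLp ∞) hw
      rw [← hψ.setIntegral_eq (fun y hy => by simp [hy])]
      have i1 := hψ.integrable_smul hu.1.locallyIntegrableOn
      have i2 := hψ.integrable_smul hu'.1.locallyIntegrableOn
      simp only [Pi.sub_apply, smul_sub]
      rw [integral_sub i2 i1]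
      simp only [smul_eq_mul, mul_comm (ψ _)]
      rw [a1, a2, sub_self]
  refine (ae_restrict_iff' hΩ.measurableSet).2 ?_
  filter_upwards [this] with y hy hyΩ
  exact sub_eq_zero.1 (hy hyΩ)

theorem IsDeltaSolution.integral_laplacian (hΩ : IsOpen Ω) (hΩb : Bornology.IsBounded Ω)
    {u : E d → ℝ} (hu : IsDeltaSolution Ω x f u) {ψ : E d → ℝ} (hψ : IsTest Ω ψ) :
    ∫ y in Ω, u y * (-(Laplacian.laplacian ψ y)) = sampleSum x f ψ :=
  hu.2 _ ψ (hψ.laplacian.memLp ∞).neg (hψ.isWeakSolution hΩ hΩb)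

theorem memH10_one_sub_mul_sampleCombination (hΩ : IsOpen Ω) (hΩb : Bornology.IsBounded Ω)
    (hx : ∀ i, x i ∈ Ω) (h𝒢 : ∀ z ∈ Ω, IsGreenFunction Ω z (𝒢 z)) {χ : E d → ℝ}
    (hχ : IsTest Ω χ) (h1 : ∀ i, ∀ᶠ y in 𝓝 (x i), χ y = 1) :
    MemH10 Ω (fun y => (1 - χ y) * sampleCombination x f 𝒢 y) := by
  have := MemH10.sum hΩ hΩb Finset.univ (φ := fun i y => (1 - χ y) * 𝒢 (x i) y)
    (fun i => (h𝒢 _ (hx i)).memH10_mul χ hχ (h1 i)) (fun i => (1 / (n : ℝ)) * f (x i))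
  convert this using 1
  ext y
  simp only [sampleCombination, Finset.sum_apply, Pi.smul_apply, smul_eq_mul, Finset.mul_sum]
  exact Finset.sum_congr rfl fun i _ => by ring

theorem continuousOn_sampleCombination (hx : ∀ i, x i ∈ Ω)
    (h𝒢 : ∀ z ∈ Ω, IsGreenFunction Ω z (𝒢 z)) :
    ContinuousOn (sampleCombination x f 𝒢) (Ω \ range x) := by
  intro y hy
  rw [sampleCombination_eq_sum]
  refine ContinuousAt.continuousWithinAt ?_
  have : ContinuousAt (fun y => ∑ i, ((1 / (n : ℝ)) * f (x i)) • 𝒢 (x i) y) y :=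
    tendsto_finsetSum _ fun i _ => ((h𝒢 _ (hx i)).continuousAt y hy.1
      fun h => hy.2 ⟨i, h.symm⟩).tendsto.const_smul _
  convert this using 1
  ext y
  simp

/-- In dimension two the logarithmic singularities at a sample point add up with the same sign,
even when sample points coincide. -/
theorem tendsto_abs_sampleCombination (hd2 : d = 2) (hn : 0 < n) (hx : ∀ i, x i ∈ Ω)
    (h𝒢 : ∀ z ∈ Ω, IsGreenFunction Ω z (𝒢 z)) (i : Fin n) (hi : f (x i) ≠ 0) :
    Tendsto (fun y => |sampleCombination x f 𝒢 y|) (𝓝[≠] (x i)) atTop := by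
  classical
  let s : Finset (Fin n) := Finset.univ.filter fun j => x j = x i
  let c : ℝ := (1 / (n : ℝ)) * (s.card * f (x i))
  let h : E d → ℝ := fun y => ∑ j ∈ Finset.univ.filter (fun j => ¬ x j = x i),
    ((1 / (n : ℝ)) * f (x j)) * 𝒢 (x j) y
  have hs : 0 < s.card := Finset.card_pos.2 ⟨i, by simp [s]⟩
  have hc : c ≠ 0 := by
    have : (n : ℝ) ≠ 0 := by exact_mod_cast hn.ne'
    have : (s.card : ℝ) ≠ 0 := by exact_mod_cast hs.ne'
    simp only [c]
    positivity
  have e : ∀ y, sampleCombination x f 𝒢 y = c * 𝒢 (x i) y + h y := fun y => by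
    rw [sampleCombination, Finset.mul_sum, ← Finset.sum_filter_add_sum_filter_not _
      (fun j => x j = x i)]
    congr 1
    · rw [Finset.sum_congr rfl (g := fun _ => (1 / (n : ℝ)) * (f (x i) * 𝒢 (x i) y))
        (fun j hj => by rw [(Finset.mem_filter.1 hj).2])]
      rw [Finset.sum_const, nsmul_eq_mul]
      simp only [c, s]
      ring
    · exact Finset.sum_congr rfl fun j _ => by ring
  have hh : Tendsto h (𝓝[≠] (x i)) (𝓝 (h (x i))) := by
    refine Tendsto.mono_left (tendsto_finsetSum _ fun j hj => ?_) nhdsWithin_le_nhds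
    exact ((h𝒢 _ (hx j)).continuousAt (x i) (hx i)
      (Ne.symm (Finset.mem_filter.1 hj).2)).tendsto.const_mul _
  have hG := (h𝒢 _ (hx i)).tendsto_atTop hd2
  simp_rw [e]
  rcases lt_or_gt_of_ne hc with h0 | h0
  · exact tendsto_abs_atBot_atTop.comp ((hG.const_mul_atTop_of_neg h0).atBot_add hh)
  · exact tendsto_abs_atTop_atTop.comp ((hG.const_mul_atTop h0).atTop_add hh)

theorem energy_sampleCombination (hd1 : d = 1) (hΩ : IsOpen Ω) (hΩb : Bornology.IsBounded Ω)
    (hx : ∀ i, x i ∈ Ω) (h𝒢 : ∀ z ∈ Ω, IsGreenFunction Ω z (𝒢 z)) :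
    MemH10 Ω (sampleCombination x f 𝒢) ∧ ∀ v, MemH10 Ω v → ContinuousOn v Ω →
      energy Ω (sampleCombination x f 𝒢) v = sampleSum x f v := by
  have hm := fun i => (h𝒢 _ (hx i)).memH10 hd1
  rw [sampleCombination_eq_sum]
  refine ⟨MemH10.sum hΩ hΩb _ hm _, fun v hv hvc => ?_⟩
  rw [energy_sum_left hΩ hΩb _ hm _ hv, sampleSum, Finset.mul_sum]
  refine Finset.sum_congr rfl fun i _ => ?_
  rw [(h𝒢 _ (hx i)).energy_eq hd1 v hv hvc, mul_assoc]

theorem continuousOn_sampleCombination_of_dim_one (hd1 : d = 1) (hx : ∀ i, x i ∈ Ω)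
    (h𝒢 : ∀ z ∈ Ω, IsGreenFunction Ω z (𝒢 z)) : ContinuousOn (sampleCombination x f 𝒢) Ω :=
  (continuousOn_finsetSum _ fun i _ => ((h𝒢 _ (hx i)).continuousOn hd1).const_smul (f (x i))
    ).const_smul (1 / (n : ℝ))

end DiracSource

/-! ### Galerkin systems -/

section Galerkin

variable {d : ℕ} {Ω : Set (E d)} {ι : Type} {φ : ι → E d → ℝ}

theorem IsTrialBasis.of_mem_span (hΩ : IsOpen Ω) (hΩb : Bornology.IsBounded Ω)
    (hφ : IsTrialBasis Ω φ) {v : E d → ℝ} (hv : v ∈ Submodule.span ℝ (range φ)) :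
    MemH10 Ω v ∧ ContinuousOn v Ω := by
  induction hv using Submodule.span_induction with
  | mem v h =>
    obtain ⟨k, rfl⟩ := h
    exact hφ.1 k
  | zero => exact ⟨isTest_zero.memH10 hΩ hΩb, continuousOn_const⟩
  | add v w _ _ hv hw => exact ⟨hv.1.add hΩ hΩb hw.1, hv.2.add hw.2⟩
  | smul c v _ hv => exact ⟨hv.1.const_smul hΩ hΩb c, hv.2.const_smul c⟩

variable [Fintype ι]

theorem sum_smul_mem_span (φ : ι → E d → ℝ) (c : ι → ℝ) :
    ∑ k, c k • φ k ∈ Submodule.span ℝ (range φ) :=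
  Submodule.sum_mem _ fun k _ => Submodule.smul_mem _ _ (Submodule.subset_span ⟨k, rfl⟩)

/-- A continuous element of `H¹₀(Ω)` with vanishing Dirichlet energy is zero on `Ω`. -/
theorem eqOn_zero_of_energy_eq_zero (hd : 0 < d) (hΩ : IsOpen Ω) (hΩb : Bornology.IsBounded Ω)
    {v : E d → ℝ} (hv : MemH10 Ω v) (hc : ContinuousOn v Ω) (h : energy Ω v v = 0) :
    EqOn v 0 Ω := by
  obtain ⟨C, hC0, hC⟩ := exists_poincare_energyNorm hd hΩ hΩb
  have h0 : energyNorm Ω v = 0 := by rw [energyNorm, h, Real.sqrt_zero]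
  have h1 := hC v hv
  rw [h0, mul_zero] at h1
  have h2 := ae_eq_zero_of_l2norm_eq_zero hv.1.1 (le_antisymm h1 ENNReal.toReal_nonneg)
  exact Measure.eqOn_open_of_ae_eq h2 hΩ hc continuousOn_const

/-- The Galerkin system is uniquely solvable for every right-hand side. -/
theorem IsTrialBasis.existsUnique (hd : 0 < d) (hΩ : IsOpen Ω) (hΩb : Bornology.IsBounded Ω)
    (hφ : IsTrialBasis Ω φ) (b : ι → ℝ) :
    ∃! c : ι → ℝ, ∀ j, ∑ k, c k * energy Ω (φ k) (φ j) = b j := by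
  let T : (ι → ℝ) →ₗ[ℝ] (ι → ℝ) :=
    { toFun := fun c j => ∑ k, c k * energy Ω (φ k) (φ j)
      map_add' := fun c c' => by ext j; simp [add_mul, Finset.sum_add_distrib]
      map_smul' := fun a c => by ext j; simp [Finset.mul_sum, mul_assoc] }
  have hinj : Function.Injective T := by
    refine (injective_iff_map_eq_zero T).2 fun c hc => ?_
    have hH := fun k => (hφ.1 k).1
    have hs := hφ.of_mem_span hΩ hΩb (sum_smul_mem_span φ c)
    have he : energy Ω (∑ k, c k • φ k) (∑ k, c k • φ k) = 0 := by
      rw [energy_sum_left hΩ hΩb _ hH c hs.1]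
      refine Finset.sum_eq_zero fun j _ => ?_
      rw [energy_comm, energy_sum_left hΩ hΩb _ hH c (hH j)]
      have : ∑ k, c k * energy Ω (φ k) (φ j) = 0 := congrFun hc j
      rw [this, mul_zero]
    have hz := eqOn_zero_of_energy_eq_zero hd hΩ hΩb hs.1 hs.2 he
    refine funext (Fintype.linearIndependent_iff.1 hφ.2 c (funext fun y => ?_))
    simpa using hz y.2
  have hsurj := LinearMap.injective_iff_surjective.1 hinj
  obtain ⟨c, hc⟩ := hsurj b
  exact ⟨c, fun j => congrFun hc j, fun c' hc' => hinj (hc ▸ funext hc')⟩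

/-- Galerkin orthogonality: the Galerkin equations extend from the basis to the trial space. -/
theorem energy_galerkin (hΩ : IsOpen Ω) (hΩb : Bornology.IsBounded Ω) (hφ : IsTrialBasis Ω φ)
    (L : (E d → ℝ) →ₗ[ℝ] ℝ) {c : ι → ℝ}
    (hc : ∀ j, ∑ k, c k * energy Ω (φ k) (φ j) = L (φ j)) {v : E d → ℝ}
    (hv : v ∈ Submodule.span ℝ (range φ)) : energy Ω (∑ k, c k • φ k) v = L v := by
  have hH := fun k => (hφ.1 k).1
  have hs := (hφ.of_mem_span hΩ hΩb (sum_smul_mem_span φ c)).1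
  have key : ∀ v ∈ Submodule.span ℝ (range φ), energy Ω v (∑ k, c k • φ k) = L v := by
    intro v hv
    induction hv using Submodule.span_induction with
    | mem v h =>
      obtain ⟨j, rfl⟩ := h
      rw [energy_comm, energy_sum_left hΩ hΩb _ hH c (hH j), hc]
    | zero =>
      have := energy_smul_left hΩ hΩb 0 hs hs
      simpa using this
    | add v w hv' hw' hv hw =>
      rw [energy_add_left hΩ hΩb (hφ.of_mem_span hΩ hΩb hv').1 (hφ.of_mem_span hΩ hΩb hw').1 hs,
        hv, hw, map_add]
    | smul a v hv' hv =>
      rw [energy_smul_left hΩ hΩb a (hφ.of_mem_span hΩ hΩb hv').1 hs, hv, map_smul, smul_eq_mul]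
  rw [energy_comm]
  exact key v hv

/-- Evaluation at a point, as a linear functional. -/
def evalAt (y : E d) : (E d → ℝ) →ₗ[ℝ] ℝ := LinearMap.proj y

theorem sampleSum_eq_linear {n : ℕ} (x : Fin n → E d) (f v : E d → ℝ) :
    sampleSum x f v = (∑ i, ((1 / (n : ℝ)) * f (x i)) • (evalAt (x i) : (E d → ℝ) →ₗ[ℝ] ℝ)) v := by
  simp [sampleSum, Finset.mul_sum, mul_assoc, evalAt]

end Galerkin

/-! ### Convergence of the Galerkin solutions -/

section Convergence

/-- Céa's lemma: an orthogonal projection in the energy product is the best approximation. -/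
theorem energyNorm_sub_le_of_orthogonal {d : ℕ} {Ω : Set (E d)} (hΩ : IsOpen Ω)
    (hΩb : Bornology.IsBounded Ω) {u s v : E d → ℝ} (hu : MemH10 Ω u) (hs : MemH10 Ω s)
    (hv : MemH10 Ω v) (h1 : energy Ω (u - s) s = 0) (h2 : energy Ω (u - s) v = 0) :
    energyNorm Ω (u - s) ≤ energyNorm Ω (u - v) := by
  have hd := hu.sub hΩ hΩb hs
  have h3 : energyNorm Ω (u - s) ^ 2 = energy Ω (u - s) (u - v) := by
    rw [energyNorm_sq, energy_sub_right hΩ hΩb hu hs hd, energy_sub_right hΩ hΩb hu hv hd, h1, h2]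
  have h4 := (le_abs_self _).trans (abs_energy_le hΩ hd (hu.sub hΩ hΩb hv))
  rw [← h3, sq] at h4
  rcases (energyNorm_nonneg (Ω := Ω) (u - s)).eq_or_lt with h | h
  · rw [← h]
    exact energyNorm_nonneg _
  · exact le_of_mul_le_mul_left h4 h

variable {d : ℕ} {Ω : Set (E d)} {ι : ℕ → Type} [∀ N, Fintype (ι N)] {φ : ∀ N, ι N → E d → ℝ}

/-- Convergence of the discrete Green functions: if `c N` solves the Galerkin system with
right-hand side `δ_y`, then `a(w, u_N) → w(y)` for every `w` that `U_N` approximates at `y`. Both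
`‖u_N‖ ≤ K_N` and Galerkin orthogonality enter. -/
theorem tendsto_energy_galerkin_delta (hΩ : IsOpen Ω) (hΩb : Bornology.IsBounded Ω)
    (hφ : ∀ N, IsTrialBasis Ω (φ N)) {y : E d} (hy : ApproximatesAt Ω φ y)
    {c : ∀ N, ι N → ℝ}
    (hc : ∀ N j, ∑ k, c N k * energy Ω (φ N k) (φ N j) = φ N j y) {g w : E d → ℝ}
    (hg : IsTest Ω g) (hw : IsWeakSolution Ω g w) :
    Tendsto (fun N => energy Ω w (∑ k, c N k • φ N k)) atTop (𝓝 (w y)) := by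
  obtain ⟨K, hK, happ⟩ := hy
  obtain ⟨v, hv, hv1, hv2⟩ := happ g w hg hw
  have hu := fun N => sum_smul_mem_span (φ N) (c N)
  have hu0 := fun N => ((hφ N).of_mem_span hΩ hΩb (hu N)).1
  have hv0 := fun N => ((hφ N).of_mem_span hΩ hΩb (hv N)).1
  have horth : ∀ N, ∀ v ∈ Submodule.span ℝ (range (φ N)),
      energy Ω (∑ k, c N k • φ N k) v = v y := fun N v hv =>
    energy_galerkin hΩ hΩb (hφ N) (evalAt y) (hc N) hv
  -- stability: `‖u_N‖² = a(u_N, u_N) = u_N(y) ≤ K_N ‖u_N‖`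
  have hun : ∀ N, energyNorm Ω (∑ k, c N k • φ N k) ≤ |K N| := fun N => by
    have h1 := horth N _ (hu N)
    rw [← energyNorm_sq] at h1
    have h2 := hK N _ (hu N)
    have h3 := energyNorm_nonneg (Ω := Ω) (∑ k, c N k • φ N k)
    have h4 := le_abs_self ((∑ k, c N k • φ N k) y)
    rcases h3.eq_or_lt with h | h
    · rw [← h]; exact abs_nonneg _
    · have : energyNorm Ω (∑ k, c N k • φ N k) ≤ K N := by
        refine le_of_mul_le_mul_right ?_ h
        rw [← sq, h1]
        exact h4.trans h2
      exact this.trans (le_abs_self _)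
  -- `a(w, u_N) = v_N(y) + a(w - v_N, u_N)`
  have herr : Tendsto (fun N => energy Ω (w - v N) (∑ k, c N k • φ N k)) atTop (𝓝 0) := by
    refine squeeze_zero_norm (fun N => ?_) (by simpa using hv2.abs)
    rw [Real.norm_eq_abs, abs_of_nonneg (energyNorm_nonneg (w - v N)), mul_comm]
    exact (abs_energy_le hΩ (hw.1.sub hΩ hΩb (hv0 N)) (hu0 N)).trans
      (mul_le_mul_of_nonneg_left (hun N) (energyNorm_nonneg _))
  have := hv1.add herr
  rw [add_zero] at this
  refine this.congr fun N => ?_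
  rw [energy_sub_left hΩ hΩb hw.1 (hv0 N) (hu0 N), energy_comm (v N), horth N _ (hv N)]
  ring

/-- Convergence in the sense of distributions. The Galerkin solution is the superposition of the
discrete Green functions, and `∫ u_N g = a(w, u_N)` for the weak solution `w` of `-Δ w = g`. -/
theorem tendsto_integral_galerkin {n : ℕ} {x : Fin n → E d} {f u : E d → ℝ} (hd : 0 < d)
    (hΩ : IsOpen Ω) (hΩb : Bornology.IsBounded Ω) (hu : IsDeltaSolution Ω x f u)
    (hφ : ∀ N, IsTrialBasis Ω (φ N)) (happ : ∀ i, ApproximatesAt Ω φ (x i))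
    {c : ∀ N, ι N → ℝ} (hc : ∀ N, IsRGCoeff Ω x f (φ N) (c N)) {g : E d → ℝ} (hg : IsTest Ω g) :
    Tendsto (fun N => ∫ y in Ω, (∑ k, c N k • φ N k) y * g y) atTop
      (𝓝 (∫ y in Ω, u y * g y)) := by
  obtain ⟨w, hw⟩ := exists_isWeakSolution hd hΩ hΩb (hg.memLp ∞)
  rw [hu.2 g w (hg.memLp ∞) hw]
  choose e he using fun N i => ((hφ N).existsUnique hd hΩ hΩb (fun j => φ N j (x i))).exists
  have hH := fun N k => ((hφ N).1 k).1
  have hce : ∀ N, c N = fun k => ∑ i, ((1 / (n : ℝ)) * f (x i)) * e N i k := fun N => by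
    refine ((hφ N).existsUnique hd hΩ hΩb (fun j => sampleSum x f (φ N j))).unique (hc N)
      fun j => ?_
    simp_rw [Finset.sum_mul]
    rw [Finset.sum_comm, sampleSum, Finset.mul_sum]
    refine Finset.sum_congr rfl fun i _ => ?_
    rw [← mul_assoc, ← he N i j, Finset.mul_sum]
    exact Finset.sum_congr rfl fun k _ => by ring
  have hlim := tendsto_finsetSum (Finset.univ : Finset (Fin n)) fun i _ =>
    (tendsto_energy_galerkin_delta hΩ hΩb hφ (happ i) (fun N j => he N i j) hg hw).const_mul
      ((1 / (n : ℝ)) * f (x i))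
  have hS : sampleSum x f w = ∑ i, ((1 / (n : ℝ)) * f (x i)) * w (x i) := by
    simp [sampleSum, Finset.mul_sum, mul_assoc]
  rw [hS]
  refine hlim.congr fun N => ?_
  -- `e N i` are the coefficients of the discrete Green function with pole `x i`
  have hs : ∑ k, c N k • φ N k =
      ∑ i, ((1 / (n : ℝ)) * f (x i)) • ∑ k, e N i k • φ N k := by
    rw [hce N]
    simp_rw [Finset.sum_smul, Finset.smul_sum, smul_smul]
    rw [Finset.sum_comm]
  have hu0 := ((hφ N).of_mem_span hΩ hΩb (sum_smul_mem_span (φ N) (c N))).1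
  have h1 := hw.2.2 _ hu0
  simp_rw [mul_comm (g _)] at h1
  rw [← h1, hs, energy_comm, energy_sum_left hΩ hΩb _
    (fun i => MemH10.sum hΩ hΩb _ (hH N) (e N i)) _ hw.1]
  exact Finset.sum_congr rfl fun i _ => by rw [energy_comm]

/-- Céa's lemma and the Sobolev inequality give convergence in the energy norm and uniformly. -/
theorem tendsto_galerkin_of_dim_one {n : ℕ} {x : Fin n → E d} {f u : E d → ℝ} (hd1 : d = 1)
    (hΩ : IsOpen Ω) (hΩb : Bornology.IsBounded Ω) (hu : MemH10 Ω u) (huc : ContinuousOn u Ω)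
    (hue : ∀ v, MemH10 Ω v → ContinuousOn v Ω → energy Ω u v = sampleSum x f v)
    (hφ : ∀ N, IsTrialBasis Ω (φ N)) (hcomp : IsCompleteFamily Ω φ)
    {c : ∀ N, ι N → ℝ} (hc : ∀ N, IsRGCoeff Ω x f (φ N) (c N)) :
    Tendsto (fun N => energyNorm Ω (u - ∑ k, c N k • φ N k)) atTop (𝓝 0) ∧
      TendstoUniformlyOn (fun N => ∑ k, c N k • φ N k) u atTop Ω := by
  obtain ⟨v, hv, hv1⟩ := hcomp u hu
  have hs := fun N => (hφ N).of_mem_span hΩ hΩb (sum_smul_mem_span (φ N) (c N))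
  have hv0 := fun N => (hφ N).of_mem_span hΩ hΩb (hv N)
  have hdiff := fun N => hu.sub hΩ hΩb (hs N).1
  have horth : ∀ N, ∀ v ∈ Submodule.span ℝ (range (φ N)),
      energy Ω (u - ∑ k, c N k • φ N k) v = 0 := fun N v hv => by
    have h1 := (hφ N).of_mem_span hΩ hΩb hv
    rw [energy_sub_left hΩ hΩb hu (hs N).1 h1.1, hue v h1.1 h1.2, sampleSum_eq_linear,
      energy_galerkin hΩ hΩb (hφ N) _ (fun j => by rw [hc N j, sampleSum_eq_linear]) hv, sub_self]
  have hcea : ∀ N, energyNorm Ω (u - ∑ k, c N k • φ N k) ≤ energyNorm Ω (u - v N) := fun N => by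
    refine energyNorm_sub_le_of_orthogonal hΩ hΩb hu (hs N).1 (hv0 N).1 ?_ ?_
    · exact horth N _ (sum_smul_mem_span (φ N) (c N))
    · exact horth N _ (hv N)
  have hen : Tendsto (fun N => energyNorm Ω (u - ∑ k, c N k • φ N k)) atTop (𝓝 0) :=
    squeeze_zero (fun _ => energyNorm_nonneg _) hcea hv1
  refine ⟨hen, ?_⟩
  obtain ⟨C, hC0, hC⟩ := exists_sobolev_of_dim_one hd1 hΩ hΩb
  rw [Metric.tendstoUniformlyOn_iff]
  intro δ hδ
  have ht : Tendsto (fun N => C * energyNorm Ω (u - ∑ k, c N k • φ N k)) atTop (𝓝 0) := by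
    simpa using hen.const_mul C
  filter_upwards [ht.eventually_lt_const hδ] with N hN y hy
  refine lt_of_le_of_lt ?_ hN
  exact hC _ (hdiff N) (huc.sub (hs N).2) y hy

end Convergence

/-! ### Functions dominated by a defining function of the boundary -/

section Cutoff

/-- A smooth monotone step: `0` on `(-∞, 1]` and `1` on `[2, ∞)`. -/
noncomputable def cutoff (s : ℝ) : ℝ := Real.smoothTransition (s - 1)

theorem contDiff_cutoff : ContDiff ℝ ∞ cutoff :=
  Real.smoothTransition.contDiff.comp (contDiff_id.sub contDiff_const)

theorem abs_cutoff_le (s : ℝ) : |cutoff s| ≤ 1 := by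
  rw [cutoff, abs_of_nonneg (Real.smoothTransition.nonneg _)]
  exact Real.smoothTransition.le_one _

theorem cutoff_eq_zero {s : ℝ} (hs : s ≤ 1) : cutoff s = 0 :=
  Real.smoothTransition.zero_of_nonpos (by linarith)

theorem cutoff_eq_one {s : ℝ} (hs : 2 ≤ s) : cutoff s = 1 :=
  Real.smoothTransition.one_of_one_le (by linarith)

/-- The bound that keeps `F ∇(cutoff (k ρ))` bounded uniformly in `k` wherever `|F| ≤ C ρ`. -/
theorem exists_mul_deriv_cutoff_le : ∃ B, 0 < B ∧ ∀ s : ℝ, |s * deriv cutoff s| ≤ B := by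
  have hc : Continuous fun s : ℝ => s * deriv cutoff s :=
    continuous_id.mul (contDiff_cutoff.continuous_deriv (by simp))
  obtain ⟨B, hB⟩ := (isCompact_Icc (a := (1 : ℝ)) (b := 2)).exists_bound_of_continuousOn
    hc.continuousOn
  refine ⟨max B 1, by simp, fun s => ?_⟩
  rcases lt_or_ge s 1 with h | h
  · have : cutoff =ᶠ[𝓝 s] fun _ => 0 := by
      filter_upwards [Iio_mem_nhds h] with t ht using cutoff_eq_zero (le_of_lt ht)
    rw [this.deriv_eq]
    simp
  rcases lt_or_ge 2 s with h' | h'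
  · have : cutoff =ᶠ[𝓝 s] fun _ => 1 := by
      filter_upwards [Ioi_mem_nhds h'] with t ht using cutoff_eq_one (le_of_lt ht)
    rw [this.deriv_eq]
    simp
  · exact (hB s ⟨h, h'⟩).trans (le_max_left _ _)

end Cutoff

/-- A uniformly bounded sequence on a finite measure space which is pointwise eventually zero tends
to zero in `L²`. -/
theorem tendsto_eLpNorm_of_bounded {α V : Type*} [MeasurableSpace α] {μ : Measure α}
    [IsFiniteMeasure μ] [NormedAddCommGroup V] {F : ℕ → α → V}
    (hm : ∀ n, AEStronglyMeasurable (F n) μ) {M : ℝ} (hM : ∀ n, ∀ᵐ y ∂μ, ‖F n y‖ ≤ M)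
    (h0 : ∀ᵐ y ∂μ, Tendsto (fun n => F n y) atTop (𝓝 0)) :
    Tendsto (fun n => eLpNorm (F n) 2 μ) atTop (𝓝 0) := by
  have h : Tendsto (fun n => ∫⁻ y, ‖F n y‖ₑ ^ (2 : ℝ) ∂μ) atTop (𝓝 (∫⁻ _, 0 ∂μ)) := by
    refine tendsto_lintegral_of_dominated_convergence' (fun _ => ENNReal.ofReal M ^ (2 : ℝ))
      (fun n => (hm n).enorm.pow_const _) (fun n => ?_) ?_ ?_
    · filter_upwards [hM n] with y hy
      refine ENNReal.rpow_le_rpow ?_ (by norm_num)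
      rw [← ofReal_norm]
      exact ENNReal.ofReal_le_ofReal hy
    · rw [lintegral_const]
      exact ENNReal.mul_ne_top (ENNReal.rpow_ne_top_of_nonneg (by norm_num) ENNReal.ofReal_ne_top)
        (measure_ne_top _ _)
    · filter_upwards [h0] with y hy
      have h1 : Tendsto (fun n => ‖F n y‖ₑ) atTop (𝓝 0) := by
        simpa [Function.comp_def] using (continuous_enorm.tendsto (0 : V)).comp hy
      simpa [Function.comp_def] using
        ((ENNReal.continuous_rpow_const (y := (2 : ℝ))).tendsto 0).comp h1
  have h2 := (ENNReal.continuous_rpow_const (y := (1 / 2 : ℝ))).tendsto 0 |>.comp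
    (by simpa using h)
  simp only [ENNReal.zero_rpow_of_pos (by norm_num : (0 : ℝ) < 1 / 2)] at h2
  refine h2.congr fun n => ?_
  rw [eLpNorm_eq_lintegral_rpow_enorm_toReal (by norm_num) (by norm_num)]
  simp

section Boundary

variable {d : ℕ} {Ω : Set (E d)} {F ρ : E d → ℝ}

theorem gradient_comp {τ : ℝ → ℝ} (hτ : ContDiff ℝ ∞ τ) (hρ : ContDiff ℝ ∞ ρ) (y : E d) :
    gradient (fun z => τ (ρ z)) y = deriv τ (ρ y) • gradient ρ y := by
  ext j
  rw [gradient_apply, PiLp.smul_apply, gradient_apply, pderiv, pderiv, smul_eq_mul]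
  have h1 := (hτ.differentiable (by simp) (ρ y)).hasDerivAt
  have h2 := (hρ.differentiable (by simp) y).hasFDerivAt
  have := (h1.comp_hasFDerivAt y h2).fderiv
  rw [show (fun z => τ (ρ z)) = τ ∘ ρ from rfl, this]
  simp

/-- Cutting `F` off where `ρ` is small yields a test function, provided that `ρ` vanishes on the
boundary. -/
theorem isTest_indicator_mul_cutoff (hΩ : IsOpen Ω) (hΩb : Bornology.IsBounded Ω)
    (hF : ContDiff ℝ ∞ F) (hρ : ContDiff ℝ ∞ ρ) (h0 : ∀ y ∈ frontier Ω, ρ y = 0) (t : ℝ) :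
    IsTest Ω (Ω.indicator fun y => F y * cutoff (t * ρ y)) := by
  set G : E d → ℝ := fun y => F y * cutoff (t * ρ y) with hG
  have hGs : ContDiff ℝ ∞ G := hF.mul (contDiff_cutoff.comp (contDiff_const.mul hρ))
  set K : Set (E d) := closure Ω ∩ {y | 1 ≤ t * ρ y} with hK
  have hKc : IsClosed K :=
    isClosed_closure.inter (isClosed_le continuous_const (continuous_const.mul hρ.continuous))
  have hKΩ : K ⊆ Ω := fun y hy => by
    by_contra hn
    have : y ∈ frontier Ω := ⟨hy.1, fun h => hn (interior_subset h)⟩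
    have h1 : 1 ≤ t * ρ y := hy.2
    rw [h0 y this, mul_zero] at h1
    linarith
  have hz : ∀ y, y ∉ K → Ω.indicator G y = 0 := fun y hy => by
    by_cases hyΩ : y ∈ Ω
    · rw [indicator_of_mem hyΩ]
      have : t * ρ y ≤ 1 := by
        by_contra h
        exact hy ⟨subset_closure hyΩ, (not_le.1 h).le⟩
      simp [hG, cutoff_eq_zero this]
    · exact indicator_of_notMem hyΩ _
  have hts : tsupport (Ω.indicator G) ⊆ K := closure_minimal (fun y hy => by
    by_contra h
    exact hy (hz y h)) hKc
  refine ⟨contDiff_iff_contDiffAt.2 fun y => ?_, ?_, hts.trans hKΩ⟩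
  · by_cases hy : y ∈ K
    · refine hGs.contDiffAt.congr_of_eventuallyEq ?_
      filter_upwards [hΩ.mem_nhds (hKΩ hy)] with z hz using indicator_of_mem hz _
    · refine (contDiffAt_const (c := (0 : ℝ))).congr_of_eventuallyEq ?_
      filter_upwards [hKc.isOpen_compl.mem_nhds hy] with z hz' using hz z hz'
  · exact HasCompactSupport.intro
      (Metric.isCompact_of_isClosed_isBounded hKc (hΩb.closure.subset inter_subset_left)) hz

/-- A smooth function that is dominated on `Ω` by a smooth defining function of the boundary
belongs to `H¹₀(Ω)`. -/
theorem isH0_of_le_boundary (hΩ : IsOpen Ω) (hΩb : Bornology.IsBounded Ω)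
    (hF : ContDiff ℝ ∞ F) (hρ : ContDiff ℝ ∞ ρ) (hpos : ∀ y ∈ Ω, 0 < ρ y)
    (h0 : ∀ y ∈ frontier Ω, ρ y = 0) {C : ℝ} (hle : ∀ y ∈ Ω, |F y| ≤ C * ρ y) :
    IsH0 Ω F (gradient F) := by
  have : IsFiniteMeasure (volume.restrict Ω) := ⟨by simpa using hΩb.measure_lt_top⟩
  obtain ⟨B, hB0, hB⟩ := exists_mul_deriv_cutoff_le
  obtain ⟨M, hM0, hM⟩ := exists_norm_le_of_isBounded hΩb hF.continuous
  obtain ⟨M1, hM10, hM1⟩ := exists_norm_le_of_isBounded hΩb (continuous_gradient hF)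
  obtain ⟨M2, hM20, hM2⟩ := exists_norm_le_of_isBounded hΩb (continuous_gradient hρ)
  -- `F` cut off where `ρ ≤ 1 / k`
  set ψ : ℕ → E d → ℝ := fun k => Ω.indicator fun y => F y * cutoff (k * ρ y) with hψ
  have hψt : ∀ k, IsTest Ω (ψ k) := fun k => isTest_indicator_mul_cutoff hΩ hΩb hF hρ h0 k
  have hcut : ∀ k : ℕ, ContDiff ℝ ∞ fun y => cutoff (k * ρ y) := fun k =>
    contDiff_cutoff.comp (contDiff_const.mul hρ)
  have hev : ∀ k, ∀ y ∈ Ω, ψ k =ᶠ[𝓝 y] fun y => F y * cutoff (k * ρ y) := fun k y hy => by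
    filter_upwards [hΩ.mem_nhds hy] with z hz using indicator_of_mem hz _
  have hgrad : ∀ k : ℕ, ∀ y ∈ Ω, gradient (ψ k) y =
      F y • (deriv cutoff (k * ρ y) • (k : ℝ) • gradient ρ y) +
        cutoff (k * ρ y) • gradient F y := by
    intro k y hy
    rw [(hev k y hy).gradient.self_of_nhds]
    have h1 := congrFun (gradient_mul hF (hcut k)) y
    have h2 := gradient_comp contDiff_cutoff (ρ := fun z => k * ρ z) (contDiff_const.mul hρ) y
    have h3 := congrFun (gradient_const_smul hρ (k : ℝ)) y
    simp only [Pi.smul_apply] at h3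
    rw [← h3]
    exact h1.trans (by rw [h2]; rfl)
  have hconst : ∀ y ∈ Ω, ∀ᶠ k : ℕ in atTop, 2 < (k : ℝ) * ρ y := fun y hy =>
    (tendsto_natCast_atTop_atTop.atTop_mul_const (hpos y hy)).eventually_gt_atTop 2
  refine IsH0.of_tendsto (memLp_of_continuous hΩ hΩb hF.continuous 2)
    (memLp_of_continuous hΩ hΩb (continuous_gradient hF) 2) (fun k => (hψt k).isH0) ?_ ?_
  · refine tendsto_eLpNorm_of_bounded (M := M + M * 1) (fun k => ?_) (fun k => ?_) ?_
    · exact (hF.continuous.sub (hψt k).1.continuous).aestronglyMeasurable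
    · refine (ae_restrict_iff' hΩ.measurableSet).2 (.of_forall fun y hy => ?_)
      refine (norm_sub_le _ _).trans (add_le_add (hM y hy) ?_)
      rw [(hev k y hy).self_of_nhds, norm_mul]
      exact mul_le_mul (hM y hy) (abs_cutoff_le _) (norm_nonneg _) hM0.le
    · refine (ae_restrict_iff' hΩ.measurableSet).2 (.of_forall fun y hy => ?_)
      refine tendsto_const_nhds.congr' ?_
      filter_upwards [hconst y hy] with k hk
      rw [Pi.sub_apply, (hev k y hy).self_of_nhds]
      simp only [cutoff_eq_one hk.le, mul_one, sub_self]
  · refine tendsto_eLpNorm_of_bounded (M := M1 + (C * B * M2 + 1 * M1)) (fun k => ?_)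
      (fun k => ?_) ?_
    · exact ((continuous_gradient hF).sub
        (continuous_gradient (hψt k).1)).aestronglyMeasurable
    · refine (ae_restrict_iff' hΩ.measurableSet).2 (.of_forall fun y hy => ?_)
      refine (norm_sub_le _ _).trans (add_le_add (hM1 y hy) ?_)
      rw [hgrad k y hy]
      refine (norm_add_le _ _).trans (add_le_add ?_ ?_)
      · rw [smul_smul, smul_smul, norm_smul]
        refine mul_le_mul ?_ (hM2 y hy) (norm_nonneg _) ?_
        · have e : |F y| * |deriv cutoff (k * ρ y)| * |(k : ℝ)| ≤
              C * ρ y * |deriv cutoff (k * ρ y)| * |(k : ℝ)| := by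
            gcongr
            exact hle y hy
          have hC : 0 ≤ C := nonneg_of_mul_nonneg_left ((abs_nonneg _).trans (hle y hy))
            (hpos y hy)
          have h3 := hB (k * ρ y)
          rw [abs_mul, abs_mul, abs_of_pos (hpos y hy)] at h3
          simp only [Real.norm_eq_abs, abs_mul]
          refine le_trans (by linarith) (e.trans ?_)
          calc _ = C * (|(k : ℝ)| * ρ y * |deriv cutoff (k * ρ y)|) := by ring
            _ ≤ _ := mul_le_mul_of_nonneg_left h3 hC
        · have hC : 0 ≤ C := nonneg_of_mul_nonneg_left ((abs_nonneg _).trans (hle y hy))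
            (hpos y hy)
          positivity
      · rw [norm_smul]
        exact mul_le_mul (abs_cutoff_le _) (hM1 y hy) (norm_nonneg _) zero_le_one
    · refine (ae_restrict_iff' hΩ.measurableSet).2 (.of_forall fun y hy => ?_)
      refine tendsto_const_nhds.congr' ?_
      filter_upwards [hconst y hy] with k hk
      have hd : deriv cutoff (k * ρ y) = 0 := by
        have : cutoff =ᶠ[𝓝 (k * ρ y)] fun _ => 1 := by
          filter_upwards [Ioi_mem_nhds hk] with t ht using cutoff_eq_one (le_of_lt ht)
        rw [this.deriv_eq]
        simp
      rw [Pi.sub_apply, hgrad k y hy, cutoff_eq_one hk.le, hd]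
      simp

end Boundary

/-! ### The Green function of an interval -/

section Coordinates

variable {d : ℕ}

theorem pderiv_comp_apply {h : ℝ → ℝ} (hh : Differentiable ℝ h) (i j : Fin d) (y : E d) :
    pderiv i (fun y => h (y j)) y = if i = j then deriv h (y j) else 0 := by
  have h1 := (hh (y j)).hasDerivAt
  have h2 := (EuclideanSpace.proj j : E d →L[ℝ] ℝ).hasFDerivAt (x := y)
  have h3 : HasFDerivAt (fun y : E d => h (y j)) _ y := h1.comp_hasFDerivAt y h2
  rw [pderiv, h3.fderiv]
  simp [eq_comm]

theorem exists_eq_of_mem_frontier_box {a b : Fin d → ℝ} {y : E d}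
    (hy : y ∈ frontier {y : E d | ∀ j, y j ∈ Ioo (a j) (b j)}) : ∃ j, y j = a j ∨ y j = b j := by
  by_contra! h
  have ho : IsOpen {y : E d | ∀ j, y j ∈ Ioo (a j) (b j)} := by
    simp only [ofPred_forall]
    exact isOpen_iInter_of_finite fun j => isOpen_Ioo.preimage (by fun_prop)
  have hc : IsClosed {y : E d | ∀ j, y j ∈ Icc (a j) (b j)} := by
    simp only [ofPred_forall]
    exact isClosed_iInter fun j => isClosed_Icc.preimage (by fun_prop)
  have hcl : y ∈ {y : E d | ∀ j, y j ∈ Icc (a j) (b j)} :=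
    closure_minimal (fun z (hz : z ∈ {y : E d | ∀ j, y j ∈ Ioo (a j) (b j)}) j =>
      Ioo_subset_Icc_self (hz j)) hc hy.1
  refine hy.2 ?_
  rw [ho.interior_eq]
  exact fun j => ⟨lt_of_le_of_ne (hcl j).1 (h j).1.symm, lt_of_le_of_ne (hcl j).2 (h j).2⟩

end Coordinates

section Interval

/-- The primitive of `s ↦ profile (s²)` that vanishes on `(-∞, -1]`: a smooth step. -/
noncomputable def smoothStep (t : ℝ) : ℝ := ∫ s in (-1 : ℝ)..t, profile (s ^ 2)

/-- The primitive of `smoothStep` that vanishes on `(-∞, -1]`: a smooth version of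
`t ↦ max t 0`, of slope `smoothStep 1` on `[1, ∞)`. -/
noncomputable def smoothRamp (t : ℝ) : ℝ := t * smoothStep t + profilePrim (t ^ 2)

theorem hasDerivAt_smoothStep (t : ℝ) : HasDerivAt smoothStep (profile (t ^ 2)) t := by
  have hc : Continuous fun s : ℝ => profile (s ^ 2) :=
    contDiff_profile.continuous.comp (continuous_pow 2)
  exact intervalIntegral.integral_hasDerivAt_right (hc.intervalIntegrable _ _)
    (hc.stronglyMeasurableAtFilter _ _) hc.continuousAt

theorem hasDerivAt_smoothRamp (t : ℝ) : HasDerivAt smoothRamp (smoothStep t) t := by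
  have h1 := (hasDerivAt_id t).mul (hasDerivAt_smoothStep t)
  have h2 := (hasDerivAt_profilePrim (t ^ 2)).comp t (hasDerivAt_pow 2 t)
  refine (h1.add h2).congr_deriv ?_
  simp
  ring

theorem contDiff_smoothRamp : ContDiff ℝ ∞ smoothRamp := by
  rw [contDiff_infty_iff_deriv, funext fun t => (hasDerivAt_smoothRamp t).deriv,
    contDiff_infty_iff_deriv, funext fun t => (hasDerivAt_smoothStep t).deriv]
  exact ⟨fun t => (hasDerivAt_smoothRamp t).differentiableAt,
    fun t => (hasDerivAt_smoothStep t).differentiableAt, contDiff_profile.comp (contDiff_id.pow 2)⟩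

theorem smoothStep_eq_zero {t : ℝ} (ht : t ≤ -1) : smoothStep t = 0 := by
  rw [smoothStep, intervalIntegral.integral_congr (g := fun _ => (0 : ℝ)) fun s hs => ?_]
  · simp
  · rw [uIcc_of_ge ht] at hs
    exact profile_eq_zero (by nlinarith [hs.2])

theorem smoothStep_eq {t : ℝ} (ht : 1 ≤ t) : smoothStep t = smoothStep 1 := by
  have hc : Continuous fun s : ℝ => profile (s ^ 2) :=
    contDiff_profile.continuous.comp (continuous_pow 2)
  rw [smoothStep, ← intervalIntegral.integral_add_adjacent_intervals
    (hc.intervalIntegrable (-1) 1) (hc.intervalIntegrable 1 t), smoothStep,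
    intervalIntegral.integral_congr (a := 1) (b := t) (g := fun _ => (0 : ℝ)) fun s hs => ?_]
  · simp
  · rw [uIcc_of_le ht] at hs
    exact profile_eq_zero (by nlinarith [hs.1])

theorem smoothRamp_eq_zero {t : ℝ} (ht : t ≤ -1) : smoothRamp t = 0 := by
  rw [smoothRamp, smoothStep_eq_zero ht, profilePrim_eq_zero (by nlinarith)]
  simp

theorem smoothRamp_eq {t : ℝ} (ht : 1 ≤ t) : smoothRamp t = t * smoothStep 1 := by
  rw [smoothRamp, smoothStep_eq ht, profilePrim_eq_zero (by nlinarith), add_zero]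

/-- The total rise of `smoothStep` is the integral of the one-dimensional mollifiers. -/
theorem smoothStep_one_eq_mass : smoothStep 1 = mass 1 := by
  have hp : MeasurePreserving (fun y : E 1 => y 0) volume volume :=
    (volume_preserving_funUnique (Fin 1) ℝ).comp (PiLp.volume_preserving_ofLp (Fin 1))
  have hme : MeasurableEmbedding (fun y : E 1 => y 0) :=
    ((MeasurableEquiv.toLp 2 (Fin 1 → ℝ)).symm.trans
      (MeasurableEquiv.funUnique (Fin 1) ℝ)).measurableEmbedding
  have h1 : mass 1 = ∫ s : ℝ, profile (s ^ 2) := by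
    rw [← hp.integral_comp hme]
    refine integral_congr_ae (.of_forall fun y => ?_)
    simp [EuclideanSpace.norm_sq_eq]
  rw [h1, smoothStep, intervalIntegral.integral_of_le (by norm_num),
    setIntegral_eq_integral_of_forall_compl_eq_zero]
  intro s hs
  refine profile_eq_zero ?_
  by_contra! h
  have := abs_lt.1 ((sq_lt_one_iff_abs_lt_one s).1 h)
  exact hs ⟨this.1, this.2.le⟩

/-- The Green function of `(a, b)` with pole `z`, as a function of `s`, smoothed at scale `ε`. -/
noncomputable def smoothHat (a b z ε s : ℝ) : ℝ :=
  (b - z) * ((s - a) / (b - a)) - ε / mass 1 * smoothRamp ((s - z) / ε)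

variable {a b z ε : ℝ}

theorem contDiff_smoothHat : ContDiff ℝ ∞ (smoothHat a b z ε) := by
  unfold smoothHat
  have := contDiff_smoothRamp
  fun_prop

theorem deriv_deriv_smoothHat (hε : 0 < ε) (s : ℝ) :
    deriv (deriv (smoothHat a b z ε)) s = -(1 / mass 1 * (ε⁻¹ * profile (((s - z) / ε) ^ 2))) := by
  have h0 : ∀ s, HasDerivAt (fun s => (s - z) / ε) (1 / ε) s := fun s =>
    ((hasDerivAt_id s).sub_const z).div_const ε
  have h1 : ∀ s, HasDerivAt (smoothHat a b z ε)
      ((b - z) * (1 / (b - a)) - 1 / mass 1 * smoothStep ((s - z) / ε)) s := fun s => by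
    have e1 := (((hasDerivAt_id s).sub_const a).div_const (b - a)).const_mul (b - z)
    have e2 := ((hasDerivAt_smoothRamp ((s - z) / ε)).comp s (h0 s)).const_mul (ε / mass 1)
    refine (e1.sub e2).congr_deriv ?_
    field_simp
  rw [funext fun s => (h1 s).deriv]
  have h2 := (((hasDerivAt_smoothStep ((s - z) / ε)).comp s (h0 s)).const_mul
    (1 / mass 1)).const_sub ((b - z) * (1 / (b - a)))
  refine HasDerivAt.deriv (h2.congr_deriv ?_)
  field_simp

theorem smoothHat_of_le (hε : 0 < ε) {s : ℝ} (hs : s ≤ z - ε) :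
    smoothHat a b z ε s = (b - z) * ((s - a) / (b - a)) := by
  rw [smoothHat, smoothRamp_eq_zero, mul_zero, sub_zero]
  rw [div_le_iff₀ hε]
  linarith

theorem smoothHat_of_ge (hε : 0 < ε) {s : ℝ} (hs : z + ε ≤ s) :
    smoothHat a b z ε s = (b - z) * ((s - a) / (b - a)) - (s - z) := by
  have hm : mass 1 ≠ 0 := (mass_pos 1).ne'
  rw [smoothHat, smoothRamp_eq, smoothStep_one_eq_mass]
  · field_simp
  · rw [le_div_iff₀ hε]
    linarith

/-- The limit `ε → 0` of the smoothed Green functions. -/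
theorem tendsto_smoothHat (s : ℝ) :
    Tendsto (fun ε => smoothHat a b z ε s) (𝓝[>] 0)
      (𝓝 ((b - z) * ((s - a) / (b - a)) - max (s - z) 0)) := by
  rcases lt_trichotomy s z with h | h | h
  · rw [max_eq_right (by linarith), sub_zero]
    refine tendsto_const_nhds.congr' ?_
    filter_upwards [Ioo_mem_nhdsGT (sub_pos.2 h)] with ε hε
    exact (smoothHat_of_le hε.1 (by linarith [hε.2])).symm
  · subst h
    simp only [smoothHat, sub_self, zero_div, max_self]
    refine tendsto_const_nhds.sub (Tendsto.mono_left ?_ nhdsWithin_le_nhds)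
    have : Continuous fun ε : ℝ => ε / mass 1 * smoothRamp 0 := by fun_prop
    simpa using this.tendsto 0
  · rw [max_eq_left (by linarith)]
    refine tendsto_const_nhds.congr' ?_
    filter_upwards [Ioo_mem_nhdsGT (sub_pos.2 h)] with ε hε
    exact (smoothHat_of_ge hε.1 (by linarith [hε.2])).symm

/-- The smoothed Green function vanishes linearly at both ends, since it coincides there with the
exact, piecewise linear one. -/
theorem exists_abs_smoothHat_le (hε : 0 < ε) (ha : a < z - ε) (hb : z + ε < b) :
    ∃ C, ∀ s ∈ Ioo a b, |smoothHat a b z ε s| ≤ C * ((s - a) * (b - s)) := by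
  obtain ⟨M, hM⟩ := (isCompact_Icc (a := a) (b := b)).exists_bound_of_continuousOn
    (contDiff_smoothHat (a := a) (b := b) (z := z) (ε := ε)).continuous.continuousOn
  have hab : 0 < b - a := by linarith
  set δ := (z - ε - a) * (b - z - ε) with hδ
  have hδ0 : 0 < δ := mul_pos (by linarith) (by linarith)
  refine ⟨1 / (b - a) + M / δ + 1 / (b - a), fun s hs => ?_⟩
  have h1 : 0 < s - a := sub_pos.2 hs.1
  have h2 : 0 < b - s := sub_pos.2 hs.2
  have hM0 : 0 ≤ M := (norm_nonneg _).trans (hM s (Ioo_subset_Icc_self hs))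
  have hm : 0 ≤ M / δ := by positivity
  have hρ : 0 < (s - a) * (b - s) := mul_pos h1 h2
  have hi : 0 < 1 / (b - a) := by positivity
  rcases le_total s (z - ε) with h | h
  · rw [smoothHat_of_le hε h, abs_of_nonneg (mul_nonneg (by linarith) (by positivity))]
    have : (b - z) * ((s - a) / (b - a)) ≤ 1 / (b - a) * ((s - a) * (b - s)) := by
      rw [div_mul_eq_mul_div, one_mul, mul_div_assoc', div_le_div_iff_of_pos_right hab]
      nlinarith
    nlinarith
  rcases le_total (z + ε) s with h' | h'
  · have e : smoothHat a b z ε s = (z - a) * (b - s) / (b - a) := by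
      rw [smoothHat_of_ge hε h']
      field_simp
      ring
    rw [e, abs_of_nonneg (div_nonneg (mul_nonneg (by linarith) h2.le) hab.le)]
    have : (z - a) * (b - s) / (b - a) ≤ 1 / (b - a) * ((s - a) * (b - s)) := by
      rw [div_mul_eq_mul_div, one_mul, div_le_div_iff_of_pos_right hab]
      nlinarith
    nlinarith
  · have h3 : δ ≤ (s - a) * (b - s) := mul_le_mul (by linarith) (by linarith) (by linarith) h1.le
    have h4 : M ≤ M / δ * ((s - a) * (b - s)) := by
      rw [div_mul_eq_mul_div, le_div_iff₀ hδ0]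
      exact mul_le_mul_of_nonneg_left h3 hM0
    have h5 := hM s (Ioo_subset_Icc_self hs)
    rw [Real.norm_eq_abs] at h5
    nlinarith

/-- On an interval, a function of `H¹₀` is reproduced by the explicit Green function: its Dirichlet
product with the smoothed Green function is a mollification. -/
theorem tendsto_energy_smoothHat {Ω : Set (E 1)} (hΩ : IsOpen Ω) (hΩb : Bornology.IsBounded Ω)
    (hab : Ω = {y | y 0 ∈ Ioo a b}) {u : E 1 → ℝ} (hu : MemH10 Ω u) (huc : ContinuousOn u Ω)
    {y : E 1} (hy : y ∈ Ω) :
    (∀ᶠ ε in 𝓝[>] 0, MemH10 Ω fun s => smoothHat a b (y 0) ε (s 0)) ∧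
    Tendsto (fun ε => energy Ω u fun s => smoothHat a b (y 0) ε (s 0)) (𝓝[>] 0) (𝓝 (u y)) := by
  have hbox : Ω = {y : E 1 | ∀ j, y j ∈ Ioo ((fun _ => a) j) ((fun _ => b) j)} := by
    rw [hab]
    ext s
    simp only [mem_ofPred_eq, Fin.forall_fin_one]
  have hy0 : y 0 ∈ Ioo a b := by rw [hab] at hy; exact hy
  have hsm : ∀ ε, ContDiff ℝ ∞ fun s : E 1 => smoothHat a b (y 0) ε (s 0) := fun ε =>
    contDiff_smoothHat.comp (by fun_prop)
  have hmem : ∀ᶠ ε in 𝓝[>] 0, MemH10 Ω fun s => smoothHat a b (y 0) ε (s 0) := by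
    have h1 : 0 < min (y 0 - a) (b - y 0) := lt_min (sub_pos.2 hy0.1) (sub_pos.2 hy0.2)
    filter_upwards [Ioo_mem_nhdsGT h1] with ε hε
    have h2 := lt_min_iff.1 hε.2
    obtain ⟨C, hC⟩ := exists_abs_smoothHat_le (a := a) (b := b) (z := y 0) hε.1 (by linarith)
      (by linarith)
    refine (isH0_of_le_boundary hΩ hΩb (hsm ε) (ρ := fun s => (s 0 - a) * (b - s 0))
      (by fun_prop) (fun s hs => ?_) (fun s hs => ?_) (C := C) fun s hs => ?_).memH10 hΩ hΩb
    · rw [hab] at hs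
      exact mul_pos (sub_pos.2 hs.1) (sub_pos.2 hs.2)
    · rw [hbox] at hs
      obtain ⟨j, hj⟩ := exists_eq_of_mem_frontier_box hs
      rw [Subsingleton.elim j 0] at hj
      rcases hj with hj | hj <;> simp [hj]
    · rw [hab] at hs
      exact hC _ hs
  refine ⟨hmem, ?_⟩
  have hm : mass 1 ≠ 0 := (mass_pos 1).ne'
  have hlim := (tendsto_integral_mollifier hΩ huc hy).const_mul (1 / mass 1)
  rw [← mul_assoc, one_div_mul_cancel hm, one_mul] at hlim
  refine hlim.congr' ?_
  filter_upwards [hmem, self_mem_nhdsWithin] with ε hε hpos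
  have hpos : 0 < ε := hpos
  rw [energy_comm, energy_eq_integral_laplacian hΩ hΩb (hsm ε) hε hu, ← integral_const_mul]
  refine integral_congr_ae (.of_forall fun s => ?_)
  have h1 : pderiv 0 (fun s : E 1 => smoothHat a b (y 0) ε (s 0)) =
      fun s : E 1 => deriv (smoothHat a b (y 0) ε) (s 0) := funext fun s => by
    rw [pderiv_comp_apply (contDiff_smoothHat.differentiable (by simp)), if_pos rfl]
  have h2 : Differentiable ℝ (deriv (smoothHat a b (y 0) ε)) :=
    ((contDiff_infty_iff_deriv.1 contDiff_smoothHat).2).differentiable (by simp)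
  simp only
  rw [laplacian_eq_sum (hsm ε), Fin.sum_univ_one, h1, pderiv_comp_apply h2, if_pos rfl,
    deriv_deriv_smoothHat hpos, neg_neg, mollifier]
  have e : ‖s - y‖ ^ 2 * ε ^ (-2 : ℤ) = ((s 0 - y 0) / ε) ^ 2 := by
    rw [EuclideanSpace.norm_sq_eq, Fin.sum_univ_one, zpow_neg, div_pow]
    simp [div_eq_mul_inv]
  rw [e]
  simp only [Nat.cast_one, zpow_neg, zpow_one]
  ring

/-- The explicit representation on an interval, from the symmetry of the Green function. -/
theorem eq_sum_hat_of_energy_eq {n : ℕ} {Ω : Set (E 1)} (hΩ : IsOpen Ω)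
    (hΩb : Bornology.IsBounded Ω) (hab : Ω = {y | y 0 ∈ Ioo a b}) {x : Fin n → E 1} {f u : E 1 → ℝ}
    (hu : MemH10 Ω u) (huc : ContinuousOn u Ω)
    (hue : ∀ v, MemH10 Ω v → ContinuousOn v Ω → energy Ω u v = sampleSum x f v) {y : E 1}
    (hy : y ∈ Ω) :
    u y = (1 / (n : ℝ)) * ∑ i, f (x i) * (b - x i 0) * ((y 0 - a) / (b - a)) -
      (1 / (n : ℝ)) * ∑ i, f (x i) * (y 0 - x i 0) * heaviside (y 0 - x i 0) := by
  obtain ⟨h1, h2⟩ := tendsto_energy_smoothHat hΩ hΩb hab hu huc hy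
  have hy0 : y 0 ∈ Ioo a b := by rw [hab] at hy; exact hy
  have hlim : Tendsto (fun ε => sampleSum x f fun s => smoothHat a b (y 0) ε (s 0)) (𝓝[>] 0)
      (𝓝 (sampleSum x f fun s => (b - y 0) * ((s 0 - a) / (b - a)) - max (s 0 - y 0) 0)) :=
    (tendsto_finsetSum _ fun i _ => (tendsto_smoothHat (x i 0)).const_mul _).const_mul _
  -- testing the weak equation with the smoothed Green function with pole `y`
  have h3 := tendsto_nhds_unique (h2.congr' (h1.mono fun ε hε => hue _ hε
    (contDiff_smoothHat.continuous.comp (by fun_prop)).continuousOn)) hlim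
  rw [h3, sampleSum, ← mul_sub, ← Finset.sum_sub_distrib]
  congr 1
  refine Finset.sum_congr rfl fun i _ => ?_
  have hab' : b - a ≠ 0 := by linarith [hy0.1, hy0.2]
  rw [heaviside]
  split_ifs with h
  · rw [max_eq_left (by linarith)]
    field_simp
    ring
  · rw [max_eq_right (by linarith)]
    field_simp
    ring

end Interval

/-! ### Sine modes on a box -/

section ProductFunctions

variable {d : ℕ}

/-- The partial derivatives of a product of functions of one variable each. -/
theorem pderiv_prod_apply {h : Fin d → ℝ → ℝ} (hh : ∀ i, ContDiff ℝ ∞ (h i)) (j : Fin d) :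
    pderiv j (fun y : E d => ∏ i, h i (y i)) =
      fun y => ∏ i, Function.update h j (deriv (h j)) i (y i) := by
  ext y
  have hd : DifferentiableAt ℝ (fun y : E d => ∏ i, h i (y i)) y := by
    have : ContDiff ℝ ∞ fun y : E d => ∏ i, h i (y i) :=
      contDiff_prod fun i _ => (hh i).comp (by fun_prop)
    exact this.differentiable (by simp) y
  rw [pderiv, ← hd.lineDeriv_eq_fderiv, lineDeriv]
  have e : (fun t : ℝ => ∏ i, h i ((y + t • EuclideanSpace.single j (1 : ℝ)) i)) =
      fun t => h j (y j + t) * ∏ i ∈ Finset.univ.erase j, h i (y i) := by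
    ext t
    rw [← Finset.mul_prod_erase _ _ (Finset.mem_univ j)]
    congr 1
    · simp
    · refine Finset.prod_congr rfl fun i hi => ?_
      simp [Finset.ne_of_mem_erase hi]
  rw [e, deriv_mul_const_field]
  rw [deriv_comp_const_add, add_zero,
    ← Finset.mul_prod_erase _ _ (Finset.mem_univ j), Function.update_self]
  congr 1
  exact Finset.prod_congr rfl fun i hi => by rw [Function.update_of_ne (Finset.ne_of_mem_erase hi)]

theorem laplacian_prod_apply {h : Fin d → ℝ → ℝ} (hh : ∀ i, ContDiff ℝ ∞ (h i)) {c : Fin d → ℝ}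
    (hc : ∀ j s, deriv (deriv (h j)) s = c j * h j s) (y : E d) :
    Laplacian.laplacian (fun y : E d => ∏ i, h i (y i)) y = (∑ j, c j) * ∏ i, h i (y i) := by
  have hs : ContDiff ℝ ∞ fun y : E d => ∏ i, h i (y i) :=
    contDiff_prod fun i _ => (hh i).comp (by fun_prop)
  rw [laplacian_eq_sum hs, Finset.sum_mul]
  refine Finset.sum_congr rfl fun j _ => ?_
  have hh' : ∀ i, ContDiff ℝ ∞ (Function.update h j (deriv (h j)) i) := fun i => by
    rcases eq_or_ne i j with rfl | hi
    · rw [Function.update_self]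
      exact (contDiff_infty_iff_deriv.1 (hh i)).2
    · rw [Function.update_of_ne hi]
      exact hh i
  rw [pderiv_prod_apply hh, pderiv_prod_apply hh', Function.update_self, Function.update_idem]
  simp only
  rw [← Finset.mul_prod_erase Finset.univ (fun i => h i (y i)) (Finset.mem_univ j),
    ← Finset.mul_prod_erase Finset.univ _ (Finset.mem_univ j), Function.update_self, hc, mul_assoc]
  congr 2
  exact Finset.prod_congr rfl fun i hi => by rw [Function.update_of_ne (Finset.ne_of_mem_erase hi)]

end ProductFunctions

section SineModes

variable {d : ℕ} {a b : Fin d → ℝ}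

/-- The open box `∏ⱼ (aⱼ, bⱼ)`. -/
def box (a b : Fin d → ℝ) : Set (E d) := {y | ∀ j, y j ∈ Ioo (a j) (b j)}

/-- The Dirichlet eigenfunctions of the box, over all multi-indices. -/
noncomputable def sineMode (a b : Fin d → ℝ) (k : Fin d → ℕ) (y : E d) : ℝ :=
  ∏ j, Real.sin (((k j : ℝ) + 1) * Real.pi * (y j - a j) / (b j - a j))

/-- The Dirichlet eigenvalue that belongs to `sineMode a b k`. -/
noncomputable def eigenvalue (a b : Fin d → ℝ) (k : Fin d → ℕ) : ℝ :=
  ∑ j, (((k j : ℝ) + 1) * Real.pi / (b j - a j)) ^ 2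

theorem contDiff_sineMode (k : Fin d → ℕ) : ContDiff ℝ ∞ (sineMode a b k) := by
  unfold sineMode
  refine contDiff_prod fun j _ => Real.contDiff_sin.comp ?_
  fun_prop

theorem abs_sineMode_le_one (k : Fin d → ℕ) (y : E d) : |sineMode a b k y| ≤ 1 := by
  rw [sineMode, Finset.abs_prod]
  exact Finset.prod_le_one (fun _ _ => abs_nonneg _) fun _ _ => Real.abs_sin_le_one _

theorem laplacian_sineMode (k : Fin d → ℕ) (y : E d) :
    Laplacian.laplacian (sineMode a b k) y = -(eigenvalue a b k * sineMode a b k y) := by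
  have hd : ∀ j, Differentiable ℝ
      (fun s : ℝ => ((k j : ℝ) + 1) * Real.pi * (s - a j) / (b j - a j)) := fun j => by fun_prop
  have hd0 : ∀ (j : Fin d) (s : ℝ), HasDerivAt
      (fun s : ℝ => ((k j : ℝ) + 1) * Real.pi * (s - a j) / (b j - a j))
      (((k j : ℝ) + 1) * Real.pi / (b j - a j)) s := fun j s => by
    simpa using (((hasDerivAt_id s).sub_const (a j)).const_mul
      (((k j : ℝ) + 1) * Real.pi)).div_const (b j - a j)
  have := laplacian_prod_apply
    (h := fun j s => Real.sin (((k j : ℝ) + 1) * Real.pi * (s - a j) / (b j - a j)))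
    (c := fun j => -(((k j : ℝ) + 1) * Real.pi / (b j - a j)) ^ 2)
    (fun j => Real.contDiff_sin.comp (by fun_prop)) (fun j s => by
      rw [funext fun s => ((hd0 j s).sin).deriv, (((hd0 j s).cos).mul_const _).deriv]
      ring) y
  refine this.trans ?_
  rw [Finset.sum_neg_distrib, neg_mul]
  rfl

theorem abs_sin_nat_mul_le (n : ℕ) (t : ℝ) : |Real.sin (n * t)| ≤ n * |Real.sin t| := by
  induction n with
  | zero => simp
  | succ n ih =>
    push_cast
    rw [add_mul, one_mul, Real.sin_add, add_mul, one_mul]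
    refine (abs_add_le _ _).trans (add_le_add ?_ ?_)
    · rw [abs_mul]
      exact (mul_le_of_le_one_right (abs_nonneg _) (Real.abs_cos_le_one _)).trans ih
    · rw [abs_mul]
      exact mul_le_of_le_one_left (abs_nonneg _) (Real.abs_cos_le_one _)

theorem abs_sineMode_le (k : Fin d → ℕ) (y : E d) :
    |sineMode a b k y| ≤ (∏ j, ((k j : ℝ) + 1)) * |sineMode a b 0 y| := by
  rw [sineMode, sineMode, Finset.abs_prod, Finset.abs_prod, ← Finset.prod_mul_distrib]
  refine Finset.prod_le_prod (fun _ _ => abs_nonneg _) fun j _ => ?_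
  have := abs_sin_nat_mul_le (k j + 1) (Real.pi * (y j - a j) / (b j - a j))
  push_cast at this
  simpa [mul_assoc, mul_div_assoc] using this

theorem sineMode_zero_pos {y : E d} (hy : y ∈ box a b) : 0 < sineMode a b 0 y := by
  refine Finset.prod_pos fun j _ => ?_
  have h1 := (hy j).1
  have h2 := (hy j).2
  have h3 : 0 < b j - a j := by linarith
  simp only [Pi.zero_apply, Nat.cast_zero, zero_add, one_mul]
  refine Real.sin_pos_of_pos_of_lt_pi ?_ ?_
  · exact div_pos (mul_pos Real.pi_pos (by linarith)) h3
  · rw [div_lt_iff₀ h3]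
    exact mul_lt_mul_of_pos_left (by linarith) Real.pi_pos

theorem sineMode_eq_zero_of_mem_frontier (hab : ∀ j, a j < b j) (k : Fin d → ℕ) {y : E d}
    (hy : y ∈ frontier (box a b)) : sineMode a b k y = 0 := by
  obtain ⟨j, hj⟩ := exists_eq_of_mem_frontier_box hy
  refine Finset.prod_eq_zero (Finset.mem_univ j) ?_
  have h3 : b j - a j ≠ 0 := (sub_pos.2 (hab j)).ne'
  rcases hj with hj | hj
  · simp [hj]
  · rw [hj, mul_div_assoc, div_self h3, mul_one]
    exact_mod_cast Real.sin_nat_mul_pi (k j + 1)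

theorem isOpen_box (a b : Fin d → ℝ) : IsOpen (box a b) := by
  unfold box
  simp only [ofPred_forall]
  exact isOpen_iInter_of_finite fun j => isOpen_Ioo.preimage (by fun_prop)

theorem isBounded_box (a b : Fin d → ℝ) : Bornology.IsBounded (box a b) := by
  have h : IsCompact ((WithLp.toLp 2 : (Fin d → ℝ) → E d) '' (Icc a b)) :=
    isCompact_Icc.image (PiLp.continuous_toLp 2 _)
  exact h.isBounded.subset fun y hy =>
    ⟨WithLp.ofLp y, ⟨fun j => (hy j).1.le, fun j => (hy j).2.le⟩, rfl⟩

theorem isH0_sineMode (hab : ∀ j, a j < b j) (k : Fin d → ℕ) :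
    IsH0 (box a b) (sineMode a b k) (gradient (sineMode a b k)) :=
  isH0_of_le_boundary (isOpen_box a b) (isBounded_box a b) (contDiff_sineMode k)
    (contDiff_sineMode 0) (fun _ => sineMode_zero_pos)
    (fun _ => sineMode_eq_zero_of_mem_frontier hab 0) fun y hy => by
      have := abs_sineMode_le (a := a) (b := b) k y
      rwa [abs_of_pos (sineMode_zero_pos hy)] at this

theorem memH10_sineMode (hab : ∀ j, a j < b j) (k : Fin d → ℕ) :
    MemH10 (box a b) (sineMode a b k) :=
  (isH0_sineMode hab k).memH10 (isOpen_box a b) (isBounded_box a b)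

theorem energy_sineMode (hab : ∀ j, a j < b j) (k : Fin d → ℕ) {v : E d → ℝ}
    (hv : MemH10 (box a b) v) :
    energy (box a b) (sineMode a b k) v =
      eigenvalue a b k * ∫ y in box a b, sineMode a b k y * v y := by
  rw [energy_eq_integral_laplacian (isOpen_box a b) (isBounded_box a b) (contDiff_sineMode k)
    (memH10_sineMode hab k) hv, ← integral_const_mul]
  refine integral_congr_ae (.of_forall fun y => ?_)
  simp only [laplacian_sineMode]
  ring

theorem eigenvalue_pos (hd : 0 < d) (hab : ∀ j, a j < b j) (k : Fin d → ℕ) :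
    0 < eigenvalue a b k := by
  have : Nonempty (Fin d) := ⟨⟨0, hd⟩⟩
  refine Finset.sum_pos (fun j _ => ?_) Finset.univ_nonempty
  have := sub_pos.2 (hab j)
  have := Real.pi_pos
  positivity

/-- Eigenvalues grow at least quadratically in every component of the multi-index. -/
theorem exists_le_eigenvalue (hab : ∀ j, a j < b j) :
    ∃ κ, 0 < κ ∧ ∀ (k : Fin d → ℕ) (j : Fin d), κ * ((k j : ℝ) + 1) ^ 2 ≤ eigenvalue a b k := by
  have hL : ∀ j, b j - a j ≤ 1 + ∑ i, (b i - a i) := fun j => by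
    have := Finset.single_le_sum (f := fun i => b i - a i)
      (fun i _ => (sub_pos.2 (hab i)).le) (Finset.mem_univ j)
    linarith
  have hS : 0 ≤ ∑ i, (b i - a i) := Finset.sum_nonneg fun i _ => (sub_pos.2 (hab i)).le
  refine ⟨(Real.pi / (1 + ∑ i, (b i - a i))) ^ 2, ?_, fun k j => ?_⟩
  · have := Real.pi_pos
    positivity
  · refine le_trans ?_ (Finset.single_le_sum
      (f := fun j => (((k j : ℝ) + 1) * Real.pi / (b j - a j)) ^ 2)
      (fun _ _ => sq_nonneg _) (Finset.mem_univ j))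
    have h1 := sub_pos.2 (hab j)
    have h2 := Real.pi_pos
    have h3 : Real.pi / (1 + ∑ i, (b i - a i)) ≤ Real.pi / (b j - a j) :=
      div_le_div_of_nonneg_left h2.le h1 (hL j)
    calc _ ≤ (Real.pi / (b j - a j)) ^ 2 * ((k j : ℝ) + 1) ^ 2 := by gcongr
      _ = _ := by ring

theorem integral_cos_nat_mul_pi {a b : ℝ} (hab : a < b) {m : ℤ} (hm : m ≠ 0) :
    ∫ y in a..b, Real.cos (m * Real.pi * (y - a) / (b - a)) = 0 := by
  have h0 := (sub_pos.2 hab).ne'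
  have hm' : (m : ℝ) ≠ 0 := by exact_mod_cast hm
  have hπ := Real.pi_pos.ne'
  have hder : ∀ s ∈ uIcc a b, HasDerivAt
      (fun s => (b - a) / (m * Real.pi) * Real.sin (m * Real.pi * (s - a) / (b - a)))
      (Real.cos (m * Real.pi * (s - a) / (b - a))) s := fun s _ => by
    have h1 : HasDerivAt (fun s => m * Real.pi * (s - a) / (b - a)) (m * Real.pi / (b - a)) s := by
      simpa using (((hasDerivAt_id s).sub_const a).const_mul (m * Real.pi)).div_const (b - a)
    refine (h1.sin.const_mul ((b - a) / (m * Real.pi))).congr_deriv ?_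
    field_simp
  rw [intervalIntegral.integral_eq_sub_of_hasDerivAt hder
    (Continuous.intervalIntegrable (by fun_prop) _ _)]
  simp [mul_div_assoc, div_self h0, Real.sin_int_mul_pi]

theorem integral_sin_mul_sin {a b : ℝ} (hab : a < b) (m n : ℕ) :
    ∫ y in Ioo a b, Real.sin (((m : ℝ) + 1) * Real.pi * (y - a) / (b - a)) *
      Real.sin (((n : ℝ) + 1) * Real.pi * (y - a) / (b - a)) =
        if m = n then (b - a) / 2 else 0 := by
  have e : ∀ y, Real.sin (((m : ℝ) + 1) * Real.pi * (y - a) / (b - a)) *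
      Real.sin (((n : ℝ) + 1) * Real.pi * (y - a) / (b - a)) =
      (1 / 2) * (Real.cos (((m - n : ℤ) : ℝ) * Real.pi * (y - a) / (b - a)) -
        Real.cos (((m + n + 2 : ℤ) : ℝ) * Real.pi * (y - a) / (b - a))) := fun y => by
    have h1 : ((m - n : ℤ) : ℝ) * Real.pi * (y - a) / (b - a) =
        ((m : ℝ) + 1) * Real.pi * (y - a) / (b - a) -
          ((n : ℝ) + 1) * Real.pi * (y - a) / (b - a) := by push_cast; ring
    have h2 : ((m + n + 2 : ℤ) : ℝ) * Real.pi * (y - a) / (b - a) =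
        ((m : ℝ) + 1) * Real.pi * (y - a) / (b - a) +
          ((n : ℝ) + 1) * Real.pi * (y - a) / (b - a) := by push_cast; ring
    rw [h1, h2, Real.cos_sub, Real.cos_add]
    ring
  rw [← integral_Ioc_eq_integral_Ioo, ← intervalIntegral.integral_of_le hab.le]
  simp_rw [e]
  rw [intervalIntegral.integral_const_mul, intervalIntegral.integral_sub
    (Continuous.intervalIntegrable (by fun_prop) _ _)
    (Continuous.intervalIntegrable (by fun_prop) _ _),
    integral_cos_nat_mul_pi hab (m := m + n + 2) (by omega), sub_zero]
  split_ifs with h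
  · subst h
    simp
    ring
  · rw [integral_cos_nat_mul_pi hab (by omega), mul_zero]

/-- The sine modes are orthogonal, all with the same norm. -/
theorem integral_sineMode_mul_sineMode (hab : ∀ j, a j < b j) (k l : Fin d → ℕ) :
    ∫ y in box a b, sineMode a b k y * sineMode a b l y =
      if k = l then ∏ j, (b j - a j) / 2 else 0 := by
  have hp := PiLp.volume_preserving_ofLp (Fin d)
  have hme : MeasurableEmbedding (WithLp.ofLp : E d → Fin d → ℝ) :=
    (MeasurableEquiv.toLp 2 (Fin d → ℝ)).symm.measurableEmbedding
  have hpre : box a b = WithLp.ofLp ⁻¹' (univ.pi fun j => Ioo (a j) (b j)) := by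
    ext y
    simp [box]
  have h1 := hp.setIntegral_preimage_emb hme (fun s : Fin d → ℝ =>
    ∏ j, (Real.sin (((k j : ℝ) + 1) * Real.pi * (s j - a j) / (b j - a j)) *
      Real.sin (((l j : ℝ) + 1) * Real.pi * (s j - a j) / (b j - a j))))
    (univ.pi fun j => Ioo (a j) (b j))
  have h2 : ∀ y, sineMode a b k y * sineMode a b l y =
    ∏ j, (Real.sin (((k j : ℝ) + 1) * Real.pi * (y j - a j) / (b j - a j)) *
      Real.sin (((l j : ℝ) + 1) * Real.pi * (y j - a j) / (b j - a j))) := fun y => by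
    rw [Finset.prod_mul_distrib]
    rfl
  simp_rw [h2]
  rw [hpre, h1, volume_pi, Measure.restrict_pi_pi, integral_fintype_prod_eq_prod
    (fun j s => Real.sin (((k j : ℝ) + 1) * Real.pi * (s - a j) / (b j - a j)) *
      Real.sin (((l j : ℝ) + 1) * Real.pi * (s - a j) / (b j - a j)))]
  simp_rw [integral_sin_mul_sin (hab _)]
  split_ifs with h
  · subst h
    simp
  · obtain ⟨j, hj⟩ := Function.ne_iff.1 h
    exact Finset.prod_eq_zero (Finset.mem_univ j) (if_neg hj)

end SineModes

/-! ### Totality of the sine modes -/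

section Density

variable {d : ℕ} {a b : Fin d → ℝ}

theorem sineMode_update (k : Fin d → ℕ) (j : Fin d) (m : ℕ) (y : E d) :
    sineMode a b (Function.update k j m) y =
      Real.sin (((m : ℝ) + 1) * Real.pi * (y j - a j) / (b j - a j)) *
        ∏ i ∈ Finset.univ.erase j,
          Real.sin (((k i : ℝ) + 1) * Real.pi * (y i - a i) / (b i - a i)) := by
  rw [sineMode, ← Finset.mul_prod_erase _ _ (Finset.mem_univ j), Function.update_self]
  congr 1
  exact Finset.prod_congr rfl fun i hi => by rw [Function.update_of_ne (Finset.ne_of_mem_erase hi)]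

/-- Products of a sine mode with the cosine of the first frequency in one direction are linear
combinations of sine modes. -/
theorem cos_mul_sineMode_mem_span (k : Fin d → ℕ) (j : Fin d) :
    (fun y : E d => Real.cos (Real.pi * (y j - a j) / (b j - a j)) * sineMode a b k y) ∈
      Submodule.span ℝ (range (sineMode a b)) := by
  have hmem : ∀ l, sineMode a b l ∈ Submodule.span ℝ (range (sineMode a b)) := fun l =>
    Submodule.subset_span ⟨l, rfl⟩
  obtain ⟨m, hm⟩ : ∃ m, k j = m := ⟨_, rfl⟩
  have hk : sineMode a b k = sineMode a b (Function.update k j m) := by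
    rw [← hm, Function.update_eq_self]
  rw [hk]
  have hcs : ∀ t s : ℝ, Real.cos t * Real.sin s =
      1 / 2 * (Real.sin (s + t) + Real.sin (s - t)) := fun t s => by
    rw [Real.sin_add, Real.sin_sub]
    ring
  -- `sin 0 = 0` takes the place of the missing lower neighbour of the lowest frequency
  rcases m with _ | m
  · have : (fun y : E d => Real.cos (Real.pi * (y j - a j) / (b j - a j)) *
        sineMode a b (Function.update k j 0) y) =
        (1 / 2 : ℝ) • sineMode a b (Function.update k j 1) := by
      ext y
      rw [Pi.smul_apply, sineMode_update, sineMode_update, ← mul_assoc, hcs, smul_eq_mul,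
        mul_assoc (1 / 2 : ℝ)]
      congr 2
      have h1 : ((0 : ℕ) + 1 : ℝ) * Real.pi * (y j - a j) / (b j - a j) -
          Real.pi * (y j - a j) / (b j - a j) = 0 := by push_cast; ring
      rw [h1, Real.sin_zero, add_zero]
      congr 1
      push_cast
      ring
    rw [this]
    exact Submodule.smul_mem _ _ (hmem _)
  · have : (fun y : E d => Real.cos (Real.pi * (y j - a j) / (b j - a j)) *
        sineMode a b (Function.update k j (m + 1)) y) =
        (1 / 2 : ℝ) • (sineMode a b (Function.update k j (m + 2)) +
          sineMode a b (Function.update k j m)) := by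
      ext y
      rw [Pi.smul_apply, Pi.add_apply, sineMode_update, sineMode_update, sineMode_update,
        ← mul_assoc, hcs, smul_eq_mul, mul_assoc, ← add_mul]
      congr 4
      · push_cast
        ring
      · push_cast
        ring
    rw [this]
    exact Submodule.smul_mem _ _ (Submodule.add_mem _ (hmem _) (hmem _))

/-- The multipliers of the span of the sine modes form an algebra that contains the cosines of the
first frequencies; by the Stone–Weierstrass theorem it is dense in the continuous functions on the
closed box. Applied to the lowest mode, which is positive on the box, the multipliers give enough
elements of the span. -/
theorem exists_mem_span_sineMode_near (hab : ∀ j, a j < b j) {φ : E d → ℝ} (hφ : Continuous φ)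
    {ε : ℝ} (hε : 0 < ε) :
    ∃ v ∈ Submodule.span ℝ (range (sineMode a b)),
      ∀ y ∈ box a b, |v y - sineMode a b 0 y * φ y| ≤ ε := by
  set V := Submodule.span ℝ (range (sineMode a b)) with hV
  set K : Set (E d) := (WithLp.toLp 2 : (Fin d → ℝ) → E d) '' (Icc a b) with hK
  have hKc : IsCompact K := isCompact_Icc.image (PiLp.continuous_toLp 2 _)
  have : CompactSpace K := isCompact_iff_compactSpace.1 hKc
  let A : Subalgebra ℝ C(K, ℝ) :=
    { carrier := {p | ∃ P : E d → ℝ, (∀ y : K, P y = p y) ∧ ∀ v ∈ V, P * v ∈ V}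
      mul_mem' := by
        rintro p q ⟨P, hP, hPV⟩ ⟨Q, hQ, hQV⟩
        exact ⟨P * Q, fun y => by simp [hP, hQ], fun v hv => by
          rw [mul_assoc]
          exact hPV _ (hQV _ hv)⟩
      add_mem' := by
        rintro p q ⟨P, hP, hPV⟩ ⟨Q, hQ, hQV⟩
        exact ⟨P + Q, fun y => by simp [hP, hQ], fun v hv => by
          rw [add_mul]
          exact V.add_mem (hPV _ hv) (hQV _ hv)⟩
      algebraMap_mem' := fun r => ⟨fun _ => r, fun y => by simp, fun v hv => V.smul_mem r hv⟩ }
  have hcos : ∀ j : Fin d, (⟨fun y : K => Real.cos (Real.pi * ((y : E d) j - a j) / (b j - a j)),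
      by fun_prop⟩ : C(K, ℝ)) ∈ A := fun j => by
    refine ⟨fun y => Real.cos (Real.pi * (y j - a j) / (b j - a j)), fun y => rfl, fun v hv => ?_⟩
    induction hv using Submodule.span_induction with
    | mem v h =>
      obtain ⟨k, rfl⟩ := h
      exact cos_mul_sineMode_mem_span k j
    | zero => rw [mul_zero]; exact V.zero_mem
    | add v w _ _ hv hw => rw [mul_add]; exact V.add_mem hv hw
    | smul c v _ hv => rw [mul_smul_comm]; exact V.smul_mem c hv
  have hsep : A.SeparatesPoints := by
    rintro ⟨y, y', hy', rfl⟩ ⟨z, z', hz', rfl⟩ hyz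
    have hne : y' ≠ z' := fun h => hyz (by simp [h])
    obtain ⟨j, hj⟩ := Function.ne_iff.1 hne
    refine ⟨_, ⟨_, hcos j, rfl⟩, fun h => hj ?_⟩
    have h3 := sub_pos.2 (hab j)
    have hI : ∀ s ∈ Icc (a j) (b j), Real.pi * (s - a j) / (b j - a j) ∈ Icc 0 Real.pi := by
      intro s hs
      have hs1 := sub_nonneg.2 hs.1
      have := Real.pi_pos
      refine ⟨by positivity, ?_⟩
      rw [div_le_iff₀ h3]
      exact mul_le_mul_of_nonneg_left (by linarith [hs.2]) this.le
    have h4 := Real.injOn_cos (hI _ ⟨hy'.1 j, hy'.2 j⟩) (hI _ ⟨hz'.1 j, hz'.2 j⟩) h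
    rw [div_left_inj' h3.ne', mul_right_inj' Real.pi_pos.ne'] at h4
    linarith
  obtain ⟨⟨p, P, hP, hPV⟩, hp⟩ :=
    ContinuousMap.exists_mem_subalgebra_near_continuous_of_separatesPoints A hsep
      (fun y : K => φ y) (by fun_prop) ε hε
  refine ⟨P * sineMode a b 0, hPV _ (Submodule.subset_span ⟨0, rfl⟩), fun y hy => ?_⟩
  have hyK : y ∈ K := ⟨WithLp.ofLp y, ⟨fun j => (hy j).1.le, fun j => (hy j).2.le⟩, rfl⟩
  have h1 := (hp ⟨y, hyK⟩).le
  rw [Real.norm_eq_abs, ← hP ⟨y, hyK⟩] at h1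
  rw [Pi.mul_apply, mul_comm, ← mul_sub, abs_mul]
  exact (mul_le_of_le_one_left (abs_nonneg _) (abs_sineMode_le_one _ _)).trans h1

/-- The sine modes are total in `L²` of the box. -/
theorem ae_eq_zero_of_integral_sineMode_eq_zero (hab : ∀ j, a j < b j) {g : E d → ℝ}
    (hg : MemLp g 2 (volume.restrict (box a b)))
    (h0 : ∀ k, ∫ y in box a b, sineMode a b k y * g y = 0) :
    g =ᵐ[volume.restrict (box a b)] 0 := by
  have hΩ := isOpen_box a b
  have hΩb := isBounded_box a b
  have : IsFiniteMeasure (volume.restrict (box a b)) := ⟨by simpa using hΩb.measure_lt_top⟩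
  have hgi : Integrable g (volume.restrict (box a b)) := hg.integrable (by norm_num)
  have hSm : ∀ {v : E d → ℝ}, Continuous v → MemLp v 2 (volume.restrict (box a b)) := fun hv =>
    memLp_of_continuous hΩ hΩb hv 2
  have hV : ∀ v ∈ Submodule.span ℝ (range (sineMode a b)),
      Continuous v ∧ ∫ y in box a b, v y * g y = 0 := by
    intro v hv
    induction hv using Submodule.span_induction with
    | mem v h =>
      obtain ⟨k, rfl⟩ := h
      exact ⟨(contDiff_sineMode k).continuous, h0 k⟩
    | zero => exact ⟨continuous_const, by simp⟩
    | add v w _ _ hv hw =>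
      refine ⟨hv.1.add hw.1, ?_⟩
      simp only [Pi.add_apply, add_mul]
      rw [integral_add (integrable_mul (hSm hv.1) hg) (integrable_mul (hSm hw.1) hg), hv.2, hw.2,
        add_zero]
    | smul c v _ hv =>
      refine ⟨hv.1.const_smul c, ?_⟩
      simp only [Pi.smul_apply, smul_eq_mul, mul_assoc]
      rw [integral_const_mul, hv.2, mul_zero]
  have hS0 := (contDiff_sineMode (a := a) (b := b) 0).continuous
  -- `g` times the lowest mode is orthogonal to every continuous function
  have hzero : ∀ φ : E d → ℝ, Continuous φ →
      ∫ y in box a b, (sineMode a b 0 y * φ y) * g y = 0 := by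
    intro φ hφ
    set I := ∫ y in box a b, |g y| with hI
    have hI0 : 0 ≤ I := integral_nonneg fun _ => abs_nonneg _
    refine abs_eq_zero.1 (le_antisymm (le_of_forall_pos_le_add fun δ hδ => ?_) (abs_nonneg _))
    obtain ⟨v, hv, hv1⟩ := exists_mem_span_sineMode_near hab hφ (ε := δ / (I + 1)) (by positivity)
    obtain ⟨hvc, hv2⟩ := hV v hv
    have hsub : ∫ y in box a b, (sineMode a b 0 y * φ y) * g y =
        -∫ y in box a b, (v y - sineMode a b 0 y * φ y) * g y := by
      simp only [sub_mul]
      rw [integral_sub (integrable_mul (hSm hvc) hg) (integrable_mul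
        (hSm (v := fun y => sineMode a b 0 y * φ y) (hS0.mul hφ)) hg), hv2]
      ring
    rw [hsub, abs_neg, zero_add]
    have hb : |∫ y in box a b, (v y - sineMode a b 0 y * φ y) * g y| ≤ δ / (I + 1) * I := by
      rw [hI, ← integral_const_mul, ← Real.norm_eq_abs]
      refine norm_integral_le_of_norm_le (hgi.abs.const_mul _) ?_
      refine (ae_restrict_iff' hΩ.measurableSet).2 (.of_forall fun y hy => ?_)
      rw [norm_mul]
      exact mul_le_mul_of_nonneg_right (hv1 y hy) (abs_nonneg _)
    refine hb.trans ?_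
    rw [div_mul_eq_mul_div, div_le_iff₀ (by positivity)]
    nlinarith
  have hli : LocallyIntegrableOn (fun y => sineMode a b 0 y * g y) (box a b) :=
    IntegrableOn.locallyIntegrableOn (integrable_mul (hSm hS0) hg)
  have := IsOpen.ae_eq_zero_of_integral_contDiff_smul_eq_zero hΩ hli (μ := volume)
    fun ψ h1 h2 h3 => by
      have hψ : IsTest (box a b) ψ := ⟨h1, h2, h3⟩
      rw [← hψ.setIntegral_eq (fun y hy => by simp [hy]), ← hzero ψ h1.continuous]
      refine integral_congr_ae (.of_forall fun y => ?_)
      simp only [smul_eq_mul]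
      ring
  refine (ae_restrict_iff' hΩ.measurableSet).2 ?_
  filter_upwards [this] with y hy hyΩ
  exact (mul_eq_zero.1 (hy hyΩ)).resolve_left (sineMode_zero_pos hyΩ).ne'

end Density

/-! ### Expansions in sine modes -/

section Expansion

/-- The tail of an orthonormal expansion is controlled by any vector whose coefficients dominate
those of the tail. -/
theorem norm_sub_sum_le_of_abs_inner_le {H ι : Type*} [NormedAddCommGroup H]
    [InnerProductSpace ℝ H] {e : ι → H} (he : Orthonormal ℝ e) {x z : H}
    (hx : HasSum (fun k => inner ℝ (e k) x • e k) x) (s : Finset ι) {η : ℝ} (hη : 0 ≤ η)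
    (h : ∀ k, k ∉ s → |inner ℝ (e k) x| ≤ η * |inner ℝ (e k) z|) :
    ‖x - ∑ k ∈ s, inner ℝ (e k) x • e k‖ ≤ η * ‖z‖ := by
  classical
  have hlim : Tendsto (fun t : Finset ι => ‖∑ k ∈ t, inner ℝ (e k) x • e k -
      ∑ k ∈ s, inner ℝ (e k) x • e k‖) atTop (𝓝 ‖x - ∑ k ∈ s, inner ℝ (e k) x • e k‖) :=
    (Tendsto.sub_const hx _).norm
  refine le_of_tendsto hlim ?_
  filter_upwards [eventually_ge_atTop s] with t ht
  have e1 : ∑ k ∈ t, inner ℝ (e k) x • e k - ∑ k ∈ s, inner ℝ (e k) x • e k =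
      ∑ k ∈ t \ s, inner ℝ (e k) x • e k := by
    rw [← Finset.sum_sdiff ht, add_sub_cancel_right]
  rw [e1]
  refine abs_le_of_sq_le_sq' ?_ (by positivity) |>.2
  have e2 : ‖∑ k ∈ t \ s, inner ℝ (e k) x • e k‖ ^ 2 = ∑ k ∈ t \ s, (inner ℝ (e k) x) ^ 2 := by
    rw [← real_inner_self_eq_norm_sq, he.inner_sum]
    simp [sq]
  rw [e2, mul_pow]
  have hB := he.sum_inner_products_le z (s := t \ s)
  calc ∑ k ∈ t \ s, (inner ℝ (e k) x) ^ 2 ≤ ∑ k ∈ t \ s, η ^ 2 * ‖inner ℝ (e k) z‖ ^ 2 := by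
        refine Finset.sum_le_sum fun k hk => ?_
        rw [← mul_pow, ← sq_abs (inner ℝ (e k) x)]
        exact pow_le_pow_left₀ (abs_nonneg _) (h k (Finset.mem_sdiff.1 hk).2) 2
    _ = η ^ 2 * ∑ k ∈ t \ s, ‖inner ℝ (e k) z‖ ^ 2 := by rw [Finset.mul_sum]
    _ ≤ η ^ 2 * ‖z‖ ^ 2 := mul_le_mul_of_nonneg_left hB (sq_nonneg _)

variable {d : ℕ} {a b : Fin d → ℝ}

/-- The coefficients of the expansion in sine modes. -/
noncomputable def sineCoeff (a b : Fin d → ℝ) (g : E d → ℝ) (k : Fin d → ℕ) : ℝ :=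
  (∏ j, (b j - a j) / 2)⁻¹ * ∫ y in box a b, sineMode a b k y * g y

/-- The partial sum of the expansion in sine modes over a finite set of multi-indices. -/
noncomputable def sineSum (a b : Fin d → ℝ) (s : Finset (Fin d → ℕ)) (g : E d → ℝ) : E d → ℝ :=
  ∑ k ∈ s, sineCoeff a b g k • sineMode a b k

theorem memLp_sineMode (k : Fin d → ℕ) : MemLp (sineMode a b k) 2 (volume.restrict (box a b)) :=
  memLp_of_continuous (isOpen_box a b) (isBounded_box a b) (contDiff_sineMode k).continuous 2

/-- If the coefficients of `g` off `s` are dominated by those of `η h`, then so is the error of the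
partial sum of `g` over `s`. -/
theorem l2norm_sub_sineSum_le (hab : ∀ j, a j < b j) {g h : E d → ℝ}
    (hg : MemLp g 2 (volume.restrict (box a b))) (hh : MemLp h 2 (volume.restrict (box a b)))
    (s : Finset (Fin d → ℕ)) {η : ℝ} (hη : 0 ≤ η)
    (hc : ∀ k, k ∉ s → |sineCoeff a b g k| ≤ η * |sineCoeff a b h k|) :
    l2norm (box a b) (g - sineSum a b s g) ≤ η * l2norm (box a b) h := by
  set μ := volume.restrict (box a b) with hμ
  set c : ℝ := ∏ j, (b j - a j) / 2 with hcdef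
  have hc0 : 0 < c := Finset.prod_pos fun j _ => half_pos (sub_pos.2 (hab j))
  have hsc : √c ≠ 0 := (Real.sqrt_pos.2 hc0).ne'
  have hss : (√c)⁻¹ * (√c)⁻¹ = c⁻¹ := by rw [← mul_inv, Real.mul_self_sqrt hc0.le]
  let e : (Fin d → ℕ) → Lp ℝ 2 μ := fun k => (√c)⁻¹ • (memLp_sineMode k).toLp (sineMode a b k)
  have hin : ∀ k {f : E d → ℝ} (hf : MemLp f 2 μ),
      inner ℝ (e k) (hf.toLp f) = (√c)⁻¹ * ∫ y in box a b, sineMode a b k y * f y := by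
    intro k f hf
    simp only [e]
    rw [real_inner_smul_left, L2.inner_def]
    congr 1
    refine integral_congr_ae ?_
    filter_upwards [(memLp_sineMode (a := a) (b := b) k).coeFn_toLp, hf.coeFn_toLp] with y h1 h2
    rw [h1, h2]
    simp [mul_comm]
  have hinc : ∀ k {f : E d → ℝ} (hf : MemLp f 2 μ),
      inner ℝ (e k) (hf.toLp f) = √c * sineCoeff a b f k := by
    intro k f hf
    rw [hin, sineCoeff, ← mul_assoc, ← hcdef, ← hss]
    field_simp
  have he : Orthonormal ℝ e := by
    rw [orthonormal_iff_ite]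
    intro k l
    have h1 : inner ℝ (e k) (e l) =
        (√c)⁻¹ * inner ℝ (e k) ((memLp_sineMode l).toLp (sineMode a b l)) := by
      conv_lhs => rw [show e l = (√c)⁻¹ • (memLp_sineMode l).toLp (sineMode a b l) from rfl]
      rw [real_inner_smul_right]
    rw [h1, hin, integral_sineMode_mul_sineMode hab, ← mul_assoc, hss, ← hcdef]
    split_ifs
    · exact inv_mul_cancel₀ hc0.ne'
    · exact mul_zero _
  -- totality makes the normalised modes `e` a Hilbert basis
  have hbot : (Submodule.span ℝ (range e))ᗮ = ⊥ := by
    refine (Submodule.eq_bot_iff _).2 fun x hx => ?_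
    have hx0 : ∀ k, ∫ y in box a b, sineMode a b k y * x y = 0 := fun k => by
      have h1 : inner ℝ (e k) x = 0 := hx _ (Submodule.subset_span ⟨k, rfl⟩)
      have h2 := hin k (Lp.memLp x)
      rw [Lp.toLp_coeFn, h1] at h2
      exact (mul_eq_zero.1 h2.symm).resolve_left (inv_ne_zero hsc)
    have := ae_eq_zero_of_integral_sineMode_eq_zero hab (Lp.memLp x) hx0
    exact (Lp.eq_zero_iff_ae_eq_zero).2 this
  have hsum : HasSum (fun k => inner ℝ (e k) (hg.toLp g) • e k) (hg.toLp g) := by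
    have := (HilbertBasis.mkOfOrthogonalEqBot he hbot).hasSum_repr (hg.toLp g)
    simpa only [HilbertBasis.repr_apply_apply, HilbertBasis.coe_mkOfOrthogonalEqBot] using this
  have key := norm_sub_sum_le_of_abs_inner_le he hsum s hη (z := hh.toLp h) fun k hk => by
    rw [hinc, hinc, abs_mul, abs_mul, mul_left_comm]
    exact mul_le_mul_of_nonneg_left (hc k hk) (abs_nonneg _)
  have hS : MemLp (sineSum a b s g) 2 μ :=
    memLp_finsetSum' s fun k _ => (memLp_sineMode k).const_smul _
  have hSe : ∑ k ∈ s, inner ℝ (e k) (hg.toLp g) • e k = hS.toLp (sineSum a b s g) := by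
    have h1 : ∀ k, inner ℝ (e k) (hg.toLp g) • e k =
        sineCoeff a b g k • (memLp_sineMode k).toLp (sineMode a b k) := fun k => by
      rw [hinc, show e k = (√c)⁻¹ • (memLp_sineMode k).toLp (sineMode a b k) from rfl, smul_smul]
      congr 1
      field_simp
    simp_rw [h1]
    have h2 : ∀ t : Finset (Fin d → ℕ), ∀ ht : MemLp (sineSum a b t g) 2 μ,
        ∑ k ∈ t, sineCoeff a b g k • (memLp_sineMode k).toLp (sineMode a b k) =
          ht.toLp (sineSum a b t g) := by
      intro t ht
      refine Lp.ext ?_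
      refine (Lp.coeFn_finsetSum t _).trans ?_
      refine EventuallyEq.trans ?_ ht.coeFn_toLp.symm
      have h3 : ∀ᵐ y ∂μ, ∀ k ∈ t, (sineCoeff a b g k • (memLp_sineMode k).toLp (sineMode a b k) :
          Lp ℝ 2 μ) y = sineCoeff a b g k * sineMode a b k y := by
        refine (Finset.eventually_all t).2 fun k _ => ?_
        filter_upwards [Lp.coeFn_smul (sineCoeff a b g k)
          ((memLp_sineMode (a := a) (b := b) k).toLp (sineMode a b k)),
          (memLp_sineMode (a := a) (b := b) k).coeFn_toLp] with y h4 h5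
        rw [h4, Pi.smul_apply, h5, smul_eq_mul]
      filter_upwards [h3] with y hy
      simp only [sineSum, Finset.sum_apply, Pi.smul_apply, smul_eq_mul]
      exact Finset.sum_congr rfl hy
    exact h2 s hS
  rw [hSe, ← MemLp.toLp_sub, Lp.norm_toLp, Lp.norm_toLp] at key
  exact key

end Expansion

section SineCoefficients

variable {d : ℕ} {a b : Fin d → ℝ} {g h w v : E d → ℝ}

theorem prod_half_pos (hab : ∀ j, a j < b j) : 0 < ∏ j, (b j - a j) / 2 :=
  Finset.prod_pos fun j _ => half_pos (sub_pos.2 (hab j))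

theorem integral_sineMode_mul (hab : ∀ j, a j < b j) (g : E d → ℝ) (k : Fin d → ℕ) :
    ∫ y in box a b, sineMode a b k y * g y = (∏ j, (b j - a j) / 2) * sineCoeff a b g k := by
  rw [sineCoeff, mul_inv_cancel_left₀ (prod_half_pos hab).ne']

theorem sineCoeff_sineMode (hab : ∀ j, a j < b j) (k l : Fin d → ℕ) :
    sineCoeff a b (sineMode a b l) k = if k = l then 1 else 0 := by
  rw [sineCoeff, integral_sineMode_mul_sineMode hab]
  split_ifs
  · exact inv_mul_cancel₀ (prod_half_pos hab).ne'
  · exact mul_zero _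

theorem sineCoeff_add (hg : MemLp g 2 (volume.restrict (box a b)))
    (hh : MemLp h 2 (volume.restrict (box a b))) (k : Fin d → ℕ) :
    sineCoeff a b (g + h) k = sineCoeff a b g k + sineCoeff a b h k := by
  simp only [sineCoeff, Pi.add_apply, mul_add]
  rw [integral_add (integrable_mul (memLp_sineMode k) hg) (integrable_mul (memLp_sineMode k) hh),
    mul_add]

theorem sineCoeff_smul (c : ℝ) (g : E d → ℝ) (k : Fin d → ℕ) :
    sineCoeff a b (c • g) k = c * sineCoeff a b g k := by
  simp only [sineCoeff, Pi.smul_apply, smul_eq_mul, mul_left_comm _ c]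
  rw [integral_const_mul]
  ring

theorem continuous_sineSum (s : Finset (Fin d → ℕ)) (g : E d → ℝ) :
    Continuous (sineSum a b s g) := by
  have e : sineSum a b s g = fun y => ∑ k ∈ s, (sineCoeff a b g k • sineMode a b k) y := by
    ext y
    simp [sineSum]
  rw [e]
  exact continuous_finsetSum _ fun k _ =>
    (contDiff_sineMode (a := a) (b := b) k).continuous.const_smul (sineCoeff a b g k)

theorem memH10_sineSum (hab : ∀ j, a j < b j) (s : Finset (Fin d → ℕ)) (g : E d → ℝ) :
    MemH10 (box a b) (sineSum a b s g) :=
  MemH10.sum (isOpen_box a b) (isBounded_box a b) s (memH10_sineMode hab) _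

theorem memLp_sineSum (s : Finset (Fin d → ℕ)) (g : E d → ℝ) :
    MemLp (sineSum a b s g) 2 (volume.restrict (box a b)) :=
  memLp_of_continuous (isOpen_box a b) (isBounded_box a b) (continuous_sineSum s g) 2

theorem energy_sineSum (hab : ∀ j, a j < b j) (s : Finset (Fin d → ℕ)) (g : E d → ℝ)
    (hv : MemH10 (box a b) v) :
    energy (box a b) (sineSum a b s g) v = ∑ k ∈ s, sineCoeff a b g k *
      (eigenvalue a b k * ∫ y in box a b, sineMode a b k y * v y) := by
  rw [sineSum, energy_sum_left (isOpen_box a b) (isBounded_box a b) s (memH10_sineMode hab) _ hv]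
  exact Finset.sum_congr rfl fun k _ => by rw [energy_sineMode hab k hv]

/-- The partial sums are the orthogonal projections in the energy product. -/
theorem energy_sub_sineSum_sineMode (hab : ∀ j, a j < b j) (hw : MemH10 (box a b) w)
    (s : Finset (Fin d → ℕ)) {l : Fin d → ℕ} (hl : l ∈ s) :
    energy (box a b) (w - sineSum a b s w) (sineMode a b l) = 0 := by
  have hS := memH10_sineMode hab l
  rw [energy_sub_left (isOpen_box a b) (isBounded_box a b) hw (memH10_sineSum hab s w) hS,
    energy_comm, energy_sineMode hab l hw, energy_sineSum hab s w hS, integral_sineMode_mul hab,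
    Finset.sum_eq_single l]
  · rw [integral_sineMode_mul hab, sineCoeff_sineMode hab, if_pos rfl]
    ring
  · intro k _ hk
    rw [integral_sineMode_mul hab, sineCoeff_sineMode hab, if_neg hk]
    ring
  · exact fun h => (h hl).elim

theorem energy_sub_sineSum_sineSum (hab : ∀ j, a j < b j) (hw : MemH10 (box a b) w)
    (s : Finset (Fin d → ℕ)) (g : E d → ℝ) :
    energy (box a b) (w - sineSum a b s w) (sineSum a b s g) = 0 := by
  have hΩ := isOpen_box a b
  have hΩb := isBounded_box a b
  have hd := hw.sub hΩ hΩb (memH10_sineSum hab s w)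
  rw [energy_comm]
  conv_lhs => rw [sineSum]
  rw [energy_sum_left hΩ hΩb s (memH10_sineMode hab) _ hd]
  refine Finset.sum_eq_zero fun k hk => ?_
  rw [energy_comm, energy_sub_sineSum_sineMode hab hw s hk, mul_zero]

theorem IsWeakSolution.sineCoeff_eq (hab : ∀ j, a j < b j) (hw : IsWeakSolution (box a b) g w)
    (k : Fin d → ℕ) : sineCoeff a b g k = eigenvalue a b k * sineCoeff a b w k := by
  have h1 := hw.2.2 _ (memH10_sineMode hab k)
  rw [energy_comm, energy_sineMode hab k hw.1] at h1
  simp only [sineCoeff]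
  rw [mul_left_comm, h1]
  simp_rw [mul_comm (g _)]

/-- The expansion of a weak solution converges in the energy norm at least as fast as the expansion
of the data converges in `L²`. -/
theorem exists_energyNorm_sub_sineSum_le (hd : 0 < d) (hab : ∀ j, a j < b j) :
    ∃ C, 0 < C ∧ ∀ g w : E d → ℝ, MemLp g 2 (volume.restrict (box a b)) →
      IsWeakSolution (box a b) g w → ∀ s : Finset (Fin d → ℕ),
        energyNorm (box a b) (w - sineSum a b s w) ≤
          C * l2norm (box a b) (g - sineSum a b s g) := by
  have hΩ := isOpen_box a b
  have hΩb := isBounded_box a b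
  obtain ⟨C, hC0, hC⟩ := exists_poincare_energyNorm hd hΩ hΩb
  refine ⟨C, hC0, fun g w hg hw s => ?_⟩
  have hs := memH10_sineSum hab s w
  have hdiff := hw.1.sub hΩ hΩb hs
  have hkey : ∀ v, MemH10 (box a b) v → energy (box a b) (w - sineSum a b s w) v =
      ∫ y in box a b, (g - sineSum a b s g) y * v y := fun v hv => by
    have e1 : ∀ y, (g - sineSum a b s g) y * v y =
        g y * v y - ∑ k ∈ s, sineCoeff a b g k * (sineMode a b k y * v y) := fun y => by
      simp only [sineSum, Pi.sub_apply, Finset.sum_apply, Pi.smul_apply, smul_eq_mul, sub_mul,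
        Finset.sum_mul, mul_assoc]
    have hi : ∀ k ∈ s, Integrable (fun y => sineCoeff a b g k * (sineMode a b k y * v y))
        (volume.restrict (box a b)) := fun k _ =>
      (integrable_mul (memLp_sineMode k) hv.1.1).const_mul _
    simp_rw [e1]
    rw [integral_sub (integrable_mul hg hv.1.1) (integrable_finsetSum _ hi),
      integral_finsetSum _ hi, energy_sub_left hΩ hΩb hw.1 hs hv, hw.2.2 v hv,
      energy_sineSum hab s w hv]
    congr 1
    refine Finset.sum_congr rfl fun k _ => ?_
    rw [integral_const_mul, hw.sineCoeff_eq hab k]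
    ring
  have h1 := hkey _ hdiff
  rw [← energyNorm_sq] at h1
  have h2 := (le_abs_self _).trans (abs_integral_mul_le (hg.sub (memLp_sineSum s g)) hdiff.1.1)
  have h3 := hC _ hdiff
  have h4 : (0 : ℝ) ≤ l2norm (box a b) (g - sineSum a b s g) := ENNReal.toReal_nonneg
  have h5 : energyNorm (box a b) (w - sineSum a b s w) ^ 2 ≤
      l2norm (box a b) (g - sineSum a b s g) *
        (C * energyNorm (box a b) (w - sineSum a b s w)) := by
    rw [h1]
    exact h2.trans (mul_le_mul_of_nonneg_left h3 h4)
  rcases (energyNorm_nonneg (Ω := box a b) (w - sineSum a b s w)).eq_or_lt with h | h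
  · rw [← h]
    positivity
  · refine le_of_mul_le_mul_right ?_ h
    rw [← sq]
    linarith

/-- The operator `-Δ`. -/
noncomputable def negLaplacian (ψ : E d → ℝ) (y : E d) : ℝ := -Laplacian.laplacian ψ y

theorem IsTest.iterate_negLaplacian {Ω : Set (E d)} {ψ : E d → ℝ} (hψ : IsTest Ω ψ) (s : ℕ) :
    IsTest Ω (negLaplacian^[s] ψ) := by
  induction s generalizing ψ with
  | zero => exact hψ
  | succ s ih =>
    rw [Function.iterate_succ_apply]
    refine ih ?_
    have := hψ.laplacian.const_smul (-1)
    convert this using 1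
    ext y
    simp [negLaplacian]

/-- Each application of `-Δ` multiplies the coefficients by the eigenvalue; no boundary terms occur
for test functions. -/
theorem IsTest.sineCoeff_iterate_negLaplacian (hab : ∀ j, a j < b j) {ψ : E d → ℝ}
    (hψ : IsTest (box a b) ψ) (s : ℕ) (k : Fin d → ℕ) :
    sineCoeff a b (negLaplacian^[s] ψ) k = eigenvalue a b k ^ s * sineCoeff a b ψ k := by
  induction s with
  | zero => simp
  | succ s ih =>
    rw [Function.iterate_succ_apply', pow_succ', mul_assoc, ← ih]
    exact ((hψ.iterate_negLaplacian s).isWeakSolution (isOpen_box a b)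
      (isBounded_box a b)).sineCoeff_eq hab k

end SineCoefficients

/-! ### Approximation by the Fourier basis -/

section SineApproximation

variable {d : ℕ} {a b : Fin d → ℝ} {w v : E d → ℝ}

/-- The multi-indices of the Fourier basis with `N` modes in each direction, counted from `0`. -/
def modes (d N : ℕ) : Finset (Fin d → ℕ) := Fintype.piFinset fun _ => Finset.range N

theorem mem_modes {N : ℕ} {k : Fin d → ℕ} : k ∈ modes d N ↔ ∀ j, k j < N := by
  simp [modes]

theorem sineMode_mem_span {N : ℕ} {k : Fin d → ℕ} (hk : k ∈ modes d N) :
    sineMode a b k ∈ Submodule.span ℝ (range (sineBasis a b N)) :=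
  Submodule.subset_span ⟨fun j => ⟨k j, mem_modes.1 hk j⟩, rfl⟩

theorem sineSum_mem_span {N M : ℕ} (hNM : N ≤ M) (g : E d → ℝ) :
    sineSum a b (modes d N) g ∈ Submodule.span ℝ (range (sineBasis a b M)) :=
  Submodule.sum_mem _ fun _ hk => Submodule.smul_mem _ _ (sineMode_mem_span
    (mem_modes.2 fun j => (mem_modes.1 hk j).trans_le hNM))

theorem sineBasis_eq_sineMode (N : ℕ) (k : Fin d → Fin N) :
    sineBasis a b N k = sineMode a b fun j => k j := rfl

theorem isTrialBasis_sineBasis (hab : ∀ j, a j < b j) (N : ℕ) :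
    IsTrialBasis (box a b) (sineBasis a b N) := by
  refine ⟨fun k => ⟨memH10_sineMode hab _, (contDiff_sineMode _).continuous.continuousOn⟩, ?_⟩
  rw [Fintype.linearIndependent_iff]
  intro c hc l
  have h0 : ∀ y ∈ box a b, ∑ k, c k * (sineBasis a b N l y * sineBasis a b N k y) = 0 := by
    intro y hy
    have := congrFun hc ⟨y, hy⟩
    simp only [Finset.sum_apply, Pi.smul_apply, smul_eq_mul, Pi.zero_apply] at this
    simp_rw [mul_left_comm (c _)]
    rw [← Finset.mul_sum, this, mul_zero]
  have h1 : ∫ y in box a b, ∑ k, c k * (sineBasis a b N l y * sineBasis a b N k y) = 0 := by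
    rw [setIntegral_congr_fun (isOpen_box a b).measurableSet h0]
    simp
  simp_rw [sineBasis_eq_sineMode] at h1
  rw [integral_finsetSum _ fun k _ =>
    (integrable_mul (memLp_sineMode _) (memLp_sineMode _)).const_mul _] at h1
  simp_rw [integral_const_mul, integral_sineMode_mul_sineMode hab] at h1
  rw [Finset.sum_eq_single l] at h1
  · rw [if_pos rfl] at h1
    exact (mul_eq_zero.1 h1).resolve_right (prod_half_pos hab).ne'
  · intro k _ hk
    rw [if_neg, mul_zero]
    exact fun h => hk (funext fun j => Fin.ext (congrFun h j).symm)
  · exact fun h => (h (Finset.mem_univ l)).elim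

theorem sineSum_eq_self (hab : ∀ j, a j < b j) {N : ℕ}
    (hv : v ∈ Submodule.span ℝ (range (sineBasis a b N))) : sineSum a b (modes d N) v = v := by
  have hL : ∀ v ∈ Submodule.span ℝ (range (sineBasis a b N)),
      MemLp v 2 (volume.restrict (box a b)) := fun v hv =>
    ((isTrialBasis_sineBasis hab N).of_mem_span (isOpen_box a b) (isBounded_box a b) hv).1.1.1
  induction hv using Submodule.span_induction with
  | mem v h =>
    obtain ⟨k, rfl⟩ := h
    rw [sineBasis_eq_sineMode, sineSum, Finset.sum_eq_single fun j => (k j : ℕ)]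
    · rw [sineCoeff_sineMode hab, if_pos rfl, one_smul]
    · intro l _ hl
      rw [sineCoeff_sineMode hab, if_neg hl, zero_smul]
    · exact fun h => (h (mem_modes.2 fun j => (k j).2)).elim
  | zero => simp [sineSum, sineCoeff]
  | add v w hv' hw' hv hw =>
    conv_rhs => rw [← hv, ← hw]
    simp only [sineSum, sineCoeff_add (hL v hv') (hL w hw'), add_smul, Finset.sum_add_distrib]
  | smul c v _ hv =>
    conv_rhs => rw [← hv]
    simp only [sineSum, sineCoeff_smul, Finset.smul_sum, mul_smul]

/-- An inverse inequality: point evaluation on the trial space, relative to the energy norm, grows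
at most like the number of modes. -/
theorem exists_abs_le_energyNorm (hd : 0 < d) (hab : ∀ j, a j < b j) :
    ∃ C, 0 < C ∧ ∀ N, ∀ v ∈ Submodule.span ℝ (range (sineBasis a b N)), ∀ y,
      |v y| ≤ C * (N : ℝ) ^ d * energyNorm (box a b) v := by
  have hΩ := isOpen_box a b
  have hΩb := isBounded_box a b
  obtain ⟨C, hC0, hC⟩ := exists_poincare_energyNorm hd hΩ hΩb
  set c := ∏ j, (b j - a j) / 2 with hc
  have hc0 : 0 < c := prod_half_pos hab
  refine ⟨c⁻¹ * (√c * C), by positivity, fun N v hv y => ?_⟩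
  have hv0 := ((isTrialBasis_sineBasis hab N).of_mem_span hΩ hΩb hv).1
  have hS : ∀ k, l2norm (box a b) (sineMode a b k) = √c := fun k => by
    have h1 := integral_inner_self (memLp_sineMode (a := a) (b := b) k)
    have h2 := integral_sineMode_mul_sineMode hab k k
    rw [if_pos rfl] at h2
    have h3 : l2norm (box a b) (sineMode a b k) ^ 2 = c := by
      rw [l2norm, ← h1, hc, ← h2]
      refine integral_congr_ae (.of_forall fun y => ?_)
      simp [sq]
    rw [← h3]
    exact (Real.sqrt_sq ENNReal.toReal_nonneg).symm
  have hcoef : ∀ k, |sineCoeff a b v k| ≤ c⁻¹ * (√c * C) * energyNorm (box a b) v := fun k => by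
    rw [sineCoeff, abs_mul, abs_of_pos (inv_pos.2 hc0), mul_assoc, mul_assoc, ← hS k]
    refine mul_le_mul_of_nonneg_left ?_ (inv_pos.2 hc0).le
    exact (abs_integral_mul_le (memLp_sineMode k) hv0.1.1).trans
      (mul_le_mul_of_nonneg_left (hC v hv0) ENNReal.toReal_nonneg)
  rw [← sineSum_eq_self hab hv]
  conv_rhs => rw [sineSum_eq_self hab hv]
  simp only [sineSum, Finset.sum_apply, Pi.smul_apply, smul_eq_mul]
  refine (Finset.abs_sum_le_sum_abs _ _).trans ?_
  have hle : ∀ k ∈ modes d N, |sineCoeff a b v k * sineMode a b k y| ≤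
      c⁻¹ * (√c * C) * energyNorm (box a b) v := fun k _ => by
    rw [abs_mul]
    exact (mul_le_of_le_one_right (abs_nonneg _) (abs_sineMode_le_one k y)).trans (hcoef k)
  refine (Finset.sum_le_card_nsmul _ _ _ hle).trans (le_of_eq ?_)
  rw [modes, Fintype.card_piFinset_const, Finset.card_range, nsmul_eq_mul]
  push_cast
  ring

/-- The Fourier expansion of a weak solution with data in `C_c^∞` converges in the energy norm
faster than any power of the number of modes. -/
theorem exists_energyNorm_sub_sineSum_modes_le (hd : 0 < d) (hab : ∀ j, a j < b j)
    {g : E d → ℝ} (hg : IsTest (box a b) g) (hw : IsWeakSolution (box a b) g w) (s : ℕ) :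
    ∃ B, 0 ≤ B ∧ ∀ N : ℕ, energyNorm (box a b) (w - sineSum a b (modes d N) w) ≤
      B * ((((N : ℝ) + 1) ^ 2)⁻¹) ^ s := by
  obtain ⟨C, hC0, hC⟩ := exists_energyNorm_sub_sineSum_le hd hab
  obtain ⟨κ, hκ0, hκ⟩ := exists_le_eigenvalue hab
  refine ⟨C * (κ⁻¹ ^ s * l2norm (box a b) (negLaplacian^[s] g)),
    mul_nonneg hC0.le (mul_nonneg (by positivity) ENNReal.toReal_nonneg), fun N => ?_⟩
  refine (hC g w (hg.memLp 2) hw _).trans ?_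
  rw [mul_assoc]
  refine mul_le_mul_of_nonneg_left ?_ hC0.le
  refine (l2norm_sub_sineSum_le hab (hg.memLp 2) ((hg.iterate_negLaplacian s).memLp 2) _
    (η := ((κ * ((N : ℝ) + 1) ^ 2)⁻¹) ^ s) (by positivity) fun k hk => ?_).trans (le_of_eq ?_)
  -- off `modes d N` the eigenvalues are at least `κ (N + 1)²`
  · obtain ⟨j, hj⟩ : ∃ j, N ≤ k j := by
      by_contra! h
      exact hk (mem_modes.2 h)
    have hN : (N : ℝ) ≤ k j := by exact_mod_cast hj
    have h1 : κ * ((N : ℝ) + 1) ^ 2 ≤ eigenvalue a b k := le_trans (by gcongr) (hκ k j)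
    have h0 : 0 < κ * ((N : ℝ) + 1) ^ 2 := by positivity
    have hl := eigenvalue_pos hd hab k
    rw [hg.sineCoeff_iterate_negLaplacian hab, abs_mul, abs_of_pos (pow_pos hl s), ← mul_assoc,
      ← mul_pow]
    refine le_mul_of_one_le_left (abs_nonneg _) (one_le_pow₀ ?_)
    rw [inv_mul_eq_div, one_le_div h0]
    exact h1
  · rw [mul_inv, mul_pow]
    ring

theorem tendsto_inv_add_one_sq : Tendsto (fun N : ℕ => (((N : ℝ) + 1) ^ 2)⁻¹) atTop (𝓝 0) :=
  tendsto_inv_atTop_zero.comp ((tendsto_pow_atTop two_ne_zero).comp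
    (tendsto_natCast_atTop_atTop.atTop_add tendsto_const_nhds))

/-- Completeness: test functions are dense in `H¹₀`, and their expansions converge rapidly. -/
theorem isCompleteFamily_sineBasis (hd : 0 < d) (hab : ∀ j, a j < b j) :
    IsCompleteFamily (box a b) (sineBasis a b) := by
  have hΩ := isOpen_box a b
  have hΩb := isBounded_box a b
  intro w hw
  refine ⟨fun N => sineSum a b (modes d N) w, fun N => sineSum_mem_span le_rfl w, ?_⟩
  rw [Metric.tendsto_atTop]
  intro ε hε
  obtain ⟨ψ, hψ, -, hψ2⟩ := (hw.isH0 hΩ).approx (ENNReal.ofReal (ε / 2))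
    (ENNReal.ofReal_pos.2 (half_pos hε))
  have hψ0 := hψ.memH10 hΩ hΩb
  have hwψ : energyNorm (box a b) (w - ψ) ≤ ε / 2 := by
    rw [((hw.isH0 hΩ).sub hΩ hΩb hψ.isH0).energyNorm_eq hΩ hΩb]
    exact ENNReal.toReal_le_of_le_ofReal (half_pos hε).le hψ2
  have hψw := hψ.isWeakSolution hΩ hΩb
  have hψt : IsTest (box a b) fun y => -Laplacian.laplacian ψ y := hψ.iterate_negLaplacian 1
  obtain ⟨B, hB0, hB⟩ := exists_energyNorm_sub_sineSum_modes_le hd hab hψt hψw 1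
  have hlim : Tendsto (fun N : ℕ => B * ((((N : ℝ) + 1) ^ 2)⁻¹) ^ 1) atTop (𝓝 0) := by
    simpa using tendsto_inv_add_one_sq.const_mul B
  obtain ⟨N0, hN0⟩ := eventually_atTop.1 (hlim.eventually_lt_const (half_pos hε))
  refine ⟨N0, fun N hN => ?_⟩
  rw [Real.dist_eq, sub_zero, abs_of_nonneg (energyNorm_nonneg _)]
  have hs := memH10_sineSum hab (modes d N) ψ
  -- the partial sum of `w` is at least as close to `w` as the partial sum of `ψ`
  have hcea := energyNorm_sub_le_of_orthogonal hΩ hΩb hw (memH10_sineSum hab (modes d N) w) hs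
    (energy_sub_sineSum_sineSum hab hw _ w) (energy_sub_sineSum_sineSum hab hw _ ψ)
  have htri := energyNorm_add_le hΩ hΩb (hw.sub hΩ hΩb hψ0) (hψ0.sub hΩ hΩb hs)
  rw [sub_add_sub_cancel] at htri
  linarith [hB N, hN0 N hN]

/-- Functions that converge to `w` in the energy norm and whose increments are uniformly summable
converge to the continuous function `w` pointwise. -/
theorem tendsto_of_summable_increments (hd : 0 < d) {Ω : Set (E d)} (hΩ : IsOpen Ω)
    (hΩb : Bornology.IsBounded Ω) (hw : MemH10 Ω w) (hwc : ContinuousOn w Ω) {v : ℕ → E d → ℝ}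
    (hv : ∀ N, MemH10 Ω (v N)) (hvc : ∀ N, ContinuousOn (v N) Ω)
    (hlim : Tendsto (fun N => energyNorm Ω (w - v N)) atTop (𝓝 0)) {r : ℕ → ℝ} (hr : Summable r)
    (hstep : ∀ N, ∀ y ∈ Ω, |v N y - v (N + 1) y| ≤ r N) {y : E d} (hy : y ∈ Ω) :
    Tendsto (fun N => v N y) atTop (𝓝 (w y)) := by
  have hcs : ∀ y ∈ Ω, ∃ l, Tendsto (fun N => v N y) atTop (𝓝 l) := fun y hy =>
    cauchySeq_tendsto_of_complete (cauchySeq_of_dist_le_of_summable r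
      (fun N => by rw [Real.dist_eq]; exact hstep N y hy) hr)
  choose! W hW using hcs
  have hunif : TendstoUniformlyOn v W atTop Ω := by
    rw [Metric.tendstoUniformlyOn_iff]
    intro ε hε
    filter_upwards [(tendsto_sum_nat_add r).eventually_lt_const hε] with N hN z hz
    rw [dist_comm]
    refine lt_of_le_of_lt ?_ hN
    have := dist_le_tsum_of_dist_le_of_tendsto r
      (fun N => by rw [Real.dist_eq]; exact hstep N z hz) hr (hW z hz) N
    simpa [add_comm] using this
  have hWc : ContinuousOn W Ω := hunif.continuousOn (Eventually.of_forall hvc).frequently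
  obtain ⟨C, hC0, hC⟩ := exists_poincare_energyNorm hd hΩ hΩb
  have hL2 : Tendsto (fun N => eLpNorm (v N - w) 2 (volume.restrict Ω)) atTop (𝓝 0) := by
    have h1 : Tendsto (fun N => ENNReal.ofReal (C * energyNorm Ω (w - v N))) atTop (𝓝 0) := by
      simpa using ENNReal.tendsto_ofReal (hlim.const_mul C)
    refine tendsto_of_tendsto_of_tendsto_of_le_of_le tendsto_const_nhds h1 (fun _ => zero_le)
      fun N => ?_
    have hm := hw.sub hΩ hΩb (hv N)
    rw [← neg_sub w (v N), eLpNorm_neg, ← ENNReal.ofReal_toReal hm.1.1.2.ne]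
    exact ENNReal.ofReal_le_ofReal (hC _ hm)
  obtain ⟨ns, hns, hae⟩ := (tendstoInMeasure_of_tendsto_eLpNorm two_ne_zero
    (fun N => (hv N).1.1.1) hw.1.1.1 hL2).exists_seq_tendsto_ae
  -- the uniform limit and the `L²` limit agree almost everywhere, hence everywhere by continuity
  have heq : W =ᵐ[volume.restrict Ω] w := by
    filter_upwards [hae, ae_restrict_mem hΩ.measurableSet] with z hz hzΩ
    exact tendsto_nhds_unique ((hW z hzΩ).comp hns.tendsto_atTop) hz
  rw [← Measure.eqOn_open_of_ae_eq heq hΩ hWc hwc hy]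
  exact hW y hy

/-- With `K_N` of size `N ^ d` from the inverse inequality, the rapid convergence of the expansion
of a weak solution with data in `C_c^∞` absorbs `K_N`, and makes the partial sums converge
pointwise. -/
theorem approximatesAt_sineBasis (hd : 0 < d) (hab : ∀ j, a j < b j) {y : E d}
    (hy : y ∈ box a b) : ApproximatesAt (box a b) (sineBasis a b) y := by
  have hΩ := isOpen_box a b
  have hΩb := isBounded_box a b
  obtain ⟨C, hC0, hC⟩ := exists_abs_le_energyNorm hd hab
  refine ⟨fun N => C * (N : ℝ) ^ d, fun N v hv => hC N v hv y, fun g w hg hw => ?_⟩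
  obtain ⟨B, hB0, hB⟩ := exists_energyNorm_sub_sineSum_modes_le hd hab hg hw (d + 1)
  -- the power `d + 1` leaves a summable factor after the growth `N ^ d` is absorbed
  have hq : ∀ N : ℕ, ((N : ℝ) + 1) ^ d * ((((N : ℝ) + 1) ^ 2)⁻¹) ^ (d + 1) ≤
      (((N : ℝ) + 1) ^ 2)⁻¹ := fun N => by
    have h1 : (1 : ℝ) ≤ (N : ℝ) + 1 := by simp
    rw [pow_succ, ← mul_assoc, ← mul_pow]
    refine mul_le_of_le_one_left (by positivity) (pow_le_one₀ (by positivity) ?_)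
    rw [← div_eq_mul_inv, div_le_one (by positivity)]
    nlinarith
  have hs := fun N => memH10_sineSum hab (modes d N) w
  have hlim : Tendsto (fun N : ℕ => energyNorm (box a b) (w - sineSum a b (modes d N) w)) atTop
      (𝓝 0) := by
    refine squeeze_zero (fun _ => energyNorm_nonneg _) hB ?_
    have := (tendsto_inv_add_one_sq.pow (d + 1)).const_mul B
    simpa using this
  refine ⟨fun N => sineSum a b (modes d N) w, fun N => sineSum_mem_span le_rfl w, ?_, ?_⟩
  · have hsum : Summable fun N : ℕ => C * (2 * B) * (((N : ℝ) + 1) ^ 2)⁻¹ := by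
      have := (summable_nat_add_iff 1).2 (Real.summable_nat_pow_inv.2 one_lt_two)
      push_cast at this
      exact this.mul_left _
    -- the increments lie in the trial space, where the inverse inequality bounds them
    refine tendsto_of_summable_increments hd hΩ hΩb hw.1 hw.2.1 hs
      (fun N => (continuous_sineSum _ _).continuousOn) hlim hsum (fun N z _ => ?_) hy
    have h1 := hC (N + 1) (sineSum a b (modes d N) w - sineSum a b (modes d (N + 1)) w)
      (Submodule.sub_mem _ (sineSum_mem_span N.le_succ w) (sineSum_mem_span le_rfl w)) z
    rw [Pi.sub_apply] at h1
    refine h1.trans ?_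
    have h2 := energyNorm_add_le hΩ hΩb ((hs N).sub hΩ hΩb hw.1) (hw.1.sub hΩ hΩb (hs (N + 1)))
    rw [sub_add_sub_cancel, energyNorm_sub_comm hΩ hΩb (hs N) hw.1] at h2
    have h3 := hB N
    have h4 := hB (N + 1)
    have h5 : B * ((((((N + 1 : ℕ) : ℝ)) + 1) ^ 2)⁻¹) ^ (d + 1) ≤
        B * ((((N : ℝ) + 1) ^ 2)⁻¹) ^ (d + 1) := by
      push_cast
      gcongr
      linarith
    have h6 : energyNorm (box a b) (sineSum a b (modes d N) w - sineSum a b (modes d (N + 1)) w) ≤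
        2 * B * ((((N : ℝ) + 1) ^ 2)⁻¹) ^ (d + 1) := by linarith
    push_cast
    calc _ ≤ C * ((N : ℝ) + 1) ^ d * (2 * B * ((((N : ℝ) + 1) ^ 2)⁻¹) ^ (d + 1)) := by gcongr
      _ = C * (2 * B) * (((N : ℝ) + 1) ^ d * ((((N : ℝ) + 1) ^ 2)⁻¹) ^ (d + 1)) := by ring
      _ ≤ _ := mul_le_mul_of_nonneg_left (hq N) (by positivity)
  · have ht : Tendsto (fun N : ℕ => C * B * (((N : ℝ) + 1) ^ 2)⁻¹) atTop (𝓝 0) := by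
      simpa using tendsto_inv_add_one_sq.const_mul (C * B)
    refine squeeze_zero (fun N => mul_nonneg (by positivity) (energyNorm_nonneg _))
      (fun N => ?_) ht
    calc _ ≤ C * ((N : ℝ) + 1) ^ d * (B * ((((N : ℝ) + 1) ^ 2)⁻¹) ^ (d + 1)) := by
          have hN : (N : ℝ) ^ d ≤ ((N : ℝ) + 1) ^ d := by gcongr; linarith
          have := energyNorm_nonneg (Ω := box a b) (w - sineSum a b (modes d N) w)
          exact mul_le_mul (mul_le_mul_of_nonneg_left hN hC0.le) (hB N) this (by positivity)
      _ = C * B * (((N : ℝ) + 1) ^ d * ((((N : ℝ) + 1) ^ 2)⁻¹) ^ (d + 1)) := by ring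
      _ ≤ _ := mul_le_mul_of_nonneg_left (hq N) (by positivity)

end SineApproximation

end RitzGalerkin

open RitzGalerkin
theorem theorem1 {d n : ℕ} (hd : 0 < d) (hn : 0 < n) (Ω : Set (E d)) (hΩ : IsOpen Ω)
    (hΩb : Bornology.IsBounded Ω) (x : Fin n → E d) (hx : ∀ i, x i ∈ Ω) (f : E d → ℝ) :
    ∃ u : E d → ℝ,
      -- `u` is the unique solution of the Dirichlet problem with Dirac source
      (IsDeltaSolution Ω x f u ∧
        ∀ u', IsDeltaSolution Ω x f u' → u' =ᵐ[volume.restrict Ω] u) ∧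
      -- the equation holds in the sense of distributions
      (∀ ψ, IsTest Ω ψ → ∫ y in Ω, u y * (-(Laplacian.laplacian ψ y)) = sampleSum x f ψ) ∧
      -- away from the sample points `u` lies in `H¹₀` and is continuous
      (∀ χ, IsTest Ω χ → (∀ i, ∀ᶠ y in 𝓝 (x i), χ y = 1) → MemH10 Ω (fun y => (1 - χ y) * u y)) ∧
      ContinuousOn u (Ω \ range x) ∧
      -- the Ritz–Galerkin solutions with sampled right-hand side approximate `u`
      (∀ (ι : ℕ → Type) [∀ N, Fintype (ι N)] (φ : ∀ N, ι N → E d → ℝ),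
        (∀ N, IsTrialBasis Ω (φ N)) →
          (∀ N, ∃! c : ι N → ℝ, IsRGCoeff Ω x f (φ N) c) ∧
          ∀ c : ∀ N, ι N → ℝ, (∀ N, IsRGCoeff Ω x f (φ N) (c N)) →
            ((∀ i, ApproximatesAt Ω φ (x i)) → ∀ g, IsTest Ω g →
              Tendsto (fun N => ∫ y in Ω, (∑ k, c N k • φ N k) y * g y) atTop
                (𝓝 (∫ y in Ω, u y * g y))) ∧
            (d = 1 → IsCompleteFamily Ω φ →
              Tendsto (fun N => energyNorm Ω (u - ∑ k, c N k • φ N k)) atTop (𝓝 0) ∧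
              TendstoUniformlyOn (fun N => ∑ k, c N k • φ N k) u atTop Ω)) ∧
      -- the Fourier basis on a box, in any dimension, is such a basis
      (∀ a b : Fin d → ℝ, Ω = {y | ∀ j, y j ∈ Ioo (a j) (b j)} →
        (∀ N, IsTrialBasis Ω (sineBasis a b N)) ∧ IsCompleteFamily Ω (sineBasis a b) ∧
          ∀ y ∈ Ω, ApproximatesAt Ω (sineBasis a b) y) ∧
      -- one dimension: `u` is the `H¹₀` weak solution, and explicit on an interval
      (d = 1 →
        (MemH10 Ω u ∧ ∀ v, MemH10 Ω v → ContinuousOn v Ω → energy Ω u v = sampleSum x f v) ∧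
        ∀ a b : ℝ, Ω = {y | y ⟨0, hd⟩ ∈ Ioo a b} → ∀ y ∈ Ω,
          u y = (1 / (n : ℝ)) * ∑ i, f (x i) * (b - x i ⟨0, hd⟩) *
                ((y ⟨0, hd⟩ - a) / (b - a)) -
              (1 / (n : ℝ)) * ∑ i, f (x i) * (y ⟨0, hd⟩ - x i ⟨0, hd⟩) *
                heaviside (y ⟨0, hd⟩ - x i ⟨0, hd⟩)) ∧
      -- two dimensions: `u` is singular at the sample points
      (d = 2 → ∀ i, f (x i) ≠ 0 → Tendsto (fun y => |u y|) (𝓝[≠] (x i)) atTop) := by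
  choose! 𝒢 h𝒢 using fun z (hz : z ∈ Ω) => exists_isGreenFunction hd hΩ hΩb hz
  have hu := isDeltaSolution_sampleCombination (f := f) hx h𝒢
  refine ⟨sampleCombination x f 𝒢, ⟨hu, fun u' hu' => hu.ae_eq hd hΩ hΩb hu'⟩,
    fun ψ hψ => hu.integral_laplacian hΩ hΩb hψ,
    fun χ hχ h1 => memH10_one_sub_mul_sampleCombination hΩ hΩb hx h𝒢 hχ h1,
    continuousOn_sampleCombination hx h𝒢, fun ι _ φ hφ => ⟨fun N => ?_, fun c hc => ⟨?_, ?_⟩⟩,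
    fun a b hab => ?_, fun hd1 => ⟨?_, fun a b hab y hy => ?_⟩,
    fun hd2 i hi => tendsto_abs_sampleCombination hd2 hn hx h𝒢 i hi⟩
  · exact (hφ N).existsUnique hd hΩ hΩb fun j => sampleSum x f (φ N j)
  · exact fun happ g hg => tendsto_integral_galerkin hd hΩ hΩb hu hφ happ hc hg
  · intro hd1 hcomp
    obtain ⟨h1, h2⟩ := energy_sampleCombination (f := f) hd1 hΩ hΩb hx h𝒢
    exact tendsto_galerkin_of_dim_one hd1 hΩ hΩb h1
      (continuousOn_sampleCombination_of_dim_one hd1 hx h𝒢) h2 hφ hcomp hc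
  · -- the box is not empty, since it contains a sample point
    have hlt : ∀ j, a j < b j := fun j => by
      have := hx ⟨0, hn⟩
      rw [hab] at this
      exact (this j).1.trans (this j).2
    have hbox : Ω = box a b := hab
    subst hbox
    exact ⟨isTrialBasis_sineBasis hlt, isCompleteFamily_sineBasis hd hlt,
      fun y hy => approximatesAt_sineBasis hd hlt hy⟩
  · exact energy_sampleCombination hd1 hΩ hΩb hx h𝒢
  · obtain ⟨h1, h2⟩ := energy_sampleCombination (f := f) hd1 hΩ hΩb hx h𝒢
    have h3 := continuousOn_sampleCombination_of_dim_one (f := f) hd1 hx h𝒢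
    subst hd1
    exact eq_sum_hat_of_energy_eq hΩ hΩb hab h1 h3 h2 hy
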